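/- Let $b\ge 2$ be an integer. For $n\ge 0$ let $T_n$ be the rooted $b$-ary tree of height $n$ (every non-leaf vertex has exactly $b$ children and all leaves are at distance $n$ from the root), and let $L_n$ be its set of $b^n$ leaves. The height of a vertex is its distance to the nearest leaf; every vertex is a descendant (and an ancestor) of itself. For $\lambda\ge 0$ the Poisson particle model $\Gamma_n(\lambda)$ is the random multigraph with vertex set $L_n$ obtained as follows: at the leaves start independent $\mathrm{Po}(\lambda/2)$ numbers of particles; the particles perform independent simple random walks on $T_n$, each stopped at its first return (at a positive time) to $L_n$; each particle contributes one edge, joining its starting leaf to the leaf at which it is stopped. For $k\ge 0$ let $D_k$ be the event that some vertex $v$ of $T_n$ has height $k$ and no edge of $\Gamma_n(\lambda)$ joins a leaf descending from $v$ to a leaf not descending from $v$. Let $C_k$ be the event that there are a component of $\Gamma_n(\lambda)$ and a vertex of $T_n$ of height $k$ that is a common ancestor of all the vertices of that component. A vertex of $\Gamma_n(\lambda)$ is isolated if no edge joins it to another vertex. We say that $\lambda=\sigma n$ is a sharp threshold for the disappearance (respectively, appearance) of a property if for every $\varepsilon>0$ and every sequence $\lambda_n\ge 0$ the following holds as $n\to\infty$: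 if $\lambda_n\le(1-\varepsilon)\sigma n$ for all large $n$, then the probability that $\Gamma_n(\lambda_n)$ has the property tends to $1$ (respectively, $0$); and if $\lambda_n\ge(1+\varepsilon)\sigma n$ for all large $n$, then this probability tends to $0$ (respectively, $1$). Theorem. There are real numbers $0<\sigma_0<\sigma_1<\sigma_2<\cdots$, depending only on $b$, with $$\lim_{k\to\infty}\sigma_k=\sigma_{\mathrm{crit}}:=\frac{b+1}{b-1}\log b,$$ such that: (a) for every $k\ge 0$, $\lambda=\sigma_k n$ is a sharp threshold for the disappearance of $C_k$ and for the disappearance of $D_k$; (b) $\lambda=\sigma_{\mathrm{crit}}n$ is a sharp threshold for the appearance of connectedness of $\Gamma_n(\lambda)$; (c) for every $k\ge 0$ there is $c>0$ such that, for $\lambda=\sigma_k n$ and all sufficiently large $n$, both $\mathbb P(C_k)$ and $\mathbb P(D_k)$ lie in $[c,1-c]$. In particular, $\lambda=\sigma_0 n$ is a sharp threshold for the disappearance of isolated vertices, and $\sigma_0<\sigma_{\mathrm{crit}}$, so that the sharp thresholds for isolated vertices and for connectedness do not coincide. -/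

import Mathlib

open MeasureTheory ProbabilityTheory Filter Topology
open scoped NNReal Graph

noncomputable section

/-! ### The `b`-ary tree `T_n` -/

/-- The vertices of the `b`-ary tree `T_n` of height `n`: words of length at most `n` over an
alphabet with `b` letters. The empty word is the apex and the parent of `a :: l` is `l`. -/
def TreeVertex (b n : ℕ) : Type := {l : List (Fin b) // l.length ≤ n}

instance (b n : ℕ) : Finite (TreeVertex b n) :=
  (List.finite_length_le (Fin b) n).to_subtype

instance (b n : ℕ) : MeasurableSpace (TreeVertex b n) := ⊤

instance (b n : ℕ) : DiscreteMeasurableSpace (TreeVertex b n) := ⟨fun _ => trivial⟩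

namespace TreeVertex

variable {b n : ℕ}

/-- `v.IsParent u` means that `u` is the parent of `v`. -/
def IsParent (v u : TreeVertex b n) : Prop := ∃ a : Fin b, v.1 = a :: u.1

/-- The height of a vertex, that is, its distance to the nearest leaf. -/
def height (v : TreeVertex b n) : ℕ := n - v.1.length

/-- `x.IsDescendant y`: there is a path from `x` to `y`, possibly of length `0`, in which each
vertex except the first is the parent of the previous one. -/
def IsDescendant (x y : TreeVertex b n) : Prop := Relation.ReflTransGen IsParent x y

end TreeVertex

/-- The tree `T_n`. -/
def tree (b n : ℕ) : SimpleGraph (TreeVertex b n) :=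
  SimpleGraph.fromRel TreeVertex.IsParent

/-- The set `L_n` of leaves of `T_n`. -/
def Leaf (b n : ℕ) : Type := {v : TreeVertex b n // v.height = 0}

/-! ### Simple random walk -/

/-- The law of one step of simple random walk from `v`: a uniformly random neighbour of `v`.
(At a vertex without neighbours, which occurs only for the one-vertex tree, the walk stays put.) -/
def stepLaw {V : Type} [MeasurableSpace V] (G : SimpleGraph V) (v : V) : Measure V :=
  open Classical in
  if (G.neighborSet v).Nonempty then uniformOn (G.neighborSet v) else Measure.dirac v

/-- The transition kernel of simple random walk on `G`. -/
def stepKernel {V : Type} [MeasurableSpace V] [DiscreteMeasurableSpace V] (G : SimpleGraph V) :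
    Kernel V V :=
  ⟨stepLaw G, Measurable.of_discrete⟩

instance {V : Type} [Finite V] [MeasurableSpace V] [DiscreteMeasurableSpace V]
    (G : SimpleGraph V) : IsMarkovKernel (stepKernel G) := by
  refine ⟨fun v => ?_⟩
  change IsProbabilityMeasure (stepLaw G v)
  unfold stepLaw
  split_ifs with h
  · exact isProbabilityMeasure_uniformOn (Set.toFinite _) h
  · infer_instance

/-- The transition kernel at time `m`, as a function of the whole trajectory up to time `m`; it
depends on the current position only. -/
def historyKernel {V : Type} [MeasurableSpace V] [DiscreteMeasurableSpace V] (G : SimpleGraph V)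
    (m : ℕ) : Kernel (Finset.Iic m → V) V :=
  (stepKernel G).comap (fun w => w ⟨m, Finset.mem_Iic.2 le_rfl⟩) (measurable_pi_apply _)

instance {V : Type} [Finite V] [MeasurableSpace V] [DiscreteMeasurableSpace V]
    (G : SimpleGraph V) (m : ℕ) : IsMarkovKernel (historyKernel G m) := by
  unfold historyKernel
  infer_instance

/-- The law, on trajectories `ℕ → V`, of simple random walk on `G` started at `v`. -/
def walkLaw {V : Type} [Finite V] [MeasurableSpace V] [DiscreteMeasurableSpace V]
    (G : SimpleGraph V) (v : V) : Measure (ℕ → V) :=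
  Kernel.traj (X := fun _ => V) (historyKernel G) 0 (fun _ => v)

instance {V : Type} [Finite V] [MeasurableSpace V] [DiscreteMeasurableSpace V]
    (G : SimpleGraph V) (v : V) : IsProbabilityMeasure (walkLaw G v) := by
  unfold walkLaw
  infer_instance

/-! ### The Poisson particle model -/

/-- An outcome of the random experiment: for every leaf `x`, the number of particles started at
`x` and a sequence of trajectories, the `i`-th of which is followed by the `i`-th particle
started at `x` (if there are more than `i` of them). -/
abbrev ParticleOutcome (b n : ℕ) : Type := Leaf b n → ℕ × (ℕ → ℕ → TreeVertex b n)

/-- The law of the experiment with parameter `lam`: the numbers of particles are Poisson with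
mean `lam / 2`, the trajectories are simple random walks on `T_n`, all independent. -/
def particleLaw (b n : ℕ) (lam : ℝ≥0) : Measure (ParticleOutcome b n) :=
  Measure.infinitePi fun x : Leaf b n =>
    (poissonMeasure (lam / 2)).prod (Measure.infinitePi fun _ : ℕ => walkLaw (tree b n) x.1)

/-- The trajectory `w` makes its first return to the set of leaves (at a positive time) at the
leaf `y`. -/
def ReturnsAt {b n : ℕ} (w : ℕ → TreeVertex b n) (y : Leaf b n) : Prop :=
  ∃ t, 1 ≤ t ∧ w t = y.1 ∧ ∀ s, 1 ≤ s → s < t → (w s).height ≠ 0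

lemma ReturnsAt.unique {b n : ℕ} {w : ℕ → TreeVertex b n} {y z : Leaf b n}
    (hy : ReturnsAt w y) (hz : ReturnsAt w z) : y = z := by
  obtain ⟨t, ht, hty, hmin⟩ := hy
  obtain ⟨t', ht', htz, hmin'⟩ := hz
  have h : t = t' := by
    rcases lt_trichotomy t t' with h | h | h
    · exact absurd (by rw [hty]; exact y.2) (hmin' t ht h)
    · exact h
    · exact absurd (by rw [htz]; exact z.2) (hmin t' ht' h)
  subst h
  exact Subtype.ext (hty.symm.trans htz)

/-- The random multigraph: its vertices are the leaves of `T_n`, and the `i`-th particle started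
at `x` is an edge `(x, i)` joining `x` to the leaf at which the walk of the particle is stopped.
(Almost surely, every walk is stopped.) -/
def particleGraph {b n : ℕ} (ω : ParticleOutcome b n) : Graph (Leaf b n) (Leaf b n × ℕ) where
  vertexSet := Set.univ
  IsLink e y z := e.2 < (ω e.1).1 ∧
    ((y = e.1 ∧ ReturnsAt ((ω e.1).2 e.2) z) ∨ (z = e.1 ∧ ReturnsAt ((ω e.1).2 e.2) y))
  isLink_symm := fun _ _ => ⟨fun _ _ h => ⟨h.1, h.2.symm⟩⟩
  eq_or_eq_of_isLink_of_isLink := by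
    rintro e x y v w ⟨-, h⟩ ⟨-, h'⟩
    rcases h with ⟨h1, h2⟩ | ⟨h1, h2⟩ <;> rcases h' with ⟨h3, h4⟩ | ⟨h3, h4⟩
    · exact Or.inl (h1.trans h3.symm)
    · exact Or.inr (h1.trans h3.symm)
    · exact Or.inr (h2.unique h4)
    · exact Or.inl (h2.unique h4)
  left_mem_of_isLink := fun _ _ _ _ => Set.mem_univ _

/-! ### Components, connectedness, and the events of interest -/

/-- `C` is (the vertex set of) a component of the multigraph `G`. -/
def IsComponent {α β : Type} (G : Graph α β) (C : Set α) : Prop :=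
  ∃ x ∈ V(G), C = {y | Relation.ReflTransGen G.Adj x y}

/-- The multigraph `G` is connected. -/
def IsConnectedGraph {α β : Type} (G : Graph α β) : Prop :=
  V(G).Nonempty ∧ ∀ x ∈ V(G), ∀ y ∈ V(G), Relation.ReflTransGen G.Adj x y

/-- The vertex `x` is isolated in the multigraph `G`: no edge joins it to another vertex. -/
def IsIsolated {α β : Type} (G : Graph α β) (x : α) : Prop :=
  x ∈ V(G) ∧ ∀ y, y ≠ x → ¬ G.Adj x y

/-- The event `D_k`: some vertex `v` of `T_n` has height `k` and no edge joins a leaf descending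
from `v` to a leaf not descending from `v`. -/
def eventD (b n k : ℕ) : Set (ParticleOutcome b n) :=
  {ω | ∃ v : TreeVertex b n, v.height = k ∧ ∀ x y : Leaf b n,
    x.1.IsDescendant v → ¬ y.1.IsDescendant v → ¬ (particleGraph ω).Adj x y}

/-- The event `C_k`: the vertices of some component have a common ancestor of height `k`. -/
def eventC (b n k : ℕ) : Set (ParticleOutcome b n) :=
  {ω | ∃ C : Set (Leaf b n), IsComponent (particleGraph ω) C ∧
    ∃ v : TreeVertex b n, v.height = k ∧ ∀ x ∈ C, x.1.IsDescendant v}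

/-- The event that there is an isolated vertex. -/
def eventIsolated (b n : ℕ) : Set (ParticleOutcome b n) :=
  {ω | ∃ x : Leaf b n, IsIsolated (particleGraph ω) x}

/-- The event that the multigraph is connected. -/
def eventConnected (b n : ℕ) : Set (ParticleOutcome b n) :=
  {ω | IsConnectedGraph (particleGraph ω)}

/-- Let `p n lam` be the probability of an event in the `n`-th model with parameter `lam`. The
sequence `thr` is a sharp threshold at which this probability passes from `below` to `above`: for
every `ε > 0`, the probability tends to `below` along every choice of parameters that are
eventually at most `(1 - ε) * thr n`, and to `above` along every choice of parameters that are
eventually at least `(1 + ε) * thr n`. -/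
def IsSharpThreshold (p : ℕ → ℝ≥0 → ℝ) (thr : ℕ → ℝ) (below above : ℝ) : Prop :=
  ∀ ε : ℝ, 0 < ε → ∀ lam : ℕ → ℝ≥0,
    ((∀ᶠ n in atTop, (lam n : ℝ) ≤ (1 - ε) * thr n) →
      Tendsto (fun n => p n (lam n)) atTop (𝓝 below)) ∧
    ((∀ᶠ n in atTop, (1 + ε) * thr n ≤ (lam n : ℝ)) →
      Tendsto (fun n => p n (lam n)) atTop (𝓝 above))

/-- The constant `σ_crit = (b + 1) / (b - 1) * log b`. -/
def sigmaCrit (b : ℕ) : ℝ := ((b : ℝ) + 1) / ((b : ℝ) - 1) * Real.log b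

end

/-! ### Simple random walk on a finite graph -/

section Walk

variable {V : Type} [Finite V] [MeasurableSpace V] [DiscreteMeasurableSpace V]

/-! By gambler's ruin an excursion from a leaf reaches height `j` with probability `(b-1)/(b^j-1)`,
and by symmetry it ends uniformly below its highest vertex. Hence the return law `returnProb` is a
sum of `levelWeight` over common ancestors. This is proved by checking that `hitProb` is harmonic
and letting time tend to infinity in the stopped martingale (`walkLaw_returnsAt`). Poisson thinning
turns the law into void probabilities: disjoint sets `A`, `B` of leaves are joined by no edge with
probability `exp(-λ flow A B)` (`particleLaw_noEdge`).

The edges leaving the leaves below a vertex of height `k` have rate `λ * cutAt b n k`. Summation by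
parts (`cutAt_eq`) makes `cutAt` a partial sum of a series whose terms do not involve `n` and
decrease strictly in `k` to those of a geometric series; the limits are `cutRate b k`, decreasing to
`(b-1)/(b+1)`. There are `b^(n-k)` such vertices, and the expected number of those that no edge
leaves changes from large to small around `λ = σ_k n` with `σ_k = log b / cutRate b k`. Hence `σ_k`
increases strictly to `σ_crit`.

For `D_k` the first moment suffices above the threshold. Below it a second moment works: vertices
with only high common ancestors are almost independent, and the other pairs are few and share
strictly fewer edges than leave one of them. For `C_k` the key is the isoperimetric inequality
`exists_isoperimetric`: a nonempty proper subset of the leaves below a vertex has an edge boundary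
larger by a fixed `δ`. So components that fill only part of such a set cost a factor `exp(-λ δ)`,
with boundedly many shapes per vertex.

Connectedness fails below `σ_crit` because some `D_k` occurs. Above `σ_crit`, take the lowest height
at which the leaves below some vertex are not all in one component. A component splitting these
leaves is a union of sets of leaves below vertices one level lower, so below an ancestor `K` levels
up its trace has boundedly many shapes. `cutRateInf_mul_le_flow` shows that nearly the full critical
rate lies below that ancestor: either the density of the component is intermediate at every level,
and every level contributes, or it is nearly trivial at some level, where isoperimetry applies. A
union bound finishes.

At the threshold, the second moment bounds `P(D_k)` below. An upper bound needs more than the first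
moment, whose limit is `1` when `k = 0`; the leaves are cut into two parts in which independent
events are estimated (`particleLaw_eventD_le_of_indep`). -/

instance (G : SimpleGraph V) (v : V) : IsProbabilityMeasure (stepLaw G v) :=
  inferInstanceAs (IsProbabilityMeasure (stepKernel G v))

/-- A function of the trajectory up to time `t`, seen as a function on finite paths. -/
def onPath (t : ℕ) (F : (ℕ → V) → ℝ) (h : Finset.Iic t → V) : ℝ :=
  F fun s => h ⟨min s t, Finset.mem_Iic.2 (min_le_right s t)⟩

omit [Finite V] [MeasurableSpace V] [DiscreteMeasurableSpace V] in
lemma onPath_frestrictLe {t : ℕ} {F : (ℕ → V) → ℝ}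
    (hF : ∀ w w' : ℕ → V, (∀ s ≤ t, w s = w' s) → F w = F w') (w : ℕ → V) :
    onPath t F (Preorder.frestrictLe t w) = F w := by
  refine hF _ _ fun s hs => ?_
  simp [Preorder.frestrictLe, min_eq_left hs]

lemma integrable_walkLaw {G : SimpleGraph V} {v : V} {t : ℕ} {F : (ℕ → V) → ℝ}
    (hF : ∀ w w' : ℕ → V, (∀ s ≤ t, w s = w' s) → F w = F w') :
    Integrable F (walkLaw G v) := by
  have h : F = onPath t F ∘ Preorder.frestrictLe t := by
    ext w; exact (onPath_frestrictLe hF w).symm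
  rw [h]
  have := (Integrable.of_finite (f := onPath t F)
    (μ := (walkLaw G v).map (Preorder.frestrictLe (π := fun _ : ℕ => V) t)))
  exact this.comp_measurable (Preorder.measurable_frestrictLe t)

/-- The Markov property: the joint law of the path up to time `t` and the next position is the path
law composed with one step of the kernel. Integrability is automatic because there are finitely many
paths up to time `t`. -/
lemma integral_walkLaw_succ (G : SimpleGraph V) (v : V) (t : ℕ) {F : (ℕ → V) → ℝ}
    (hF : ∀ w w' : ℕ → V, (∀ s ≤ t, w s = w' s) → F w = F w') (g : V → ℝ) :
    ∫ w, F w * g (w (t + 1)) ∂walkLaw G v =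
      ∫ w, F w * ∫ u, g u ∂stepLaw G (w t) ∂walkLaw G v := by
  have hmap := Kernel.partialTraj_compProd_eq_map_traj (X := fun _ => V)
    (κ := historyKernel G) (Nat.zero_le t) (x₀ := fun _ => v)
  have hmap1 := Kernel.traj_map_frestrictLe_apply (X := fun _ => V) (κ := historyKernel G) 0 t
    (fun _ => v)
  set f : (Finset.Iic t → V) × V → ℝ := fun q => onPath t F q.1 * g q.2
  have h1 : ∫ w, F w * g (w (t + 1)) ∂walkLaw G v =
      ∫ q, f q ∂((Kernel.traj (X := fun _ => V) (historyKernel G) 0 (fun _ => v)).map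
        (fun x => (Preorder.frestrictLe t x, x (t + 1)))) := by
    rw [integral_map (by fun_prop) (by exact (Measurable.of_discrete).aestronglyMeasurable)]
    refine integral_congr_ae (Eventually.of_forall fun w => ?_)
    simp only [f, onPath_frestrictLe hF]
  rw [h1, ← hmap, Measure.integral_compProd (Integrable.of_finite), ← hmap1,
    integral_map (by fun_prop) (by exact (Measurable.of_discrete).aestronglyMeasurable)]
  refine integral_congr_ae (Eventually.of_forall fun w => ?_)
  simp only [f, onPath_frestrictLe hF, integral_const_mul]
  rfl

lemma walkLaw_apply_zero (G : SimpleGraph V) (v : V) : ∀ᵐ w ∂walkLaw G v, w 0 = v := by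
  have hmap1 := Kernel.traj_map_frestrictLe_apply (X := fun _ => V) (κ := historyKernel G) 0 0
    (fun _ => v)
  rw [Kernel.partialTraj_self, Kernel.id_apply] at hmap1
  have : ∀ᵐ h ∂((walkLaw G v).map (Preorder.frestrictLe (π := fun _ : ℕ => V) 0)),
      h ⟨0, by simp⟩ = v := by
    rw [walkLaw, hmap1, ae_dirac_iff (by exact MeasurableSet.of_discrete)]
  exact ae_of_ae_map (by fun_prop) this

lemma integral_stepLaw (G : SimpleGraph V) (v : V) (s : Finset V) (hs : G.neighborSet v = s)
    (hne : s.Nonempty) (g : V → ℝ) :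
    (s.card : ℝ) * ∫ u, g u ∂stepLaw G v = ∑ u ∈ s, g u := by
  have h : stepLaw G v = uniformOn (s : Set V) := by
    rw [stepLaw, if_pos (by rw [hs]; exact hne), hs]
  have hc : (s.card : ℝ) ≠ 0 := by exact_mod_cast hne.card_pos.ne'
  rw [h, uniformOn, ProbabilityTheory.cond, integral_smul_measure, Measure.count_apply_finset,
    setIntegral_finset _ (IntegrableOn.of_finite (Finset.finite_toSet s))]
  simp [Measure.real, hc]

end Walk

/-! ### Simple random walk on the tree -/

section Tree

variable {b n : ℕ}

namespace TreeVertex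

/-- The word that a vertex is. -/
def word (v : TreeVertex b n) : List (Fin b) := v.1

lemma word_injective : Function.Injective (word : TreeVertex b n → List (Fin b)) :=
  Subtype.val_injective

lemma isParent_iff (v u : TreeVertex b n) : v.IsParent u ↔ ∃ a, v.word = a :: u.word := Iff.rfl

/-- The child of `v` with last letter `a`. -/
def child (v : TreeVertex b n) (h : v.word.length < n) (a : Fin b) : TreeVertex b n :=
  ⟨a :: v.1, h⟩

/-- The parent of `v` (the apex is its own parent). -/
def parent (v : TreeVertex b n) : TreeVertex b n :=
  ⟨v.1.tail, (List.length_tail ▸ Nat.sub_le _ _).trans v.2⟩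

@[simp] lemma word_child (v : TreeVertex b n) (h : v.word.length < n) (a : Fin b) :
    (v.child h a).word = a :: v.word := rfl

@[simp] lemma word_parent (v : TreeVertex b n) : v.parent.word = v.word.tail := rfl

lemma child_injective (v : TreeVertex b n) (h : v.word.length < n) :
    Function.Injective (v.child h) := by
  intro a a' haa
  have := congrArg word haa
  simpa using this

lemma height_child (v : TreeVertex b n) (h : v.word.length < n) (a : Fin b) :
    (v.child h a).height = v.height - 1 := by
  change n - (v.child h a).word.length = n - v.word.length - 1
  rw [word_child, List.length_cons]; omega

lemma height_parent (v : TreeVertex b n) (h : v.word ≠ []) : v.parent.height = v.height + 1 := by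
  have h1 := List.length_pos_iff.2 h
  have h2 : v.word.length ≤ n := v.2
  change n - v.parent.word.length = n - v.word.length + 1
  rw [word_parent, List.length_tail]; omega

lemma height_le (v : TreeVertex b n) : v.height ≤ n := Nat.sub_le _ _

lemma length_eq (v : TreeVertex b n) : v.word.length = n - v.height := by
  have : v.word.length ≤ n := v.2
  change v.word.length = n - (n - v.word.length)
  omega

end TreeVertex

open TreeVertex

lemma tree_adj_iff (v u : TreeVertex b n) :
    (tree b n).Adj v u ↔ v.IsParent u ∨ u.IsParent v := by
  simp only [tree, SimpleGraph.fromRel_adj, and_iff_right_iff_imp]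
  rintro (⟨a, h⟩ | ⟨a, h⟩) rfl <;> exact absurd (congrArg List.length h) (by simp)

lemma isParent_parent {v : TreeVertex b n} (h : v.word ≠ []) : v.IsParent v.parent := by
  obtain ⟨a, l, hl⟩ := List.exists_cons_of_ne_nil h
  exact ⟨a, by change v.word = a :: v.parent.word; simp [hl]⟩

lemma IsParent.eq_parent {v u : TreeVertex b n} (h : v.IsParent u) : u = v.parent := by
  obtain ⟨a, h⟩ := h
  refine word_injective ?_
  change v.word = a :: u.word at h
  simp [h]

lemma isParent_iff_child {v u : TreeVertex b n} :
    u.IsParent v ↔ ∃ (h : v.word.length < n) (a : Fin b), u = v.child h a := by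
  constructor
  · rintro ⟨a, h⟩
    change u.word = a :: v.word at h
    have h1 : u.word.length ≤ n := u.2
    rw [h, List.length_cons] at h1
    exact ⟨h1, a, word_injective h⟩
  · rintro ⟨h, a, rfl⟩
    exact ⟨a, rfl⟩

-- The condition `n ≠ 0` excludes the one-vertex tree, whose leaf has no neighbour and where the
-- walk stays put.
open Classical in
lemma integral_stepLaw_leaf {v : TreeVertex b n} (hv : v.height = 0) (hn : n ≠ 0)
    (g : TreeVertex b n → ℝ) : ∫ u, g u ∂stepLaw (tree b n) v = g v.parent := by
  have hl := v.length_eq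
  have hne : v.word ≠ [] := by
    intro h; rw [h] at hl; simp at hl; omega
  have := integral_stepLaw (tree b n) v {v.parent} (by
    ext u
    simp only [SimpleGraph.mem_neighborSet, tree_adj_iff, Finset.coe_singleton,
      Set.mem_singleton_iff]
    constructor
    · rintro (h | h)
      · exact IsParent.eq_parent h
      · obtain ⟨h, -⟩ := isParent_iff_child.1 h
        omega
    · rintro rfl
      exact Or.inl (isParent_parent hne)) ⟨_, Finset.mem_singleton_self _⟩ g
  simpa using this

open Classical in
lemma integral_stepLaw_inner {v : TreeVertex b n} (hv : v.word.length < n) (hne : v.word ≠ [])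
    (g : TreeVertex b n → ℝ) :
    ((b : ℝ) + 1) * ∫ u, g u ∂stepLaw (tree b n) v = g v.parent + ∑ a, g (v.child hv a) := by
  have hnot : v.parent ∉ Finset.univ.map ⟨_, v.child_injective hv⟩ := by
    simp only [Finset.mem_map, Finset.mem_univ, true_and, not_exists]
    intro a h
    have h1 := congrArg TreeVertex.height h
    have h2 := v.length_eq
    simp only [Function.Embedding.coeFn_mk, height_child, height_parent v hne] at h1
    omega
  have := integral_stepLaw (tree b n) v
    (Finset.cons v.parent (Finset.univ.map ⟨_, v.child_injective hv⟩) hnot) (by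
    ext u
    simp only [SimpleGraph.mem_neighborSet, tree_adj_iff, Finset.coe_cons, Set.mem_insert_iff,
      Finset.mem_coe, Finset.mem_map, Finset.mem_univ, true_and, Function.Embedding.coeFn_mk]
    refine or_congr ⟨IsParent.eq_parent, fun h => h ▸ isParent_parent hne⟩ ?_
    rw [isParent_iff_child]
    exact ⟨fun ⟨h, a, e⟩ => ⟨a, e.symm⟩, fun ⟨a, e⟩ => ⟨hv, a, e.symm⟩⟩)
    ⟨_, Finset.mem_cons_self _ _⟩ g
  rw [Finset.card_cons, Finset.sum_cons, Finset.card_map, Finset.sum_map, Finset.card_univ,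
    Fintype.card_fin] at this
  exact_mod_cast this

open Classical in
lemma integral_stepLaw_root (hb : b ≠ 0) {v : TreeVertex b n} (hv : v.word.length < n)
    (hne : v.word = []) (g : TreeVertex b n → ℝ) :
    (b : ℝ) * ∫ u, g u ∂stepLaw (tree b n) v = ∑ a, g (v.child hv a) := by
  have := integral_stepLaw (tree b n) v
    (Finset.univ.map ⟨_, v.child_injective hv⟩) (by
    ext u
    simp only [SimpleGraph.mem_neighborSet, tree_adj_iff,
      Finset.mem_coe, Finset.mem_map, Finset.mem_univ, true_and, Function.Embedding.coeFn_mk]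
    rw [isParent_iff_child (v := v) (u := u)]
    constructor
    · rintro (h | h)
      · obtain ⟨a, h⟩ := (isParent_iff _ _).1 h
        simp [hne] at h
      · obtain ⟨h, a, e⟩ := h
        exact ⟨a, e.symm⟩
    · exact fun h => Or.inr ⟨hv, h.imp fun _ e => e.symm⟩)
    ⟨_, Finset.mem_map_of_mem _ (Finset.mem_univ ⟨0, Nat.pos_of_ne_zero hb⟩)⟩ g
  simpa using this

/-- The word that a leaf is. -/
def Leaf.word (x : Leaf b n) : List (Fin b) := x.1.word

lemma Leaf.word_injective : Function.Injective (Leaf.word : Leaf b n → List (Fin b)) :=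
  TreeVertex.word_injective.comp Subtype.val_injective

lemma Leaf.length_eq (x : Leaf b n) : x.word.length = n := by
  have := x.1.length_eq
  rw [x.2] at this
  simpa [Leaf.word] using this

/-! ### The hitting distribution -/

/-- The probability that an excursion from a leaf of `T_n` reaches height `j ≥ 1`. -/
noncomputable def reachProb (b n j : ℕ) : ℝ := if j ≤ n then ((b : ℝ) - 1) / ((b : ℝ) ^ j - 1) else 0

/-- The probability that an excursion from a leaf of `T_n` has maximal height `j ≥ 1` and ends at
a given leaf below the highest vertex that it reaches. -/
noncomputable def levelWeight (b n j : ℕ) : ℝ := (reachProb b n j - reachProb b n (j + 1)) / (b : ℝ) ^ j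

lemma sum_Icc_eq_add {R : Type*} [AddCommMonoid R] {j m : ℕ} (h : j ≤ m) (f : ℕ → R) :
    ∑ i ∈ Finset.Icc j m, f i = f j + ∑ i ∈ Finset.Icc (j + 1) m, f i := by
  rw [← Finset.add_sum_Ioc_eq_sum_Icc h, Finset.Icc_add_one_left_eq_Ioc]

open Classical in
/-- The probability that an excursion from the leaf `x` ends at the leaf `y`. -/
noncomputable def returnProb (x y : Leaf b n) : ℝ :=
  ∑ i ∈ Finset.Icc 1 n, levelWeight b n i * if x.word.drop i = y.word.drop i then 1 else 0

open Classical in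
/-- The probability that simple random walk from `u` hits the set of leaves at `y`. -/
noncomputable def hitProb (y : Leaf b n) (u : TreeVertex b n) : ℝ :=
  if u.height = 0 then (if u = y.1 then 1 else 0) else
    ((b : ℝ) ^ u.height - 1) / ((b : ℝ) - 1) *
      ∑ i ∈ Finset.Icc u.height n,
        levelWeight b n i * if u.word.drop (i - u.height) = y.word.drop i then 1 else 0

lemma pow_sub_one_pos (hb : 2 ≤ b) {j : ℕ} (hj : j ≠ 0) : (0 : ℝ) < (b : ℝ) ^ j - 1 :=
  sub_pos.2 (one_lt_pow₀ (by exact_mod_cast hb) hj)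

lemma levelWeight_of_lt (hb : 2 ≤ b) {j : ℕ} (hj : j ≠ 0) (hjn : j < n) :
    levelWeight b n j = ((b : ℝ) - 1) ^ 2 / (((b : ℝ) ^ j - 1) * ((b : ℝ) ^ (j + 1) - 1)) := by
  have h1 := pow_sub_one_pos hb hj
  have h2 := pow_sub_one_pos hb (Nat.succ_ne_zero j)
  have h3 : (0 : ℝ) < b := by positivity
  rw [levelWeight, reachProb, reachProb, if_pos hjn.le, if_pos (by omega)]
  simp only [Nat.succ_eq_add_one] at h2
  field_simp
  ring

lemma levelWeight_self : levelWeight b n n = ((b : ℝ) - 1) / ((b : ℝ) ^ n - 1) / (b : ℝ) ^ n := by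
  rw [levelWeight, reachProb, reachProb, if_pos le_rfl, if_neg (by omega), sub_zero]

open Classical in
lemma sum_ite_cons_eq (u l : List (Fin b)) (hl : l ≠ []) :
    ∑ a : Fin b, (if a :: u = l then (1 : ℝ) else 0) = if u = l.tail then 1 else 0 := by
  obtain ⟨a, l, rfl⟩ := List.exists_cons_of_ne_nil hl
  by_cases h : u = l <;> simp [h]

-- The children of `u` share all ancestors from height `u.height` on, so those terms are merely
-- multiplied by `b`. Only the term one level lower tells the children apart, and at most one child
-- matches `y` there. Height `1` is separate because the children are leaves, where `hitProb` is an
-- indicator.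
open Classical in
lemma sum_hitProb_child (y : Leaf b n) {u : TreeVertex b n} (hu : u.word.length < n) :
    ∑ a, hitProb y (u.child hu a) = (if u.height = 1 then (if u.word = y.word.drop 1 then 1 else 0) else
      ((b : ℝ) ^ (u.height - 1) - 1) / ((b : ℝ) - 1) *
        (levelWeight b n (u.height - 1) * (if u.word = y.word.drop u.height then 1 else 0) +
          b * ∑ i ∈ Finset.Icc u.height n,
            levelWeight b n i * if u.word.drop (i - u.height) = y.word.drop i then 1 else 0)) := by
  have hlen := u.length_eq
  have hle := u.height_le
  have hy := y.length_eq
  by_cases h : u.height = 1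
  · rw [if_pos h]
    have hy0 : y.word ≠ [] := by
      intro h0; rw [h0] at hy; simp at hy; omega
    rw [List.drop_one, ← sum_ite_cons_eq u.word _ hy0]
    refine Finset.sum_congr rfl fun a _ => ?_
    rw [hitProb, if_pos (by rw [height_child, h])]
    refine if_congr ?_ rfl rfl
    rw [← TreeVertex.word_injective.eq_iff]
    rfl
  · rw [if_neg h]
    have h2 : ∀ a, hitProb y (u.child hu a) = ((b : ℝ) ^ (u.height - 1) - 1) / ((b : ℝ) - 1) *
        (levelWeight b n (u.height - 1) *
          (if a :: u.word = y.word.drop (u.height - 1) then 1 else 0) +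
          ∑ i ∈ Finset.Icc u.height n,
            levelWeight b n i * if u.word.drop (i - u.height) = y.word.drop i then 1 else 0) := by
      intro a
      rw [hitProb, if_neg (by rw [height_child]; omega), height_child]
      congr 1
      rw [sum_Icc_eq_add (by omega), Nat.sub_self, List.drop_zero,
        show u.height - 1 + 1 = u.height by omega]
      congr 1
      refine Finset.sum_congr rfl fun i hi => ?_
      rw [Finset.mem_Icc] at hi
      rw [show i - (u.height - 1) = i - u.height + 1 by omega]
      rfl
    simp_rw [h2]
    rw [← Finset.mul_sum, Finset.sum_add_distrib, ← Finset.mul_sum, sum_ite_cons_eq]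
    · simp [List.tail_drop, show u.height - 1 + 1 = u.height by omega]
    · intro h0
      have := congrArg List.length h0
      simp [hy] at this
      omega

open Classical in
lemma hitProb_eq (y : Leaf b n) {u : TreeVertex b n} (hu : u.height ≠ 0) :
    hitProb y u = ((b : ℝ) ^ u.height - 1) / ((b : ℝ) - 1) *
      (levelWeight b n u.height * (if u.word = y.word.drop u.height then 1 else 0) +
        ∑ i ∈ Finset.Icc (u.height + 1) n,
          levelWeight b n i * if u.word.drop (i - u.height) = y.word.drop i then 1 else 0) := by
  rw [hitProb, if_neg hu, sum_Icc_eq_add u.height_le, Nat.sub_self, List.drop_zero]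

open Classical in
lemma hitProb_parent (y : Leaf b n) {u : TreeVertex b n} (hu : u.word ≠ []) :
    hitProb y u.parent = ((b : ℝ) ^ (u.height + 1) - 1) / ((b : ℝ) - 1) *
      ∑ i ∈ Finset.Icc (u.height + 1) n,
          levelWeight b n i * if u.word.drop (i - u.height) = y.word.drop i then 1 else 0 := by
  rw [hitProb, if_neg (by rw [height_parent u hu]; omega), height_parent u hu]
  congr 1
  refine Finset.sum_congr rfl fun i hi => ?_
  rw [Finset.mem_Icc] at hi
  congr 2
  rw [word_parent, List.drop_tail, show i - (u.height + 1) + 1 = i - u.height by omega]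

/-- The factor `(b^h - 1)/(b - 1)` is the inverse of the probability of reaching height `h`, so
`hitProb` conditions on having reached `u`. The sum over proper ancestors is common to `u`, its
parent and its children; its coefficient is harmonic because `(b^(h+1) - 1) + b(b^(h-1) - 1) =
(b+1)(b^h - 1)`. What remains is an identity for the weight at the height of `u` itself. -/
lemma integral_hitProb (hb : 2 ≤ b) (y : Leaf b n) {u : TreeVertex b n} (hu : u.height ≠ 0) :
    ∫ v, hitProb y v ∂stepLaw (tree b n) u = hitProb y u := by
  have hlen := u.length_eq
  have hle := u.height_le
  have hlt : u.word.length < n := by omega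
  have hsum := sum_hitProb_child y hlt
  have heq := hitProb_eq y hu
  have hb0 : (0 : ℝ) < b := by positivity
  have hb1 : (0 : ℝ) < (b : ℝ) - 1 := by simpa using pow_sub_one_pos hb one_ne_zero
  have hj := pow_sub_one_pos hb hu
  obtain ⟨j, hj'⟩ : ∃ j, u.height = j + 1 := ⟨u.height - 1, by omega⟩
  rw [hj'] at hsum heq hj hlen hle
  simp only [Nat.add_sub_cancel] at hsum
  have hsplit := sum_Icc_eq_add (m := n) hle (fun i => levelWeight b n i *
    open Classical in if u.word.drop (i - (j + 1)) = y.word.drop i then (1 : ℝ) else 0)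
  simp only [Nat.sub_self, List.drop_zero] at hsplit
  rw [hsplit] at hsum
  -- The apex has no parent, and its weight has another form because height `n + 1` is never
  -- reached.
  by_cases hroot : u.word = []
  · have hjn : n = j + 1 := by
      rw [hroot] at hlen; simp at hlen; omega
    have hr := integral_stepLaw_root (by omega) hlt hroot (hitProb y)
    rw [hsum] at hr
    have hempty : Finset.Icc (j + 1 + 1) n = ∅ := Finset.Icc_eq_empty (by omega)
    have hI : u.word = y.word.drop (j + 1) := by
      rw [hroot, eq_comm, List.drop_eq_nil_iff, y.length_eq, hjn]
    rw [heq, hempty, Finset.sum_empty, if_pos hI]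
    rw [hempty, Finset.sum_empty, if_pos hI] at hr
    have hw : levelWeight b n (j + 1) =
        ((b : ℝ) - 1) / ((b : ℝ) ^ (j + 1) - 1) / (b : ℝ) ^ (j + 1) := by
      rw [← hjn]; exact levelWeight_self
    rw [hw] at hr ⊢
    refine mul_left_cancel₀ hb0.ne' (hr.trans ?_)
    rcases Nat.eq_zero_or_pos j with rfl | hj0
    · rw [if_pos rfl, if_pos hI]
      simp
      field_simp
    · have hjj := pow_sub_one_pos hb hj0.ne'
      rw [if_neg (by omega), levelWeight_of_lt hb hj0.ne' (by omega)]
      field_simp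
      ring
  · have hr := integral_stepLaw_inner hlt hroot (hitProb y)
    rw [hsum, hitProb_parent y hroot, hj'] at hr
    have hjn : j + 1 < n := by
      have := List.length_pos_iff.2 hroot
      omega
    have hj2 := pow_sub_one_pos hb (Nat.succ_ne_zero (j + 1))
    simp only [Nat.succ_eq_add_one] at hj2
    rw [heq]
    refine mul_left_cancel₀ (by positivity : (b : ℝ) + 1 ≠ 0) (hr.trans ?_)
    rw [levelWeight_of_lt hb (Nat.succ_ne_zero j) hjn]
    simp only [Nat.succ_eq_add_one]
    generalize Finset.sum (M := ℝ) (Finset.Icc (j + 1 + 1) n) _ = S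
    rcases Nat.eq_zero_or_pos j with rfl | hj0
    · simp only [zero_add, if_pos]
      have e1 : (b : ℝ) ^ 1 - 1 ≠ 0 := by simpa using hb1.ne'
      simp only [zero_add] at hj2
      field_simp
      ring
    · have hjj := pow_sub_one_pos hb hj0.ne'
      rw [if_neg (by omega), levelWeight_of_lt hb hj0.ne' (by omega)]
      field_simp
      ring

end Tree

/-! ### First return to the leaves: optional stopping for `hitProb` -/

section Return

variable {b n : ℕ}

open TreeVertex

/-- The trajectory `w` avoids the leaves at the times `1, …, t`. -/
def NotReturned (t : ℕ) (w : ℕ → TreeVertex b n) : Prop :=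
  ∀ s, 1 ≤ s → s ≤ t → (w s).height ≠ 0

/-- The trajectory `w` first returns to the leaves at `y`, and does so by time `t`. -/
def ReturnedBy (t : ℕ) (y : Leaf b n) (w : ℕ → TreeVertex b n) : Prop :=
  ∃ s, 1 ≤ s ∧ s ≤ t ∧ w s = y.1 ∧ NotReturned (s - 1) w

lemma notReturned_succ {t : ℕ} {w : ℕ → TreeVertex b n} :
    NotReturned (t + 1) w ↔ NotReturned t w ∧ (w (t + 1)).height ≠ 0 := by
  constructor
  · exact fun h => ⟨fun s h1 h2 => h s h1 (by omega), h _ (by omega) le_rfl⟩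
  · rintro ⟨h, h'⟩ s h1 h2
    rcases Nat.lt_or_ge t s with hs | hs
    · rwa [show s = t + 1 by omega]
    · exact h s h1 hs

lemma NotReturned.congr {t : ℕ} {w w' : ℕ → TreeVertex b n} (h : ∀ s ≤ t, w s = w' s) :
    NotReturned t w ↔ NotReturned t w' := by
  unfold NotReturned
  refine forall_congr' fun s => imp_congr_right fun _ => forall_congr' fun h2 => ?_
  rw [h s h2]

lemma ReturnedBy.congr {t : ℕ} {y : Leaf b n} {w w' : ℕ → TreeVertex b n}
    (h : ∀ s ≤ t, w s = w' s) : ReturnedBy t y w ↔ ReturnedBy t y w' := by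
  unfold ReturnedBy
  refine exists_congr fun s => and_congr_right fun _ => and_congr_right fun h2 => ?_
  rw [h s h2, NotReturned.congr fun s' h' => h s' (by omega)]

lemma returnedBy_succ {t : ℕ} {y : Leaf b n} {w : ℕ → TreeVertex b n} :
    ReturnedBy (t + 1) y w ↔ ReturnedBy t y w ∨ (NotReturned t w ∧ w (t + 1) = y.1) := by
  constructor
  · rintro ⟨s, h1, h2, h3, h4⟩
    rcases Nat.lt_or_ge t s with hs | hs
    · obtain rfl : s = t + 1 := by omega
      exact Or.inr ⟨h4, h3⟩
    · exact Or.inl ⟨s, h1, hs, h3, h4⟩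
  · rintro (⟨s, h1, h2, h3, h4⟩ | ⟨h3, h4⟩)
    · exact ⟨s, h1, by omega, h3, h4⟩
    · exact ⟨t + 1, by omega, le_rfl, h4, h3⟩

lemma ReturnedBy.not_notReturned {t : ℕ} {y : Leaf b n} {w : ℕ → TreeVertex b n}
    (h : ReturnedBy t y w) : ¬ NotReturned t w := by
  obtain ⟨s, h1, h2, h3, -⟩ := h
  intro h
  exact h s h1 h2 (h3 ▸ y.2)

lemma returnsAt_iff {y : Leaf b n} {w : ℕ → TreeVertex b n} :
    ReturnsAt w y ↔ ∃ t, ReturnedBy t y w := by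
  constructor
  · rintro ⟨t, h1, h2, h3⟩
    exact ⟨t, t, h1, le_rfl, h2, fun s h h' => h3 s h (by omega)⟩
  · rintro ⟨t, s, h1, -, h2, h3⟩
    exact ⟨s, h1, h2, fun r h h' => h3 r h (by omega)⟩

open Classical in
/-- The indicator function of a proposition. -/
noncomputable def ind (P : Prop) : ℝ := if P then 1 else 0

lemma ind_nonneg (P : Prop) : 0 ≤ ind P := by unfold ind; split_ifs <;> simp

lemma ind_of {P : Prop} (h : P) : ind P = 1 := if_pos h

lemma ind_of_not {P : Prop} (h : ¬ P) : ind P = 0 := if_neg h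

lemma ind_congr {P Q : Prop} (h : P ↔ Q) : ind P = ind Q := by rw [propext h]

lemma measurableSet_of_congr {t : ℕ} {P : (ℕ → TreeVertex b n) → Prop}
    (hP : ∀ w w' : ℕ → TreeVertex b n, (∀ s ≤ t, w s = w' s) → (P w ↔ P w')) :
    MeasurableSet {w | P w} := by
  have : {w | P w} = Preorder.frestrictLe (π := fun _ : ℕ => TreeVertex b n) t ⁻¹'
      {h | P fun s => h ⟨min s t, Finset.mem_Iic.2 (min_le_right s t)⟩} := by
    ext w
    refine hP _ _ fun s hs => ?_
    simp [Preorder.frestrictLe, min_eq_left hs]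
  rw [this]
  exact Preorder.measurable_frestrictLe t MeasurableSet.of_discrete

lemma measurableSet_returnedBy (t : ℕ) (y : Leaf b n) :
    MeasurableSet {w : ℕ → TreeVertex b n | ReturnedBy t y w} :=
  measurableSet_of_congr fun _ _ => ReturnedBy.congr

lemma measurableSet_notReturned (t : ℕ) :
    MeasurableSet {w : ℕ → TreeVertex b n | NotReturned t w} :=
  measurableSet_of_congr fun _ _ => NotReturned.congr

lemma measurableSet_returnsAt (y : Leaf b n) :
    MeasurableSet {w : ℕ → TreeVertex b n | ReturnsAt w y} := by
  simp_rw [returnsAt_iff, Set.ofPred_exists]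
  exact MeasurableSet.iUnion fun t => measurableSet_returnedBy t y

lemma integral_ind {μ : Measure (ℕ → TreeVertex b n)} {P : (ℕ → TreeVertex b n) → Prop}
    (hP : MeasurableSet {w | P w}) : ∫ w, ind (P w) ∂μ = μ.real {w | P w} := by
  rw [← integral_indicator_one hP]
  rfl

/-- The drift of the height is `-1` at the apex and `-(b-1)/(b+1) ≤ -1/3` at the other inner
vertices. -/
lemma integral_height_le (hb : 2 ≤ b) {u : TreeVertex b n} (hu : u.height ≠ 0) :
    ∫ v, (v.height : ℝ) ∂stepLaw (tree b n) u ≤ u.height - 1 / 3 := by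
  have hlen := u.length_eq
  have hle := u.height_le
  have hlt : u.word.length < n := by omega
  have hb2 : (2 : ℝ) ≤ b := by exact_mod_cast hb
  obtain ⟨j, hj⟩ : ∃ j, u.height = j + 1 := ⟨u.height - 1, by omega⟩
  by_cases hroot : u.word = []
  · have := integral_stepLaw_root (by omega) hlt hroot (fun v => (v.height : ℝ))
    simp only [height_child, hj, Nat.add_sub_cancel, Finset.sum_const, Finset.card_univ,
      Fintype.card_fin, nsmul_eq_mul] at this
    rw [mul_left_cancel₀ (by positivity) this, hj]
    push_cast
    linarith
  · have := integral_stepLaw_inner hlt hroot (fun v => (v.height : ℝ))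
    simp only [height_child, height_parent u hroot, hj, Nat.add_sub_cancel, Finset.sum_const,
      Finset.card_univ, Fintype.card_fin, nsmul_eq_mul] at this
    rw [hj]
    push_cast at this ⊢
    nlinarith

variable (b n) in
lemma ind_notReturned_congr (t : ℕ) (w w' : ℕ → TreeVertex b n) (h : ∀ s ≤ t, w s = w' s) :
    ind (NotReturned t w) = ind (NotReturned t w') :=
  ind_congr (NotReturned.congr h)

lemma ind_returnedBy_congr (y : Leaf b n) (t : ℕ) (w w' : ℕ → TreeVertex b n)
    (h : ∀ s ≤ t, w s = w' s) : ind (ReturnedBy t y w) = ind (ReturnedBy t y w') :=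
  ind_congr (ReturnedBy.congr h)

lemma integrable_notReturned_mul {v : TreeVertex b n} (t r : ℕ) (g : TreeVertex b n → ℝ) :
    Integrable (fun w => ind (NotReturned t w) * g (w r)) (walkLaw (tree b n) v) := by
  refine integrable_walkLaw (t := max t r) fun w w' h => ?_
  rw [ind_notReturned_congr b n t w w' fun s hs => h s (hs.trans (le_max_left _ _)),
    h r (le_max_right _ _)]

lemma integrable_returnedBy {v : TreeVertex b n} (t : ℕ) (y : Leaf b n) :
    Integrable (fun w => ind (ReturnedBy t y w)) (walkLaw (tree b n) v) :=
  integrable_walkLaw (t := t) (ind_returnedBy_congr y t)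

lemma integrable_notReturned {v : TreeVertex b n} (t : ℕ) :
    Integrable (fun w => ind (NotReturned t w)) (walkLaw (tree b n) v) :=
  integrable_walkLaw (t := t) (ind_notReturned_congr b n t)

/-- The expected height on the event of no return loses at least a third of the probability of this
event at every step. As it stays nonnegative, these probabilities are summable. Time is shifted by
one because the walk may start at a leaf, where the drift bound fails. -/
lemma tendsto_notReturned (hb : 2 ≤ b) (v : TreeVertex b n) :
    Tendsto (fun t => (walkLaw (tree b n) v).real {w | NotReturned t w}) atTop (𝓝 0) := by
  set μ := walkLaw (tree b n) v
  set A : ℕ → ℝ := fun t => ∫ w, ind (NotReturned (t + 1) w) * ((w (t + 1)).height : ℝ) ∂μ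
  have hA0 : ∀ t, 0 ≤ A t := fun t =>
    integral_nonneg fun w => mul_nonneg (ind_nonneg _) (Nat.cast_nonneg _)
  have hstep : ∀ t, A (t + 1) + 1 / 3 * μ.real {w | NotReturned (t + 1) w} ≤ A t := by
    intro t
    -- The latest time can be dropped from the indicator: if the walk is then at a leaf, the factor
    -- `height` vanishes.
    have h1 : A (t + 1) =
        ∫ w, ind (NotReturned (t + 1) w) * ((w (t + 1 + 1)).height : ℝ) ∂μ := by
      refine integral_congr_ae (Eventually.of_forall fun w => ?_)
      simp only
      by_cases h : (w (t + 1 + 1)).height = 0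
      · simp [h]
      · congr 1
        exact ind_congr (notReturned_succ.trans (and_iff_left h))
    rw [h1, integral_walkLaw_succ _ _ _ (ind_notReturned_congr b n (t + 1))
      (fun u => (u.height : ℝ)), ← integral_ind (measurableSet_notReturned _),
      ← integral_const_mul, ← integral_add]
    · refine integral_mono_of_nonneg (Eventually.of_forall fun w => ?_)
        (integrable_notReturned_mul (t + 1) (t + 1) fun u => (u.height : ℝ))
        (Eventually.of_forall fun w => ?_)
      · exact add_nonneg (mul_nonneg (ind_nonneg _) (integral_nonneg fun _ => Nat.cast_nonneg _))
          (mul_nonneg (by norm_num) (ind_nonneg _))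
      · by_cases h : NotReturned (t + 1) w
        · have := integral_height_le hb (h (t + 1) (by omega) le_rfl)
          simp only [ind_of h]
          linarith
        · simp [ind_of_not h]
    · exact integrable_notReturned_mul (t + 1) (t + 1)
        fun u => ∫ v, (v.height : ℝ) ∂stepLaw (tree b n) u
    · exact (integrable_notReturned _).const_mul _
  have hsum : Summable fun t => μ.real {w | NotReturned (t + 1) w} := by
    refine summable_of_sum_range_le (c := 3 * A 0) (fun _ => measureReal_nonneg) fun m => ?_
    have : ∀ m, A m + 1 / 3 * ∑ t ∈ Finset.range m, μ.real {w | NotReturned (t + 1) w} ≤ A 0 := by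
      intro m
      induction m with
      | zero => simp
      | succ m ih =>
        rw [Finset.sum_range_succ]
        have := hstep m
        linarith
    have h1 := this m
    have h2 := hA0 m
    linarith
  exact (tendsto_add_atTop_iff_nat 1).1 hsum.tendsto_atTop_zero

lemma hitProb_nonneg_bdd (y : Leaf b n) : ∃ C, ∀ u, |hitProb y u| ≤ C := by
  obtain ⟨C, hC⟩ := (Set.finite_range fun u => |hitProb y u|).bddAbove
  exact ⟨C, fun u => hC ⟨u, rfl⟩⟩

lemma hitProb_parent_leaf (hb : 2 ≤ b) (hn : n ≠ 0) (x y : Leaf b n) :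
    hitProb y x.1.parent = returnProb x y := by
  have hx : x.1.word ≠ [] := by
    intro h
    have := x.length_eq
    rw [Leaf.word, h] at this
    simp at this; omega
  have hb1 : (b : ℝ) - 1 ≠ 0 := by simpa using (pow_sub_one_pos hb one_ne_zero).ne'
  rw [hitProb_parent y hx, x.2, returnProb]
  simp only [zero_add, pow_one, div_self hb1, one_mul, Nat.sub_zero]
  rfl

/-- The integrand is `hitProb y` along the walk stopped at its return, a martingale from time `1` on
by harmonicity. The first step leads from `x` to its parent, where `hitProb y` equals `returnProb x
y`. -/
lemma integral_returnedBy (hb : 2 ≤ b) (hn : n ≠ 0) (x y : Leaf b n) (t : ℕ) :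
    ∫ w, (ind (ReturnedBy (t + 1) y w) + ind (NotReturned (t + 1) w) * hitProb y (w (t + 1)))
      ∂walkLaw (tree b n) x.1 = returnProb x y := by
  have key : ∀ t, ∫ w, (ind (ReturnedBy (t + 1) y w) +
      ind (NotReturned (t + 1) w) * hitProb y (w (t + 1))) ∂walkLaw (tree b n) x.1 =
      ∫ w, (ind (ReturnedBy t y w) +
        ind (NotReturned t w) * ∫ u, hitProb y u ∂stepLaw (tree b n) (w t))
          ∂walkLaw (tree b n) x.1 := by
    intro t
    rw [integral_add (integrable_returnedBy _ _)
      (integrable_notReturned_mul t t fun v => ∫ u, hitProb y u ∂stepLaw (tree b n) v),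
      ← integral_walkLaw_succ _ _ _ (ind_notReturned_congr b n t),
      ← integral_add (integrable_returnedBy _ _) (integrable_notReturned_mul _ _ _)]
    refine integral_congr_ae (Eventually.of_forall fun w => ?_)
    simp only
    by_cases h1 : ReturnedBy t y w
    · rw [ind_of h1, ind_of (returnedBy_succ.2 (Or.inl h1)), ind_of_not h1.not_notReturned,
        ind_of_not fun h => h1.not_notReturned (notReturned_succ.1 h).1]
    · by_cases h2 : NotReturned t w
      · by_cases h3 : (w (t + 1)).height = 0
        · rw [ind_of_not h1, ind_of h2, ind_of_not fun h => (notReturned_succ.1 h).2 h3, hitProb,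
            if_pos h3]
          rw [zero_mul, add_zero, zero_add, one_mul]
          by_cases h4 : w (t + 1) = y.1
          · rw [if_pos h4, ind_of (returnedBy_succ.2 (Or.inr ⟨h2, h4⟩))]
          · rw [if_neg h4, ind_of_not]
            rw [returnedBy_succ]
            tauto
        · rw [ind_of_not h1, ind_of h2, ind_of (notReturned_succ.2 ⟨h2, h3⟩), ind_of_not]
          rw [returnedBy_succ]
          rintro (h | ⟨-, h⟩)
          · exact h1 h
          · exact h3 (h ▸ y.2)
      · rw [ind_of_not h1, ind_of_not h2, ind_of_not fun h => h2 (notReturned_succ.1 h).1,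
          ind_of_not (by rw [returnedBy_succ]; tauto)]
  induction t with
  | zero =>
    rw [key, ← hitProb_parent_leaf hb hn]
    have : ∀ᵐ w ∂walkLaw (tree b n) x.1, ind (ReturnedBy 0 y w) +
        ind (NotReturned 0 w) * ∫ u, hitProb y u ∂stepLaw (tree b n) (w 0) =
          hitProb y x.1.parent := by
      filter_upwards [walkLaw_apply_zero (tree b n) x.1] with w hw
      rw [hw, integral_stepLaw_leaf x.2 hn, ind_of_not, ind_of, zero_add, one_mul]
      · intro s h1 h2; omega
      · rintro ⟨s, h1, h2, -⟩; omega
    rw [integral_congr_ae this, integral_const, probReal_univ, one_smul]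
  | succ t ih =>
    rw [key, ← ih]
    refine integral_congr_ae (Eventually.of_forall fun w => ?_)
    simp only
    by_cases h : NotReturned (t + 1) w
    · rw [integral_hitProb hb y (h (t + 1) (by omega) le_rfl)]
    · rw [ind_of_not h, zero_mul, zero_mul]

/-- Let `t → ∞` in `integral_returnedBy`: the part of the integral on the event of no return is at
most a constant times a probability that tends to `0`. -/
theorem walkLaw_returnsAt (hb : 2 ≤ b) (hn : n ≠ 0) (x y : Leaf b n) :
    (walkLaw (tree b n) x.1).real {w | ReturnsAt w y} = returnProb x y := by
  set μ := walkLaw (tree b n) x.1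
  obtain ⟨C, hC⟩ := hitProb_nonneg_bdd y
  have h1 : Tendsto (fun t => μ.real {w | ReturnedBy t y w}) atTop
      (𝓝 (μ.real {w | ReturnsAt w y})) := by
    simp_rw [returnsAt_iff, Set.ofPred_exists]
    have hm : Monotone fun t => {w : ℕ → TreeVertex b n | ReturnedBy t y w} :=
      monotone_nat_of_le_succ fun t w hw => returnedBy_succ.2 (Or.inl hw)
    exact (ENNReal.tendsto_toReal (measure_ne_top _ _)).comp (tendsto_measure_iUnion_atTop hm)
  have h2 : Tendsto (fun t => μ.real {w | ReturnedBy (t + 1) y w} - returnProb x y) atTop (𝓝 0) := by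
    have h3 := ((tendsto_add_atTop_iff_nat 1).2 (tendsto_notReturned hb x.1)).mul_const C
    rw [zero_mul] at h3
    refine squeeze_zero_norm (fun t => ?_) h3
    rw [← integral_returnedBy hb hn x y t, integral_add (integrable_returnedBy _ _)
      (integrable_notReturned_mul _ _ _), integral_ind (measurableSet_returnedBy _ _),
      sub_add_cancel_left, norm_neg, ← integral_ind (measurableSet_notReturned _),
      ← integral_mul_const]
    refine norm_integral_le_of_norm_le ((integrable_notReturned _).mul_const _)
      (Eventually.of_forall fun w => ?_)
    rw [Real.norm_eq_abs, abs_mul, abs_of_nonneg (ind_nonneg _)]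
    exact mul_le_mul_of_nonneg_left (hC _) (ind_nonneg _)
  have h4 := ((tendsto_add_atTop_iff_nat 1).2 h1).sub_const (returnProb x y)
  exact sub_eq_zero.1 (tendsto_nhds_unique h4 h2)

end Return

/-! ### Void probabilities -/

section Void

variable {b n : ℕ}

instance : Finite (Leaf b n) := inferInstanceAs (Finite {v : TreeVertex b n // v.height = 0})

noncomputable instance : Fintype (Leaf b n) := Fintype.ofFinite _

noncomputable instance : DecidableEq (Leaf b n) := Classical.decEq _

instance (b n : ℕ) (lam : ℝ≥0) : IsProbabilityMeasure (particleLaw b n lam) := by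
  unfold particleLaw
  infer_instance

/-- The probability that none of a Poisson number of independent samples lies in `R`. -/
lemma poisson_prod_avoid {Ω : Type*} [MeasurableSpace Ω] (μ : Measure Ω) [IsProbabilityMeasure μ]
    (r : ℝ≥0) {R : Set Ω} (hR : MeasurableSet R) :
    MeasurableSet {q : ℕ × (ℕ → Ω) | ∀ i < q.1, q.2 i ∉ R} ∧
    ((poissonMeasure r).prod (Measure.infinitePi fun _ : ℕ => μ))
      {q : ℕ × (ℕ → Ω) | ∀ i < q.1, q.2 i ∉ R} = ENNReal.ofReal (Real.exp (-(r * μ.real R))) := by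
  have hmeas : MeasurableSet {q : ℕ × (ℕ → Ω) | ∀ i < q.1, q.2 i ∉ R} := by
    have : {q : ℕ × (ℕ → Ω) | ∀ i < q.1, q.2 i ∉ R} =
        ⋂ i : ℕ, ({q : ℕ × (ℕ → Ω) | q.1 ≤ i} ∪ {q | q.2 i ∈ Rᶜ}) := by
      ext q
      simp only [Set.mem_ofPred_eq, Set.mem_iInter, Set.mem_union, Set.mem_compl_iff]
      exact forall_congr' fun i => by rw [← not_lt]; tauto
    rw [this]
    refine MeasurableSet.iInter fun i => MeasurableSet.union ?_ ?_
    · exact measurable_fst (MeasurableSet.of_discrete (s := {m : ℕ | m ≤ i}))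
    · exact ((measurable_pi_apply i).comp measurable_snd) hR.compl
  refine ⟨hmeas, ?_⟩
  rw [Measure.prod_apply hmeas]
  -- Given `m` samples, all avoid `R` with probability `(1 - μ R)^m`; averaging over `m` yields the
  -- Poisson generating function at `1 - μ R`.
  have h1 : ∀ m : ℕ, (Measure.infinitePi fun _ : ℕ => μ)
      (Prod.mk m ⁻¹' {q : ℕ × (ℕ → Ω) | ∀ i < q.1, q.2 i ∉ R}) =
        ENNReal.ofReal ((1 - μ.real R) ^ m) := by
    intro m
    have : Prod.mk m ⁻¹' {q : ℕ × (ℕ → Ω) | ∀ i < q.1, q.2 i ∉ R} =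
        Set.pi (Finset.range m : Set ℕ) fun _ => Rᶜ := by
      ext q; simp
    rw [this, Measure.infinitePi_pi _ fun _ _ => hR.compl, Finset.prod_const, Finset.card_range,
      ← probReal_compl_eq_one_sub hR, ENNReal.ofReal_pow measureReal_nonneg,
      ofReal_measureReal]
  simp_rw [h1]
  have hp0 : 0 ≤ 1 - μ.real R := sub_nonneg.2 measureReal_le_one
  have hp1 : 1 - μ.real R ≤ 1 := sub_le_self _ measureReal_nonneg
  have hint : Integrable (fun m : ℕ => (1 - μ.real R) ^ m) (poissonMeasure r) := by
    refine Integrable.of_bound (Measurable.of_discrete).aestronglyMeasurable 1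
      (Eventually.of_forall fun m => ?_)
    rw [Real.norm_eq_abs, abs_of_nonneg (pow_nonneg hp0 m)]
    exact pow_le_one₀ hp0 hp1
  rw [← ofReal_integral_eq_lintegral_ofReal hint (Eventually.of_forall fun m => pow_nonneg hp0 m)]
  congr 1
  have h2 := hasSum_integral_poissonMeasure hint
  have h3 := (NormedSpace.expSeries_div_hasSum_exp ((r : ℝ) * (1 - μ.real R))).mul_left
    (Real.exp (-r))
  rw [← Real.exp_eq_exp_ℝ, ← Real.exp_add] at h3
  rw [h2.unique (by
    convert! h3 using 2 with m
    rw [smul_eq_mul, mul_pow]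
    ring)]
  congr 1
  ring

/-- The event that no particle goes from `x` to `y`, for all `(x, y)` in `S`. -/
def avoids (S : Finset (Leaf b n × Leaf b n)) : Set (ParticleOutcome b n) :=
  {ω | ∀ x, ∀ i < (ω x).1, ∀ y, (x, y) ∈ S → ¬ ReturnsAt ((ω x).2 i) y}

lemma avoids_union (S T : Finset (Leaf b n × Leaf b n)) :
    avoids (S ∪ T) = avoids S ∩ avoids T := by
  ext ω
  simp only [avoids, Finset.mem_union, Set.mem_ofPred_eq, Set.mem_inter_iff]
  exact ⟨fun h => ⟨fun x i hi y hy => h x i hi y (Or.inl hy),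
    fun x i hi y hy => h x i hi y (Or.inr hy)⟩,
    fun h x i hi y hy => hy.elim (h.1 x i hi y) (h.2 x i hi y)⟩

/-- The trajectories that return at a leaf `y` with `(x, y) ∈ S`. -/
def returnsIn (S : Finset (Leaf b n × Leaf b n)) (x : Leaf b n) : Set (ℕ → TreeVertex b n) :=
  ⋃ y ∈ Finset.univ.filter fun y => (x, y) ∈ S, {w | ReturnsAt w y}

lemma measurableSet_returnsIn (S : Finset (Leaf b n × Leaf b n)) (x : Leaf b n) :
    MeasurableSet (returnsIn S x) :=
  Finset.measurableSet_biUnion _ fun y _ => measurableSet_returnsAt y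

lemma avoids_eq_pi (S : Finset (Leaf b n × Leaf b n)) :
    avoids S = Set.pi ((Finset.univ : Finset (Leaf b n)) : Set (Leaf b n))
      fun x => {q | ∀ i < q.1, q.2 i ∉ returnsIn S x} := by
  ext ω
  simp [avoids, returnsIn]

lemma measurableSet_avoids (S : Finset (Leaf b n × Leaf b n)) : MeasurableSet (avoids S) := by
  rw [avoids_eq_pi]
  exact MeasurableSet.pi (Finset.countable_toSet _) fun x _ =>
    (poisson_prod_avoid (walkLaw (tree b n) x.1) 0 (measurableSet_returnsIn S x)).1

/-- The event is a product over starting leaves, so the exponents add. For one starting leaf the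
returns at different leaves are disjoint events, so their probabilities add too. -/
theorem particleLaw_avoids (hb : 2 ≤ b) (hn : n ≠ 0) (lam : ℝ≥0)
    (S : Finset (Leaf b n × Leaf b n)) :
    (particleLaw b n lam).real (avoids S) =
      Real.exp (-(lam / 2 * ∑ q ∈ S, returnProb q.1 q.2)) := by
  have hR : ∀ x : Leaf b n, (walkLaw (tree b n) x.1).real (returnsIn S x) =
      ∑ y ∈ Finset.univ.filter fun y => (x, y) ∈ S, returnProb x y := by
    intro x
    rw [returnsIn, measureReal_biUnion_finset _ fun y _ => measurableSet_returnsAt y]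
    · exact Finset.sum_congr rfl fun y _ => walkLaw_returnsAt hb hn x y
    · intro y _ z _ hyz
      exact Set.disjoint_left.2 fun w hy hz => hyz (hy.unique hz)
  have hS : ∑ q ∈ S, returnProb q.1 q.2 =
      ∑ x : Leaf b n, ∑ y ∈ Finset.univ.filter fun y => (x, y) ∈ S, returnProb x y := by
    simp_rw [Finset.sum_filter]
    rw [← Fintype.sum_prod_type' (fun x y => if (x, y) ∈ S then returnProb x y else 0)]
    simp
  rw [measureReal_def, particleLaw, avoids_eq_pi, Measure.infinitePi_pi]
  · rw [Finset.prod_congr rfl fun x _ => (poisson_prod_avoid (walkLaw (tree b n) x.1) (lam / 2)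
      (measurableSet_returnsIn S x)).2, ← ENNReal.ofReal_prod_of_nonneg fun _ _ => Real.exp_nonneg _,
      ENNReal.toReal_ofReal (Finset.prod_nonneg fun _ _ => Real.exp_nonneg _), ← Real.exp_sum, hS,
      Finset.mul_sum, ← Finset.sum_neg_distrib]
    simp_rw [hR]
    push_cast
    rfl
  · exact fun x _ =>
      (poisson_prod_avoid (walkLaw (tree b n) x.1) 0 (measurableSet_returnsIn S x)).1

/-! ### Edges between sets of leaves -/

/-- The rate of edges between the sets `A` and `B` of leaves. -/
noncomputable def flow (A B : Finset (Leaf b n)) : ℝ := ∑ x ∈ A, ∑ y ∈ B, returnProb x y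

/-- The event that no edge joins `A` and `B`. -/
def noEdge (A B : Finset (Leaf b n)) : Set (ParticleOutcome b n) := avoids (A ×ˢ B ∪ B ×ˢ A)

lemma measurableSet_noEdge (A B : Finset (Leaf b n)) : MeasurableSet (noEdge A B) :=
  measurableSet_avoids _

lemma returnProb_comm (x y : Leaf b n) : returnProb x y = returnProb y x := by
  simp only [returnProb, eq_comm]

lemma flow_comm (A B : Finset (Leaf b n)) : flow A B = flow B A := by
  rw [flow, Finset.sum_comm]
  simp only [flow, returnProb_comm]

lemma mem_noEdge_iff {A B : Finset (Leaf b n)} {ω : ParticleOutcome b n} :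
    ω ∈ noEdge A B ↔ ∀ x ∈ A, ∀ y ∈ B, ¬ (particleGraph ω).Adj x y := by
  simp only [noEdge, avoids, Finset.mem_union, Finset.mem_product, Set.mem_ofPred_eq,
    Graph.Adj, particleGraph]
  constructor
  · rintro h x hx y hy ⟨e, he, ⟨rfl, h1⟩ | ⟨rfl, h1⟩⟩
    · exact h _ _ he y (Or.inl ⟨hx, hy⟩) h1
    · exact h _ _ he x (Or.inr ⟨hy, hx⟩) h1
  · rintro h x i hi y (⟨hx, hy⟩ | ⟨hx, hy⟩) h1
    · exact h x hx y hy ⟨(x, i), hi, Or.inl ⟨rfl, h1⟩⟩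
    · exact h y hy x hx ⟨(x, i), hi, Or.inr ⟨rfl, h1⟩⟩

/-- Particles from `A` to `B` and from `B` to `A` contribute equally because `returnProb` is
symmetric; this absorbs the factor `1/2` in the Poisson mean. -/
theorem particleLaw_noEdge (hb : 2 ≤ b) (hn : n ≠ 0) (lam : ℝ≥0) {A B : Finset (Leaf b n)}
    (hAB : Disjoint A B) :
    (particleLaw b n lam).real (noEdge A B) = Real.exp (-(lam * flow A B)) := by
  rw [noEdge, particleLaw_avoids hb hn, Finset.sum_union, Finset.sum_product, Finset.sum_product]
  · change Real.exp (-(lam / 2 * (flow A B + flow B A))) = _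
    rw [flow_comm B A]
    congr 1
    ring
  · rw [Finset.disjoint_product]
    exact Or.inl hAB

/-- Inclusion-exclusion on ordered pairs: the pairs that cross both boundaries are exactly those
between `A` and `B`. -/
theorem particleLaw_noEdge_inter (hb : 2 ≤ b) (hn : n ≠ 0) (lam : ℝ≥0) {A B : Finset (Leaf b n)}
    (hAB : Disjoint A B) :
    (particleLaw b n lam).real (noEdge A Aᶜ ∩ noEdge B Bᶜ) =
      Real.exp (-(lam * (flow A Aᶜ + flow B Bᶜ - flow A B))) := by
  have hB : B ⊆ Aᶜ := fun x hx => Finset.mem_compl.2 fun h => Finset.disjoint_left.1 hAB h hx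
  have hA : A ⊆ Bᶜ := fun x hx => Finset.mem_compl.2 fun h => Finset.disjoint_left.1 hAB hx h
  have hset : (A ×ˢ Aᶜ ∪ Aᶜ ×ˢ A) ∩ (B ×ˢ Bᶜ ∪ Bᶜ ×ˢ B) = A ×ˢ B ∪ B ×ˢ A := by
    ext ⟨x, y⟩
    have hx : x ∈ A → x ∉ B := fun h => Finset.disjoint_left.1 hAB h
    have hy : y ∈ A → y ∉ B := fun h => Finset.disjoint_left.1 hAB h
    simp only [Finset.mem_inter, Finset.mem_union, Finset.mem_product, Finset.mem_compl]
    tauto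
  have hsum : ∀ C D : Finset (Leaf b n), Disjoint C D →
      ∑ q ∈ C ×ˢ D ∪ D ×ˢ C, returnProb q.1 q.2 = 2 * flow C D := by
    intro C D hCD
    rw [Finset.sum_union (Finset.disjoint_product.2 (Or.inl hCD)), Finset.sum_product,
      Finset.sum_product]
    change flow C D + flow D C = _
    rw [flow_comm D C, two_mul]
  have h := Finset.sum_union_inter (s₁ := A ×ˢ Aᶜ ∪ Aᶜ ×ˢ A) (s₂ := B ×ˢ Bᶜ ∪ Bᶜ ×ˢ B)
    (f := fun q : Leaf b n × Leaf b n => returnProb q.1 q.2)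
  rw [hset, hsum _ _ hAB, hsum _ _ disjoint_compl_right, hsum _ _ disjoint_compl_right] at h
  rw [noEdge, noEdge, ← avoids_union, particleLaw_avoids hb hn, eq_sub_of_add_eq h]
  congr 1
  ring

end Void

/-! ### Leaves below a vertex -/

section Below

variable {b n : ℕ}

/-- The words of length `m`. -/
def words (b m : ℕ) : Finset (List (Fin b)) :=
  (Finset.univ : Finset (List.Vector (Fin b) m)).map ⟨List.Vector.toList, List.Vector.toList_injective⟩

lemma mem_words {m : ℕ} {v : List (Fin b)} : v ∈ words b m ↔ v.length = m := by
  simp only [words, Finset.mem_map, Finset.mem_univ, true_and, Function.Embedding.coeFn_mk]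
  exact ⟨fun ⟨a, h⟩ => h ▸ a.toList_length, fun h => ⟨⟨v, h⟩, rfl⟩⟩

lemma card_words (b m : ℕ) : (words b m).card = b ^ m := by
  rw [words, Finset.card_map, Finset.card_univ, card_vector, Fintype.card_fin]

open Classical in
/-- The set of leaves that descend from the vertex `v`. -/
noncomputable def below (n : ℕ) (v : List (Fin b)) : Finset (Leaf b n) :=
  Finset.univ.filter fun x => v <:+ x.word

lemma mem_below {v : List (Fin b)} {x : Leaf b n} : x ∈ below n v ↔ v <:+ x.word := by
  simp [below]

lemma mem_below_iff {v : List (Fin b)} {k : ℕ} (hv : v.length + k = n) {x : Leaf b n} :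
    x ∈ below n v ↔ x.word.drop k = v := by
  rw [mem_below, List.suffix_iff_eq_drop, x.length_eq, show n - v.length = k by omega, eq_comm]

lemma mem_below_drop (x : Leaf b n) (j : ℕ) : x ∈ below n (x.word.drop j) :=
  mem_below.2 (List.drop_suffix _ _)

lemma mem_below_drop_iff {x y : Leaf b n} {j : ℕ} (hj : j ≤ n) :
    y ∈ below n (x.word.drop j) ↔ x.word.drop j = y.word.drop j := by
  rw [mem_below_iff (k := j) (by rw [List.length_drop, x.length_eq]; omega), eq_comm]

lemma below_mono {u v : List (Fin b)} (h : v <:+ u) : below n u ⊆ below n v := fun _ hx =>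
  mem_below.2 (h.trans (mem_below.1 hx))

lemma below_disjoint {u v : List (Fin b)} (h : u.length = v.length) (huv : u ≠ v) :
    Disjoint (below n u) (below n v) := by
  refine Finset.disjoint_left.2 fun x hu hv => huv ?_
  rw [mem_below, List.suffix_iff_eq_drop] at hu hv
  rw [hu, hv, h]

/-- The leaf with a given word. -/
def leafOf (v : List (Fin b)) (hv : v.length = n) : Leaf b n :=
  ⟨⟨v, hv.le⟩, by change n - v.length = 0; omega⟩

@[simp] lemma leafOf_word (v : List (Fin b)) (hv : v.length = n) : (leafOf v hv).word = v := rfl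

lemma below_leaf (v : List (Fin b)) (hv : v.length = n) : below n v = {leafOf v hv} := by
  ext x
  rw [mem_below_iff (k := 0) hv, List.drop_zero, Finset.mem_singleton,
    ← Leaf.word_injective.eq_iff, leafOf_word]

lemma below_eq_biUnion {v : List (Fin b)} (hv : v.length < n) :
    below n v = Finset.univ.biUnion fun a => below n (a :: v) := by
  ext x
  simp only [Finset.mem_biUnion, Finset.mem_univ, true_and, mem_below]
  constructor
  · rintro ⟨t, ht⟩
    rcases List.eq_nil_or_concat t with rfl | ⟨t, a, rfl⟩
    · have := x.length_eq
      rw [← ht] at this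
      simp at this; omega
    · exact ⟨a, t, by rw [← ht]; simp⟩
  · rintro ⟨a, h⟩
    exact (List.suffix_cons a v).trans h

lemma below_cons_disjoint {v : List (Fin b)} {a a' : Fin b} (h : a ≠ a') :
    Disjoint (below n (a :: v)) (below n (a' :: v)) :=
  below_disjoint rfl (by simpa using h)

lemma card_below {v : List (Fin b)} {k : ℕ} (hv : v.length + k = n) :
    (below n v).card = b ^ k := by
  induction k generalizing v with
  | zero => rw [below_leaf v hv]; simp
  | succ k ih =>
    rw [below_eq_biUnion (by omega), Finset.card_biUnion fun a _ a' _ h => below_cons_disjoint h,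
      Finset.sum_congr rfl fun a _ => ih (v := a :: v) (by simp; omega)]
    simp [pow_succ, mul_comm]

lemma below_nonempty (hb : b ≠ 0) {v : List (Fin b)} {k : ℕ} (hv : v.length + k = n) :
    (below n v).Nonempty := by
  rw [← Finset.card_pos, card_below hv]
  exact pow_pos (Nat.pos_of_ne_zero hb) _

/-! ### Return probabilities -/

/-- The probability that an excursion from a leaf ends at a given leaf, if the lowest common
ancestor of the two leaves has height `h ≥ 1`. -/
noncomputable def tailWeight (b n h : ℕ) : ℝ := ∑ j ∈ Finset.Icc h n, levelWeight b n j

lemma levelWeight_nonneg (hb : 2 ≤ b) {j : ℕ} (hj : j ≠ 0) (hjn : j ≤ n) :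
    0 ≤ levelWeight b n j := by
  have h0 := pow_sub_one_pos hb one_ne_zero
  have h1 := pow_sub_one_pos hb hj
  have h2 := pow_sub_one_pos hb (Nat.succ_ne_zero j)
  rw [pow_one] at h0
  rcases hjn.lt_or_eq with h | rfl
  · rw [levelWeight_of_lt hb hj h]
    positivity
  · rw [levelWeight_self]
    positivity

lemma returnProb_nonneg (hb : 2 ≤ b) (x y : Leaf b n) : 0 ≤ returnProb x y := by
  refine Finset.sum_nonneg fun i hi => mul_nonneg ?_ (by split_ifs <;> simp)
  rw [Finset.mem_Icc] at hi
  exact levelWeight_nonneg hb (by omega) hi.2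

lemma flow_nonneg (hb : 2 ≤ b) (A B : Finset (Leaf b n)) : 0 ≤ flow A B :=
  Finset.sum_nonneg fun _ _ => Finset.sum_nonneg fun _ _ => returnProb_nonneg hb _ _

lemma flow_mono (hb : 2 ≤ b) {A A' B B' : Finset (Leaf b n)} (hA : A ⊆ A') (hB : B ⊆ B') :
    flow A B ≤ flow A' B' :=
  (Finset.sum_le_sum fun _ _ => Finset.sum_le_sum_of_subset_of_nonneg hB
    fun _ _ _ => returnProb_nonneg hb _ _).trans
  (Finset.sum_le_sum_of_subset_of_nonneg hA
    fun _ _ _ => Finset.sum_nonneg fun _ _ => returnProb_nonneg hb _ _)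

lemma flow_union_right (A : Finset (Leaf b n)) {B C : Finset (Leaf b n)} (h : Disjoint B C) :
    flow A (B ∪ C) = flow A B + flow A C := by
  simp only [flow, Finset.sum_union h, Finset.sum_add_distrib]

lemma sum_returnProb (x : Leaf b n) (B : Finset (Leaf b n)) :
    ∑ y ∈ B, returnProb x y =
      ∑ j ∈ Finset.Icc 1 n, levelWeight b n j * (B ∩ below n (x.word.drop j)).card := by
  simp only [returnProb]
  rw [Finset.sum_comm]
  refine Finset.sum_congr rfl fun j hj => ?_
  rw [Finset.mem_Icc] at hj
  rw [← Finset.mul_sum, Finset.sum_boole]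
  congr 3
  ext y
  rw [Finset.mem_filter, Finset.mem_inter, mem_below_drop_iff hj.2]

lemma sum_Icc_one_eq {f : ℕ → ℝ} {h : ℕ} (hh : 1 ≤ h) (hf : ∀ j < h, f j = 0) :
    ∑ j ∈ Finset.Icc 1 n, f j = ∑ j ∈ Finset.Icc h n, f j := by
  symm
  refine Finset.sum_subset (Finset.Icc_subset_Icc_left hh) fun j hj hj' => hf j ?_
  simp only [Finset.mem_Icc] at hj hj'
  omega

lemma returnProb_eq_tailWeight {x y : Leaf b n} {h : ℕ} (hh : 1 ≤ h)
    (hne : x.word.drop (h - 1) ≠ y.word.drop (h - 1)) (heq : x.word.drop h = y.word.drop h) :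
    returnProb x y = tailWeight b n h := by
  rw [returnProb, sum_Icc_one_eq hh, tailWeight]
  · refine Finset.sum_congr rfl fun j hj => ?_
    rw [Finset.mem_Icc] at hj
    rw [if_pos, mul_one]
    have := congrArg (List.drop (j - h)) heq
    rwa [List.drop_drop, List.drop_drop, Nat.add_sub_cancel' hj.1] at this
  · intro j hj
    rw [if_neg, mul_zero]
    intro h1
    have := congrArg (List.drop (h - 1 - j)) h1
    rw [List.drop_drop, List.drop_drop, show j + (h - 1 - j) = h - 1 by omega] at this
    exact hne this

/-- The rate of edges leaving the set of leaves below a vertex of height `k`. -/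
noncomputable def cutAt (b n k : ℕ) : ℝ :=
  (b : ℝ) ^ k * ∑ j ∈ Finset.Icc (k + 1) n, levelWeight b n j * ((b : ℝ) ^ j - (b : ℝ) ^ k)

lemma sum_returnProb_compl_below {v : List (Fin b)} {k : ℕ} (hv : v.length + k = n)
    {x : Leaf b n} (hx : x ∈ below n v) :
    ∑ y ∈ (below n v)ᶜ, returnProb x y =
      ∑ j ∈ Finset.Icc (k + 1) n, levelWeight b n j * ((b : ℝ) ^ j - (b : ℝ) ^ k) := by
  have hxv := (mem_below_iff hv).1 hx
  have hlen : ∀ j ≤ n, (x.word.drop j).length + j = n := fun j hj => by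
    rw [List.length_drop, x.length_eq]; omega
  rw [sum_returnProb, sum_Icc_one_eq (Nat.succ_pos k)]
  · refine Finset.sum_congr rfl fun j hj => ?_
    rw [Finset.mem_Icc] at hj
    have hsub : below n v ⊆ below n (x.word.drop j) := below_mono (by
      rw [← hxv, show j = k + (j - k) by omega, ← List.drop_drop]
      exact List.drop_suffix _ _)
    rw [Finset.inter_comm, ← Finset.sdiff_eq_inter_compl, Finset.card_sdiff_of_subset hsub,
      card_below hv, card_below (hlen j hj.2), Nat.cast_sub]
    · push_cast; rfl
    · rw [← card_below hv, ← card_below (hlen j hj.2)]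
      exact Finset.card_le_card hsub
  · intro j hj
    have hsub : below n (x.word.drop j) ⊆ below n v := below_mono (by
      rw [← hxv, show k = j + (k - j) by omega, ← List.drop_drop]
      exact List.drop_suffix _ _)
    rw [Finset.inter_comm, Finset.disjoint_iff_inter_eq_empty.1, Finset.card_empty, Nat.cast_zero,
      mul_zero]
    exact Finset.disjoint_left.2 fun y hy hy' => (Finset.mem_compl.1 hy') (hsub hy)

/-- Every leaf below `v` has the same rate of edges to the outside, so the rate is proportional to
the number of leaves. -/
lemma flow_compl_below {v : List (Fin b)} {k : ℕ} (hv : v.length + k = n)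
    {A : Finset (Leaf b n)} (hA : A ⊆ below n v) :
    flow A (below n v)ᶜ = A.card * ((cutAt b n k) / (b : ℝ) ^ k) := by
  rw [flow, Finset.sum_congr rfl fun x hx => sum_returnProb_compl_below hv (hA hx),
    Finset.sum_const, nsmul_eq_mul, cutAt]
  rcases Nat.eq_zero_or_pos A.card with h | h
  · simp [h]
  · have : 0 < b ^ k := by
      rw [← card_below hv]
      exact h.trans_le (Finset.card_le_card hA)
    have : (b : ℝ) ^ k ≠ 0 := by exact_mod_cast this.ne'
    field_simp

lemma cut_below (hb : b ≠ 0) {v : List (Fin b)} {k : ℕ} (hv : v.length + k = n) :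
    flow (below n v) (below n v)ᶜ = cutAt b n k := by
  have : (b : ℝ) ^ k ≠ 0 := by positivity
  rw [flow_compl_below hv subset_rfl, card_below hv]
  push_cast
  field_simp

/-- The boundaries of the `b` children add up to the boundary of their parent plus the edges between
children. The latter come from `b(b-1)` ordered pairs of children, with `b^(2k)` pairs of leaves
each. -/
lemma cutAt_succ {k : ℕ} (hk : k + 1 ≤ n) :
    cutAt b n (k + 1) =
      b * cutAt b n k - tailWeight b n (k + 1) * b * ((b : ℝ) - 1) * ((b : ℝ) ^ k) ^ 2 := by
  rw [cutAt, cutAt, tailWeight, sum_Icc_eq_add hk, sum_Icc_eq_add hk]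
  have : ∑ j ∈ Finset.Icc (k + 1 + 1) n, levelWeight b n j * ((b : ℝ) ^ j - (b : ℝ) ^ k) =
      ∑ j ∈ Finset.Icc (k + 1 + 1) n, levelWeight b n j * ((b : ℝ) ^ j - (b : ℝ) ^ (k + 1)) +
      (b : ℝ) ^ k * ((b : ℝ) - 1) * ∑ j ∈ Finset.Icc (k + 1 + 1) n, levelWeight b n j := by
    rw [Finset.mul_sum, ← Finset.sum_add_distrib]
    refine Finset.sum_congr rfl fun j _ => ?_
    ring
  rw [this]
  ring

end Below

/-! ### The rates of edges leaving the vertices of a given height -/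

section Rate

variable {b n : ℕ}

/-- The `i`-th term of the series for the edge rate at height `k`. -/
noncomputable def rateTerm (b k i : ℕ) : ℝ :=
  ((b : ℝ) ^ (2 * (i + 1)) * (1 - ((b : ℝ) ^ (k + i + 1))⁻¹))⁻¹

/-- The limit as `n → ∞` of the rate of edges leaving a vertex of height `k`. -/
noncomputable def cutRate (b k : ℕ) : ℝ := ((b : ℝ) - 1) ^ 2 * ∑' i, rateTerm b k i

/-- The limit of `cutRate b k` as `k → ∞`. -/
noncomputable def cutRateInf (b : ℕ) : ℝ := ((b : ℝ) - 1) / ((b : ℝ) + 1)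

lemma sum_by_parts (Q : ℕ → ℝ) (c : ℝ) (m : ℕ) :
    ∑ i ∈ Finset.range m, (Q i - Q (i + 1)) * (1 - c ^ (i + 1)) =
      ∑ i ∈ Finset.range m, Q i * (c ^ i - c ^ (i + 1)) - Q m * (1 - c ^ m) := by
  induction m with
  | zero => simp
  | succ m ih => rw [Finset.sum_range_succ, Finset.sum_range_succ, ih]; ring

lemma inv_pow_lt_one (hb : 2 ≤ b) (k i : ℕ) : ((b : ℝ) ^ (k + i + 1))⁻¹ ≤ 1 / 2 := by
  have h2 : (2 : ℝ) ≤ b := by exact_mod_cast hb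
  rw [one_div]
  refine inv_anti₀ (by norm_num) (h2.trans ?_)
  exact le_self_pow₀ (by linarith) (by omega)

/-- Summation by parts: `levelWeight` is a difference of values of `reachProb`, and the boundary
term vanishes because height `n + 1` is not reached. In the resulting sum `n` enters only through
the number of terms, and each term is monotone in `k`. -/
lemma cutAt_eq (hb : 2 ≤ b) {k : ℕ} (hk : k ≤ n) :
    cutAt b n k = ((b : ℝ) - 1) ^ 2 * ∑ i ∈ Finset.range (n - k), rateTerm b k i := by
  have hb0 : (0 : ℝ) < b := by positivity
  have h := sum_by_parts (fun i => reachProb b n (k + 1 + i)) (b : ℝ)⁻¹ (n - k)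
  rw [show reachProb b n (k + 1 + (n - k)) = 0 by rw [reachProb, if_neg (by omega)], zero_mul,
    sub_zero] at h
  rw [cutAt, ← Finset.Ico_add_one_right_eq_Icc, Finset.sum_Ico_eq_sum_range,
    show n + 1 - (k + 1) = n - k by omega]
  have e : ∀ i, levelWeight b n (k + 1 + i) * ((b : ℝ) ^ (k + 1 + i) - (b : ℝ) ^ k) =
      (reachProb b n (k + 1 + i) - reachProb b n (k + 1 + (i + 1))) * (1 - (b : ℝ)⁻¹ ^ (i + 1)) := by
    intro i
    rw [levelWeight, show k + 1 + (i + 1) = k + 1 + i + 1 by omega,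
      show k + 1 + i = k + (i + 1) by omega, pow_add _ k (i + 1), inv_pow]
    field_simp
  simp_rw [e]
  rw [h, Finset.mul_sum, Finset.mul_sum]
  refine Finset.sum_congr rfl fun i hi => ?_
  rw [Finset.mem_range] at hi
  have hp := pow_sub_one_pos hb (Nat.succ_ne_zero (k + i))
  simp only [Nat.succ_eq_add_one] at hp
  rw [reachProb, if_pos (by omega), rateTerm, show k + 1 + i = k + i + 1 by omega]
  have e2 : 1 - ((b : ℝ) ^ (k + i + 1))⁻¹ = ((b : ℝ) ^ (k + i + 1) - 1) / (b : ℝ) ^ (k + i + 1) := by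
    field_simp
  rw [e2, inv_pow, inv_pow]
  field_simp
  ring

lemma rateTerm_pos (hb : 2 ≤ b) (k i : ℕ) : 0 < rateTerm b k i := by
  have := inv_pow_lt_one hb k i
  have hb0 : (0 : ℝ) < b := by positivity
  exact inv_pos.2 (mul_pos (by positivity) (by linarith))

lemma geom_term_le_rateTerm (hb : 2 ≤ b) (k i : ℕ) :
    ((b : ℝ) ^ (2 * (i + 1)))⁻¹ ≤ rateTerm b k i := by
  have := inv_pow_lt_one hb k i
  have hb0 : (0 : ℝ) < b := by positivity
  refine inv_anti₀ (mul_pos (by positivity) (by linarith)) ?_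
  exact mul_le_of_le_one_right (by positivity) (sub_le_self _ (by positivity))

lemma rateTerm_le_two_mul (hb : 2 ≤ b) (k i : ℕ) :
    rateTerm b k i ≤ 2 * ((b : ℝ) ^ (2 * (i + 1)))⁻¹ := by
  have := inv_pow_lt_one hb k i
  have hb0 : (0 : ℝ) < b := by positivity
  rw [rateTerm, mul_inv, mul_comm]
  refine mul_le_mul_of_nonneg_right ?_ (by positivity)
  rw [inv_le_comm₀ (by linarith) (by norm_num)]
  linarith

lemma rateTerm_lt (hb : 2 ≤ b) (k i : ℕ) : rateTerm b (k + 1) i < rateTerm b k i := by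
  have := inv_pow_lt_one hb k i
  have hb0 : (0 : ℝ) < b := by positivity
  have hb1 : (1 : ℝ) < b := by exact_mod_cast hb
  refine inv_strictAnti₀ (mul_pos (by positivity) (by linarith)) ?_
  refine mul_lt_mul_of_pos_left (sub_lt_sub_left ?_ _) (by positivity)
  exact inv_strictAnti₀ (by positivity) (pow_lt_pow_right₀ hb1 (by omega))

lemma hasSum_geom_term (hb : 2 ≤ b) :
    HasSum (fun i : ℕ => ((b : ℝ) ^ (2 * (i + 1)))⁻¹) (((b : ℝ) ^ 2 - 1)⁻¹) := by
  have hb1 : (1 : ℝ) < b := by exact_mod_cast hb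
  have h1 : (1 : ℝ) < (b : ℝ) ^ 2 := one_lt_pow₀ hb1 two_ne_zero
  have h := (hasSum_geometric_of_lt_one (r := ((b : ℝ) ^ 2)⁻¹) (by positivity)
    (inv_lt_one_of_one_lt₀ h1)).mul_left ((b : ℝ) ^ 2)⁻¹
  have h3 : (b : ℝ) ^ 2 - 1 ≠ 0 := by linarith
  convert! h using 1
  · ext i
    rw [pow_mul, pow_succ, mul_inv, inv_pow, mul_comm]
  · field_simp

lemma summable_rateTerm (hb : 2 ≤ b) (k : ℕ) : Summable (rateTerm b k) :=
  Summable.of_nonneg_of_le (fun i => (rateTerm_pos hb k i).le) (rateTerm_le_two_mul hb k)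
    ((hasSum_geom_term hb).summable.mul_left 2)

lemma cutRate_pos (hb : 2 ≤ b) (k : ℕ) : 0 < cutRate b k := by
  have := pow_sub_one_pos hb one_ne_zero
  rw [pow_one] at this
  exact mul_pos (by positivity) ((summable_rateTerm hb k).tsum_pos (fun i => (rateTerm_pos hb k i).le)
    0 (rateTerm_pos hb k 0))

lemma cutRate_lt (hb : 2 ≤ b) (k : ℕ) : cutRate b (k + 1) < cutRate b k := by
  have := pow_sub_one_pos hb one_ne_zero
  rw [pow_one] at this
  exact mul_lt_mul_of_pos_left (Summable.tsum_lt_tsum (fun i => (rateTerm_lt hb k i).le)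
    (rateTerm_lt hb k 0) (summable_rateTerm hb _) (summable_rateTerm hb _)) (by positivity)

lemma cutRateInf_eq (hb : 2 ≤ b) :
    cutRateInf b = ((b : ℝ) - 1) ^ 2 * ∑' i : ℕ, ((b : ℝ) ^ (2 * (i + 1)))⁻¹ := by
  have := pow_sub_one_pos hb one_ne_zero
  rw [pow_one] at this
  rw [(hasSum_geom_term hb).tsum_eq, cutRateInf, show (b : ℝ) ^ 2 - 1 = (b - 1) * (b + 1) by ring]
  field_simp

lemma tendsto_cutRate (hb : 2 ≤ b) : Tendsto (cutRate b) atTop (𝓝 (cutRateInf b)) := by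
  rw [cutRateInf_eq hb]
  refine Tendsto.const_mul _ ?_
  refine tendsto_tsum_of_dominated_convergence
    ((hasSum_geom_term hb).summable.mul_left 2) (fun i => ?_)
    (Eventually.of_forall fun k i => ?_)
  · have hb1 : (1 : ℝ) < b := by exact_mod_cast hb
    have h1 : Tendsto (fun k : ℕ => ((b : ℝ) ^ (k + i + 1))⁻¹) atTop (𝓝 0) := by
      refine tendsto_inv_atTop_zero.comp ((tendsto_pow_atTop_atTop_of_one_lt hb1).comp ?_)
      simp_rw [add_assoc]
      exact tendsto_add_atTop_nat _
    have h2 := ((h1.const_sub 1).const_mul ((b : ℝ) ^ (2 * (i + 1)))).inv₀ (by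
      have : (0 : ℝ) < b := by linarith
      simp [this.ne'])
    simpa [rateTerm] using h2
  · rw [Real.norm_of_nonneg (rateTerm_pos hb k i).le]
    exact rateTerm_le_two_mul hb k i

lemma cutAt_le_cutRate (hb : 2 ≤ b) {k : ℕ} (hk : k ≤ n) : cutAt b n k ≤ cutRate b k := by
  rw [cutAt_eq hb hk, cutRate]
  exact mul_le_mul_of_nonneg_left ((summable_rateTerm hb k).sum_le_tsum _
    fun i _ => (rateTerm_pos hb k i).le) (sq_nonneg _)

lemma cutAt_pos (hb : 2 ≤ b) {k : ℕ} (hk : k < n) : 0 < cutAt b n k := by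
  have := pow_sub_one_pos hb one_ne_zero
  rw [pow_one] at this
  rw [cutAt_eq hb hk.le]
  refine mul_pos (by positivity) (Finset.sum_pos (fun i _ => rateTerm_pos hb k i) ?_)
  exact ⟨0, Finset.mem_range.2 (by omega)⟩

/-- The edge rate converges exponentially fast. -/
lemma cutRate_sub_cutAt_le (hb : 2 ≤ b) {k : ℕ} (hk : k ≤ n) :
    cutRate b k - cutAt b n k ≤ 2 * cutRateInf b * ((b : ℝ) ^ (2 * (n - k)))⁻¹ := by
  rw [cutAt_eq hb hk, cutRate, cutRateInf_eq hb, ← mul_sub,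
    ← (summable_rateTerm hb k).sum_add_tsum_nat_add (n - k), add_sub_cancel_left,
    mul_left_comm, mul_assoc, mul_assoc]
  refine mul_le_mul_of_nonneg_left ?_ (sq_nonneg _)
  rw [← tsum_mul_right, ← tsum_mul_left]
  refine Summable.tsum_le_tsum (fun i => ?_) ((summable_nat_add_iff _).2 (summable_rateTerm hb k))
    (((hasSum_geom_term hb).summable.mul_right _).mul_left 2)
  rw [← mul_inv, ← pow_add]
  convert! rateTerm_le_two_mul hb k (i + (n - k)) using 4
  ring

lemma cutRateInf_mul_le_cutAt (hb : 2 ≤ b) {k : ℕ} (hk : k ≤ n) :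
    cutRateInf b * (1 - ((b : ℝ) ^ (2 * (n - k)))⁻¹) ≤ cutAt b n k := by
  have hs := (hasSum_geom_term hb).summable
  have h1 := hs.sum_add_tsum_nat_add (n - k)
  have h2 : ∑' i : ℕ, ((b : ℝ) ^ (2 * (i + (n - k) + 1)))⁻¹ =
      (∑' i : ℕ, ((b : ℝ) ^ (2 * (i + 1)))⁻¹) * ((b : ℝ) ^ (2 * (n - k)))⁻¹ := by
    rw [← tsum_mul_right]
    refine tsum_congr fun i => ?_
    rw [← mul_inv, ← pow_add]
    congr 2
    ring
  rw [cutAt_eq hb hk, cutRateInf_eq hb, mul_assoc]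
  refine mul_le_mul_of_nonneg_left ?_ (sq_nonneg _)
  rw [mul_sub, mul_one, ← h2, ← h1, add_sub_cancel_right]
  exact Finset.sum_le_sum fun i _ => geom_term_le_rateTerm hb k i

/-- The edge rates at consecutive heights are separated uniformly in `n`. -/
lemma exists_cutAt_gap (hb : 2 ≤ b) (k : ℕ) :
    ∃ δ : ℝ, 0 < δ ∧ ∀ n, k + 1 < n → cutAt b n (k + 1) + δ ≤ cutAt b n k := by
  have := pow_sub_one_pos hb one_ne_zero
  rw [pow_one] at this
  -- The gap is the difference of the first terms of the two series. The other terms are compared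
  -- one by one, and the sum at height `k` has one more, positive, term.
  refine ⟨((b : ℝ) - 1) ^ 2 * (rateTerm b k 0 - rateTerm b (k + 1) 0),
    mul_pos (by positivity) (sub_pos.2 (rateTerm_lt hb k 0)), fun n hn => ?_⟩
  rw [cutAt_eq hb hn.le, cutAt_eq hb (by omega), ← mul_add]
  refine mul_le_mul_of_nonneg_left ?_ (sq_nonneg _)
  obtain ⟨m, hm⟩ : ∃ m, n - k = m + 1 + 1 := ⟨n - k - 2, by omega⟩
  rw [hm, show n - (k + 1) = m + 1 by omega, Finset.sum_range_succ _ (m + 1),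
    Finset.sum_range_succ' _ m, Finset.sum_range_succ' _ m]
  have h1 := Finset.sum_le_sum fun i (_ : i ∈ Finset.range m) => (rateTerm_lt hb k (i + 1)).le
  have h2 := rateTerm_pos hb k (m + 1)
  linarith

end Rate

/-! ### An isoperimetric inequality -/

section Isoperimetry

variable {b n : ℕ}

/-- Edges between pieces of `D` below different children of `v` belong to the boundaries of the
pieces but not to that of `D`. Two such leaves have lowest common ancestor `v`, so each such pair
has the same rate. -/
lemma cut_add_sum (D : Finset (Leaf b n)) {v : List (Fin b)} {k : ℕ}
    (hv : v.length + (k + 1) = n) (hD : D ⊆ below n v) :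
    ∑ a, flow (D ∩ below n (a :: v)) (D ∩ below n (a :: v))ᶜ =
      flow D Dᶜ + tailWeight b n (k + 1) *
        ∑ a, ((D ∩ below n (a :: v)).card : ℝ) * (D.card - (D ∩ below n (a :: v)).card) := by
  set E : Fin b → Finset (Leaf b n) := fun a => D ∩ below n (a :: v)
  have hE : D = Finset.univ.biUnion E := by
    rw [← Finset.inter_biUnion, ← below_eq_biUnion (by omega), Finset.inter_eq_left.2 hD]
  have hdisj : ∀ a ∈ Finset.univ, ∀ a' ∈ Finset.univ, a ≠ a' → Disjoint (E a) (E a') :=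
    fun a _ a' _ h => (below_cons_disjoint h).mono Finset.inter_subset_right Finset.inter_subset_right
  have hflow : flow D Dᶜ = ∑ a, flow (E a) Dᶜ := by
    conv_lhs => rw [flow, hE, Finset.sum_biUnion hdisj, ← hE]
    rfl
  rw [hflow, Finset.mul_sum, ← Finset.sum_add_distrib]
  refine Finset.sum_congr rfl fun a _ => ?_
  have hsub : E a ⊆ D := Finset.inter_subset_left
  have hc : (E a)ᶜ = Dᶜ ∪ (D \ E a) := by
    ext x
    have := @hsub x
    simp only [Finset.mem_compl, Finset.mem_union, Finset.mem_sdiff]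
    tauto
  change flow (E a) (E a)ᶜ = _
  rw [hc, flow_union_right _ (disjoint_compl_left.mono_right Finset.sdiff_subset)]
  congr 1
  have hval : ∀ x ∈ E a, ∀ y ∈ D \ E a, returnProb x y = tailWeight b n (k + 1) := by
    intro x hx y hy
    rw [Finset.mem_sdiff] at hy
    have hxv := (mem_below_iff hv).1 (hD (hsub hx))
    have hyv := (mem_below_iff hv).1 (hD hy.1)
    have hva : (a :: v).length + k = n := by simp; omega
    refine returnProb_eq_tailWeight (Nat.succ_pos k) ?_ (hxv.trans hyv.symm)
    rw [Nat.add_sub_cancel, (mem_below_iff hva).1 (Finset.mem_inter.1 hx).2]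
    intro h
    exact hy.2 (Finset.mem_inter.2 ⟨hy.1, (mem_below_iff hva).2 h.symm⟩)
  rw [flow, Finset.sum_congr rfl fun x hx => Finset.sum_congr rfl fun y hy => hval x hx y hy]
  simp only [Finset.sum_const, nsmul_eq_mul]
  rw [Finset.card_sdiff_of_subset hsub, Nat.cast_sub (Finset.card_le_card hsub)]
  ring

/-- The counting step of the isoperimetric inequality. -/
lemma le_cut_of_children (hb : 2 ≤ b) {D : Finset (Leaf b n)} {v : List (Fin b)} {k : ℕ}
    (hv : v.length + (k + 1) = n) (hD : D ⊆ below n v) {e : Fin b → ℝ}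
    (he : ∀ a, (D ∩ below n (a :: v)).Nonempty → cutAt b n k + e a ≤
      flow (D ∩ below n (a :: v)) (D ∩ below n (a :: v))ᶜ)
    {s : ℕ} (hs : s = (Finset.univ.filter fun a => (D ∩ below n (a :: v)).Nonempty).card) :
    s * cutAt b n k + ∑ a ∈ Finset.univ.filter fun a => (D ∩ below n (a :: v)).Nonempty, e a
      - tailWeight b n (k + 1) * (s * (s - 1)) * ((b : ℝ) ^ k) ^ 2 ≤ flow D Dᶜ := by
  set I : Finset (Fin b) := Finset.univ.filter fun a => (D ∩ below n (a :: v)).Nonempty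
  have h := cut_add_sum D hv hD
  have htail : 0 ≤ tailWeight b n (k + 1) := Finset.sum_nonneg fun j hj => by
    rw [Finset.mem_Icc] at hj
    exact levelWeight_nonneg hb (by omega) hj.2
  have h1 : s * cutAt b n k + ∑ a ∈ I, e a ≤
      ∑ a, flow (D ∩ below n (a :: v)) (D ∩ below n (a :: v))ᶜ := by
    rw [hs, ← nsmul_eq_mul, ← Finset.sum_const, ← Finset.sum_add_distrib]
    exact (Finset.sum_le_sum fun a ha => he a (Finset.mem_filter.1 ha).2).trans
      (Finset.sum_le_sum_of_subset_of_nonneg (Finset.subset_univ _) fun _ _ _ => flow_nonneg hb _ _)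
  have hcard : ∀ a, ((D ∩ below n (a :: v)).card : ℝ) ≤ (b : ℝ) ^ k := fun a => by
    have h2 := Finset.card_le_card (Finset.inter_subset_right (s₁ := D) (s₂ := below n (a :: v)))
    rw [card_below (k := k) (by simp; omega)] at h2
    exact_mod_cast h2
  have hzero : ∀ a, a ∉ I → (D ∩ below n (a :: v)).card = 0 := fun a ha => by
    rw [Finset.card_eq_zero, ← Finset.not_nonempty_iff_eq_empty]
    exact fun h => ha (Finset.mem_filter.2 ⟨Finset.mem_univ _, h⟩)
  have hDcard : (D.card : ℝ) = ∑ a ∈ I, ((D ∩ below n (a :: v)).card : ℝ) := by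
    rw [Finset.sum_subset (Finset.subset_univ I) fun a _ ha => by rw [hzero a ha, Nat.cast_zero],
      ← Nat.cast_sum, ← Finset.card_biUnion fun a _ a' _ h => (below_cons_disjoint h).mono
        Finset.inter_subset_right Finset.inter_subset_right, ← Finset.inter_biUnion,
      ← below_eq_biUnion (by omega), Finset.inter_eq_left.2 hD]
  -- Each of the `s` nonempty pieces has at most `b^k` leaves, and the others together have at most
  -- `(s-1) b^k`.
  have h2 : ∑ a, ((D ∩ below n (a :: v)).card : ℝ) * (D.card - (D ∩ below n (a :: v)).card) ≤
      s * (s - 1) * ((b : ℝ) ^ k) ^ 2 := by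
    rw [← Finset.sum_subset (Finset.subset_univ I) fun a _ ha => by
      rw [hzero a ha, Nat.cast_zero, zero_mul]]
    have h3 : ∀ a ∈ I, ((D ∩ below n (a :: v)).card : ℝ) *
        (D.card - (D ∩ below n (a :: v)).card) ≤ (b : ℝ) ^ k * ((s - 1) * (b : ℝ) ^ k) := by
      intro a ha
      have h4 : (D.card : ℝ) - (D ∩ below n (a :: v)).card =
          ∑ a' ∈ I.erase a, ((D ∩ below n (a' :: v)).card : ℝ) := by
        rw [hDcard, ← Finset.add_sum_erase I _ ha, add_sub_cancel_left]
      have h5 : ∑ a' ∈ I.erase a, ((D ∩ below n (a' :: v)).card : ℝ) ≤ (s - 1) * (b : ℝ) ^ k := by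
        refine (Finset.sum_le_sum fun a' _ => hcard a').trans ?_
        rw [Finset.sum_const, nsmul_eq_mul, Finset.card_erase_of_mem ha, ← hs,
          Nat.cast_sub (by rw [hs]; exact Finset.card_pos.2 ⟨a, ha⟩), Nat.cast_one]
      rw [h4]
      exact mul_le_mul (hcard a) h5 (Finset.sum_nonneg fun _ _ => Nat.cast_nonneg _) (by positivity)
    refine (Finset.sum_le_sum h3).trans ?_
    rw [Finset.sum_const, nsmul_eq_mul, ← hs]
    exact le_of_eq (by ring)
  have h6 := mul_le_mul_of_nonneg_left h2 htail
  linarith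

/-- Among the nonempty sets of leaves below a vertex, the set of all of them has the smallest edge
boundary, and any other set has a boundary that is larger by a fixed amount. -/
theorem exists_isoperimetric (hb : 2 ≤ b) (k : ℕ) :
    ∃ δ : ℝ, 0 < δ ∧ ∀ n, k < n → ∀ v : List (Fin b), v.length + k = n →
      ∀ D : Finset (Leaf b n), D ⊆ below n v → D.Nonempty →
        D = below n v ∨ cutAt b n k + δ ≤ flow D Dᶜ := by
  induction k with
  | zero =>
    refine ⟨1, one_pos, fun n _ v hv D hD hne => Or.inl ?_⟩
    rw [below_leaf v hv] at hD ⊢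
    exact (Finset.subset_singleton_iff.1 hD).resolve_left hne.ne_empty
  | succ k ih =>
    obtain ⟨δ, hδ, ih⟩ := ih
    obtain ⟨g, hg, hgap⟩ := exists_cutAt_gap hb k
    have hb1 : (0 : ℝ) < (b : ℝ) - 1 := by simpa using pow_sub_one_pos hb one_ne_zero
    -- A proper subset either misses a child altogether, which gains `g / (b - 1)`, or meets all
    -- children and fills some child only partly, which gains the `δ` of the induction hypothesis.
    refine ⟨min δ (g / (b - 1)), lt_min hδ (by positivity), fun n hn v hv D hD hne => ?_⟩
    by_contra hcon
    rw [not_or, not_le] at hcon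
    obtain ⟨hDv, hlt⟩ := hcon
    have hva : ∀ a, (a :: v).length + k = n := fun a => by simp; omega
    set e : Fin b → ℝ := fun a => if D ∩ below n (a :: v) = below n (a :: v) then 0 else δ
    have he0 : ∀ a, 0 ≤ e a := fun a => by simp only [e]; split_ifs <;> linarith
    have hstep := le_cut_of_children hb hv hD (e := e) (fun a ha => by
      simp only [e]
      split_ifs with h
      · rw [h, cut_below (by omega) (hva a), add_zero]
      · exact (ih n (by omega) (a :: v) (hva a) _ Finset.inter_subset_right ha).resolve_left h) rfl
    set I : Finset (Fin b) := Finset.univ.filter fun a => (D ∩ below n (a :: v)).Nonempty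
    have hrec := cutAt_succ (b := b) (n := n) (k := k) hn.le
    have hgap := hgap n hn
    set c := cutAt b n k
    set c' := cutAt b n (k + 1)
    set r := tailWeight b n (k + 1)
    set m := ((b : ℝ) ^ k) ^ 2
    have hI1 : (1 : ℝ) ≤ I.card := by
      obtain ⟨x, hx⟩ := hne
      have := hD hx
      rw [below_eq_biUnion (by omega)] at this
      obtain ⟨a, -, ha⟩ := Finset.mem_biUnion.1 this
      have haI : a ∈ I := Finset.mem_filter.2
        ⟨Finset.mem_univ _, x, Finset.mem_inter.2 ⟨hx, ha⟩⟩
      exact_mod_cast Finset.card_pos.2 ⟨a, haI⟩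
    have hIb : (I.card : ℝ) ≤ b := by
      exact_mod_cast (Finset.card_le_univ I).trans_eq (Fintype.card_fin b)
    -- The recursion for the boundary converts the gap between consecutive heights into a positive
    -- lower bound for the bracket in `hid`.
    have hrm : r * m * b - c = (c - c') / (b - 1) := by
      rw [eq_div_iff hb1.ne', hrec]; ring
    have hrm' : g / (b - 1) ≤ r * m * b - c := by
      rw [hrm]
      exact div_le_div_of_nonneg_right (by linarith) hb1.le
    have hr : 0 ≤ r * m := by
      refine mul_nonneg (Finset.sum_nonneg fun j hj => ?_) (by positivity)
      rw [Finset.mem_Icc] at hj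
      exact levelWeight_nonneg hb (by omega) hj.2
    -- The bound for `|I|` full children is concave in `|I|` and equals `c'` at `|I| = b`; factoring
    -- out `b - |I|` leaves a bracket that is at least `g / (b - 1)` once `|I| ≥ 1`.
    have hid : I.card * c - r * (I.card * (I.card - 1)) * m =
        c' + (b - I.card) * (r * m * (I.card + b - 1) - c) := by
      rw [hrec]; ring
    have hge : g / (b - 1) ≤ r * m * (I.card + b - 1) - c := by nlinarith
    have hgpos : 0 < g / (b - 1) := by positivity
    rcases hIb.lt_or_eq with hlt' | heq
    · have h1 : (1 : ℝ) ≤ b - I.card := by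
        have h2 : I.card + 1 ≤ b := by exact_mod_cast hlt'
        have h3 : ((I.card + 1 : ℕ) : ℝ) ≤ b := by exact_mod_cast h2
        push_cast at h3
        linarith
      have h2 := Finset.sum_nonneg fun a (_ : a ∈ I) => he0 a
      have h3 := min_le_right δ (g / (b - 1))
      nlinarith
    · have hIu : I = Finset.univ := by
        rw [← Finset.card_eq_iff_eq_univ, Fintype.card_fin]
        exact_mod_cast heq
      obtain ⟨a, ha⟩ : ∃ a, D ∩ below n (a :: v) ≠ below n (a :: v) := by
        by_contra hall
        push Not at hall
        refine hDv (hD.antisymm ?_)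
        rw [below_eq_biUnion (by omega)]
        exact Finset.biUnion_subset.2 fun a _ => (hall a) ▸ Finset.inter_subset_left
      have h1 := Finset.single_le_sum (fun a _ => he0 a) (hIu ▸ Finset.mem_univ a : a ∈ I)
      have h2 : e a = δ := if_neg ha
      have h3 := min_le_left δ (g / (b - 1))
      rw [heq] at hid hstep
      nlinarith

lemma cutAt_le_cut (hb : 2 ≤ b) {k : ℕ} (hk : k < n) {v : List (Fin b)} (hv : v.length + k = n)
    {D : Finset (Leaf b n)} (hD : D ⊆ below n v) (hne : D.Nonempty) :
    cutAt b n k ≤ flow D Dᶜ := by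
  obtain ⟨δ, hδ, h⟩ := exists_isoperimetric hb k
  rcases h n hk v hv D hD hne with rfl | h
  · exact (cut_below (by omega) hv).ge
  · linarith

end Isoperimetry

/-! ### The events -/

section Events

variable {b n : ℕ}

lemma isDescendant_iff {x v : TreeVertex b n} : x.IsDescendant v ↔ v.word <:+ x.word := by
  constructor
  · intro h
    induction h with
    | refl => exact List.suffix_rfl
    | tail _ h ih =>
      obtain ⟨a, h⟩ := (TreeVertex.isParent_iff _ _).1 h
      exact List.IsSuffix.trans (h ▸ List.suffix_cons a _) ih
  · rintro ⟨t, ht⟩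
    induction t generalizing x with
    | nil => rw [TreeVertex.word_injective ht]; exact Relation.ReflTransGen.refl
    | cons a t ih =>
      have hne : x.word ≠ [] := by rw [← ht]; simp
      exact Relation.ReflTransGen.head (isParent_parent hne)
        (ih (x := x.parent) (by rw [TreeVertex.word_parent, ← ht]; simp))

/-- The vertex with a given word. -/
def vertexOf (v : List (Fin b)) {k : ℕ} (hv : v.length + k = n) : TreeVertex b n :=
  ⟨v, by omega⟩

lemma height_vertexOf (v : List (Fin b)) {k : ℕ} (hv : v.length + k = n) :
    (vertexOf v hv).height = k := by
  change n - v.length = k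
  omega

lemma TreeVertex.length_add {v : TreeVertex b n} {k : ℕ} (h : v.height = k) :
    v.word.length + k = n := by
  have := v.length_eq
  have := v.height_le
  omega

lemma leaf_isDescendant_iff {x : Leaf b n} {v : TreeVertex b n} :
    x.1.IsDescendant v ↔ x ∈ below n v.word := by
  rw [isDescendant_iff, mem_below]; rfl

lemma mem_eventD_iff {k : ℕ} {ω : ParticleOutcome b n} :
    ω ∈ eventD b n k ↔ ∃ v : List (Fin b), v.length + k = n ∧
      ω ∈ noEdge (below n v) (below n v)ᶜ := by
  simp only [eventD, Set.mem_ofPred_eq, mem_noEdge_iff, Finset.mem_compl, leaf_isDescendant_iff]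
  constructor
  · rintro ⟨v, hv, h⟩
    exact ⟨v.word, TreeVertex.length_add hv, fun x hx y hy => h x y hx hy⟩
  · rintro ⟨v, hv, h⟩
    exact ⟨vertexOf v hv, height_vertexOf v hv, fun x y hx hy => h x hx y hy⟩

lemma eventD_eq {k : ℕ} (hk : k ≤ n) :
    eventD b n k = ⋃ v ∈ words b (n - k), noEdge (below n v) (below n v)ᶜ := by
  ext ω
  simp only [mem_eventD_iff, Set.mem_iUnion, mem_words, exists_prop]
  refine exists_congr fun v => and_congr_left' ?_
  omega

lemma measurableSet_eventD {k : ℕ} (hk : k ≤ n) : MeasurableSet (eventD b n k) := by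
  rw [eventD_eq hk]
  exact Finset.measurableSet_biUnion _ fun v _ => measurableSet_noEdge _ _

/-- The set of leaves in the component of `x`. -/
noncomputable def componentOf (ω : ParticleOutcome b n) (x : Leaf b n) : Finset (Leaf b n) :=
  open Classical in Finset.univ.filter fun y => Relation.ReflTransGen (particleGraph ω).Adj x y

lemma mem_componentOf {ω : ParticleOutcome b n} {x y : Leaf b n} :
    y ∈ componentOf ω x ↔ Relation.ReflTransGen (particleGraph ω).Adj x y := by
  simp [componentOf]

lemma mem_componentOf_self (ω : ParticleOutcome b n) (x : Leaf b n) : x ∈ componentOf ω x :=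
  mem_componentOf.2 Relation.ReflTransGen.refl

lemma mem_noEdge_componentOf (ω : ParticleOutcome b n) (x : Leaf b n) :
    ω ∈ noEdge (componentOf ω x) (componentOf ω x)ᶜ := by
  rw [mem_noEdge_iff]
  intro y hy z hz h
  exact (Finset.mem_compl.1 hz) (mem_componentOf.2 ((mem_componentOf.1 hy).tail h))

lemma componentOf_subset {ω : ParticleOutcome b n} {A : Finset (Leaf b n)}
    (h : ω ∈ noEdge A Aᶜ) {x : Leaf b n} (hx : x ∈ A) : componentOf ω x ⊆ A := by
  intro y hy
  have hy := mem_componentOf.1 hy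
  induction hy with
  | refl => exact hx
  | tail h1 h2 ih =>
    have ih := ih (mem_componentOf.2 h1)
    by_contra hc
    exact mem_noEdge_iff.1 h _ ih _ (Finset.mem_compl.2 hc) h2

lemma mem_eventC_iff {k : ℕ} {ω : ParticleOutcome b n} :
    ω ∈ eventC b n k ↔ ∃ v : List (Fin b), v.length + k = n ∧ ∃ x,
      componentOf ω x ⊆ below n v := by
  simp only [eventC, Set.mem_ofPred_eq, leaf_isDescendant_iff]
  constructor
  · rintro ⟨C, ⟨x, -, rfl⟩, v, hv, h⟩
    exact ⟨v.word, TreeVertex.length_add hv, x, fun y hy => h y (mem_componentOf.1 hy)⟩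
  · rintro ⟨v, hv, x, h⟩
    exact ⟨_, ⟨x, Set.mem_univ _, rfl⟩, vertexOf v hv, height_vertexOf v hv,
      fun y hy => h (mem_componentOf.2 hy)⟩

lemma eventD_subset_eventC (hb : b ≠ 0) {k : ℕ} : eventD b n k ⊆ eventC b n k := by
  intro ω h
  obtain ⟨v, hv, h⟩ := mem_eventD_iff.1 h
  obtain ⟨x, hx⟩ := below_nonempty hb hv
  exact mem_eventC_iff.2 ⟨v, hv, x, componentOf_subset h hx⟩

lemma eventConnected_disjoint_eventD (hb : 2 ≤ b) {k : ℕ} (hk : k < n) :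
    Disjoint (eventConnected b n) (eventD b n k) := by
  refine Set.disjoint_left.2 fun ω hc hd => ?_
  obtain ⟨v, hv, h⟩ := mem_eventD_iff.1 hd
  obtain ⟨x, hx⟩ := below_nonempty (by omega) hv
  have hcard : (below n v).card < Fintype.card (Leaf b n) := by
    have h1 := card_below hv
    have h2 := card_below (b := b) (n := n) (v := []) (k := n) (by simp)
    rw [h1]
    refine (Nat.pow_lt_pow_right (by omega) hk).trans_le ?_
    rw [← h2]
    exact Finset.card_le_univ _
  obtain ⟨y, -, hy⟩ := Finset.exists_mem_notMem_of_card_lt_card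
    (s := below n v) (t := Finset.univ) hcard
  exact hy (componentOf_subset h hx (mem_componentOf.2 (hc.2 x (Set.mem_univ _) y (Set.mem_univ _))))

lemma eventIsolated_eq : eventIsolated b n = eventD b n 0 := by
  ext ω
  rw [mem_eventD_iff]
  simp only [eventIsolated, IsIsolated, Set.mem_ofPred_eq]
  constructor
  · rintro ⟨x, -, h⟩
    refine ⟨x.word, x.length_eq, mem_noEdge_iff.2 ?_⟩
    rw [below_leaf _ x.length_eq]
    intro y hy z hz
    obtain rfl : y = x := Finset.mem_singleton.1 hy
    exact h z fun hzy => (Finset.mem_compl.1 hz) (hzy ▸ hy)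
  · rintro ⟨v, hv, h⟩
    rw [below_leaf v hv, mem_noEdge_iff] at h
    refine ⟨leafOf v hv, Set.mem_univ _, fun y hy => h _ (Finset.mem_singleton_self _) y ?_⟩
    exact Finset.mem_compl.2 fun h' => hy (Finset.mem_singleton.1 h')

/-! ### First and second moments -/

lemma particleLaw_noEdge_below (hb : 2 ≤ b) {k : ℕ} (hk : k < n) (lam : ℝ≥0) {v : List (Fin b)}
    (hv : v.length + k = n) :
    (particleLaw b n lam).real (noEdge (below n v) (below n v)ᶜ) =
      Real.exp (-(lam * cutAt b n k)) := by
  rw [particleLaw_noEdge hb (by omega) lam disjoint_compl_right, cut_below (by omega) hv]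

lemma particleLaw_eventD_le (hb : 2 ≤ b) {k : ℕ} (hk : k < n) (lam : ℝ≥0) :
    (particleLaw b n lam).real (eventD b n k) ≤
      (b : ℝ) ^ (n - k) * Real.exp (-(lam * cutAt b n k)) := by
  rw [eventD_eq hk.le]
  refine (measureReal_biUnion_finset_le _ _).trans (le_of_eq ?_)
  rw [Finset.sum_congr rfl fun v hv => particleLaw_noEdge_below hb hk lam
    (by rw [mem_words.1 hv]; omega : v.length + k = n), Finset.sum_const, card_words, nsmul_eq_mul]
  push_cast
  rfl

/-- A component with all its vertices below `v` is either the whole set, which is the event `D_k`,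
or one of at most `2^(b^k)` nonempty proper subsets, whose boundaries exceed `cutAt` by at least the
isoperimetric `δ`. -/
lemma exists_particleLaw_eventC_le (hb : 2 ≤ b) (k : ℕ) :
    ∃ δ : ℝ, 0 < δ ∧ ∀ n, k < n → ∀ lam : ℝ≥0, (particleLaw b n lam).real (eventC b n k) ≤
      (particleLaw b n lam).real (eventD b n k) +
        (b : ℝ) ^ (n - k) * (2 ^ b ^ k * Real.exp (-(lam * (cutAt b n k + δ)))) := by
  obtain ⟨δ, hδ, h⟩ := exists_isoperimetric hb k
  refine ⟨δ, hδ, fun n hk lam => ?_⟩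
  classical
  set 𝒟 : List (Fin b) → Finset (Finset (Leaf b n)) := fun v =>
    (below n v).powerset.filter fun D => D.Nonempty ∧ D ≠ below n v
  have hsub : eventC b n k ⊆ eventD b n k ∪
      ⋃ v ∈ words b (n - k), ⋃ D ∈ 𝒟 v, noEdge D Dᶜ := by
    intro ω hω
    obtain ⟨v, hv, x, hx⟩ := mem_eventC_iff.1 hω
    by_cases hD : componentOf ω x = below n v
    · exact Or.inl (mem_eventD_iff.2 ⟨v, hv, hD ▸ mem_noEdge_componentOf ω x⟩)
    · refine Or.inr ?_
      simp only [Set.mem_iUnion]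
      exact ⟨v, mem_words.2 (by omega), componentOf ω x, Finset.mem_filter.2
        ⟨Finset.mem_powerset.2 hx, ⟨x, mem_componentOf_self ω x⟩, hD⟩, mem_noEdge_componentOf ω x⟩
  refine (measureReal_mono hsub).trans ((measureReal_union_le _ _).trans (add_le_add_right ?_ _))
  refine (measureReal_biUnion_finset_le _ _).trans ?_
  have hv : ∀ v ∈ words b (n - k), (particleLaw b n lam).real (⋃ D ∈ 𝒟 v, noEdge D Dᶜ) ≤
      2 ^ b ^ k * Real.exp (-(lam * (cutAt b n k + δ))) := by
    intro v hv
    have hv : v.length + k = n := by rw [mem_words.1 hv]; omega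
    refine (measureReal_biUnion_finset_le _ _).trans ?_
    have hD : ∀ D ∈ 𝒟 v, (particleLaw b n lam).real (noEdge D Dᶜ) ≤
        Real.exp (-(lam * (cutAt b n k + δ))) := by
      intro D hD
      obtain ⟨h1, h2, h3⟩ := Finset.mem_filter.1 hD
      rw [particleLaw_noEdge hb (by omega) lam disjoint_compl_right]
      refine Real.exp_le_exp.2 (neg_le_neg (mul_le_mul_of_nonneg_left ?_ lam.2))
      exact (h n hk v hv D (Finset.mem_powerset.1 h1) h2).resolve_left h3
    refine (Finset.sum_le_sum hD).trans ?_
    rw [Finset.sum_const, nsmul_eq_mul]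
    refine mul_le_mul_of_nonneg_right ?_ (Real.exp_nonneg _)
    have := Finset.card_filter_le (below n v).powerset fun D => D.Nonempty ∧ D ≠ below n v
    rw [Finset.card_powerset, card_below hv] at this
    exact_mod_cast this
  refine (Finset.sum_le_sum hv).trans (le_of_eq ?_)
  rw [Finset.sum_const, card_words, nsmul_eq_mul]
  push_cast
  rfl

/-- If `N` is the number of events that occur, then `2tN - (tN)^2` is at most `1`, and it is `0`
when `N = 0`; integrate. Optimising over `t` would give the usual second moment bound. -/
lemma le_measureReal_biUnion {Ω ι : Type*} [MeasurableSpace Ω] (μ : Measure Ω)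
    [IsProbabilityMeasure μ] (s : Finset ι) (A : ι → Set Ω) (hA : ∀ i ∈ s, MeasurableSet (A i))
    (t : ℝ) :
    2 * t * ∑ i ∈ s, μ.real (A i) - t ^ 2 * ∑ i ∈ s, ∑ j ∈ s, μ.real (A i ∩ A j) ≤
      μ.real (⋃ i ∈ s, A i) := by
  have hi : ∀ i ∈ s, Integrable ((A i).indicator (1 : Ω → ℝ)) μ := fun i hi =>
    (integrable_const (1 : ℝ)).indicator (hA i hi)
  have hij : ∀ i ∈ s, ∀ j ∈ s, Integrable ((A i ∩ A j).indicator (1 : Ω → ℝ)) μ :=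
    fun i hi j hj => (integrable_const (1 : ℝ)).indicator ((hA i hi).inter (hA j hj))
  have hU := Finset.measurableSet_biUnion s hA
  rw [← integral_indicator_one hU,
    Finset.sum_congr rfl fun i hi => (integral_indicator_one (hA i hi)).symm,
    Finset.sum_congr rfl fun i hi => Finset.sum_congr rfl fun j hj =>
      (integral_indicator_one ((hA i hi).inter (hA j hj))).symm,
    ← integral_finsetSum _ hi, Finset.sum_congr rfl fun i hi' =>
      (integral_finsetSum s (hij i hi')).symm,
    ← integral_finsetSum _ fun i hi' => integrable_finsetSum s (hij i hi'),
    ← integral_const_mul, ← integral_const_mul, ← integral_sub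
      ((integrable_finsetSum s hi).const_mul _)
      ((integrable_finsetSum s fun i hi' => integrable_finsetSum s (hij i hi')).const_mul _)]
  refine integral_mono (((integrable_finsetSum s hi).const_mul _).sub
      ((integrable_finsetSum s fun i hi' => integrable_finsetSum s (hij i hi')).const_mul _))
      ((integrable_const (1 : ℝ)).indicator hU) fun ω => ?_
  have h1 : ∑ i ∈ s, ∑ j ∈ s, (A i ∩ A j).indicator (1 : Ω → ℝ) ω =
      (∑ i ∈ s, (A i).indicator (1 : Ω → ℝ) ω) ^ 2 := by
    rw [sq, Finset.sum_mul_sum]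
    simp only [Set.inter_indicator_one, Pi.mul_apply]
  simp only [h1]
  by_cases h : ω ∈ ⋃ i ∈ s, A i
  · rw [Set.indicator_of_mem h, Pi.one_apply]
    nlinarith [sq_nonneg (1 - t * ∑ i ∈ s, (A i).indicator (1 : Ω → ℝ) ω)]
  · have h2 : ∑ i ∈ s, (A i).indicator (1 : Ω → ℝ) ω = 0 := Finset.sum_eq_zero fun i hi =>
      Set.indicator_of_notMem (fun h' => h (Set.mem_biUnion hi h')) _
    rw [Set.indicator_of_notMem h, h2]
    simp

end Events

/-! ### Pairs of vertices of the same height -/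

section Pairs

variable {b n : ℕ}

lemma reachProb_le (hb : 2 ≤ b) {h : ℕ} (hh : h ≠ 0) : reachProb b n h ≤ 2 * b / (b : ℝ) ^ h := by
  have hb2 : (2 : ℝ) ≤ b := by exact_mod_cast hb
  have h1 := pow_sub_one_pos hb hh
  have h2 : (2 : ℝ) ≤ (b : ℝ) ^ h := hb2.trans (le_self_pow₀ (by linarith) hh)
  rw [reachProb]
  split_ifs
  · rw [div_le_div_iff₀ h1 (by positivity)]
    nlinarith
  · positivity

lemma tailWeight_nonneg (hb : 2 ≤ b) {h : ℕ} (hh : h ≠ 0) : 0 ≤ tailWeight b n h :=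
  Finset.sum_nonneg fun j hj => by
    rw [Finset.mem_Icc] at hj
    exact levelWeight_nonneg hb (by omega) hj.2

/-- In each term `1 / b^j ≤ 1 / b^h`, after which the differences of `reachProb` telescope. -/
lemma tailWeight_le (hb : 2 ≤ b) {h : ℕ} (hh : h ≠ 0) (hn : h ≤ n) :
    tailWeight b n h ≤ 2 * b / (b : ℝ) ^ (2 * h) := by
  have hb1 : (1 : ℝ) ≤ b := by exact_mod_cast (by omega : 1 ≤ b)
  have h1 : tailWeight b n h ≤
      ∑ j ∈ Finset.Ico h (n + 1), (reachProb b n j - reachProb b n (j + 1)) / (b : ℝ) ^ h := by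
    rw [tailWeight, Finset.Ico_add_one_right_eq_Icc]
    refine Finset.sum_le_sum fun j hj => ?_
    rw [Finset.mem_Icc] at hj
    have h2 := levelWeight_nonneg hb (by omega : j ≠ 0) hj.2
    rw [levelWeight] at h2 ⊢
    refine div_le_div_of_nonneg_left ?_ (by positivity) (pow_le_pow_right₀ hb1 hj.1)
    by_contra hneg
    exact absurd h2 (not_le.2 (div_neg_of_neg_of_pos (not_le.1 hneg) (by positivity)))
  refine h1.trans ?_
  rw [← Finset.sum_div, Finset.sum_Ico_eq_sum_range]
  have h3 := Finset.sum_range_sub' (fun i => reachProb b n (h + i)) (n + 1 - h)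
  simp only [← add_assoc, add_zero] at h3
  rw [h3, show reachProb b n (h + (n + 1 - h)) = 0 by rw [reachProb, if_neg (by omega)], sub_zero,
    two_mul h, pow_add, ← div_div]
  exact div_le_div_of_nonneg_right (reachProb_le hb hh) (by positivity)

lemma returnProb_le_tailWeight (hb : 2 ≤ b) {x y : Leaf b n} {h : ℕ}
    (hne : x.word.drop h ≠ y.word.drop h) : returnProb x y ≤ tailWeight b n (h + 1) := by
  rw [returnProb, sum_Icc_one_eq (Nat.succ_pos h), tailWeight]
  · refine Finset.sum_le_sum fun j hj => ?_
    rw [Finset.mem_Icc] at hj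
    have := levelWeight_nonneg hb (by omega : j ≠ 0) hj.2
    split_ifs
    · rw [mul_one]
    · rwa [mul_zero]
  · intro j hj
    rw [if_neg, mul_zero]
    intro h1
    have := congrArg (List.drop (h - j)) h1
    rw [List.drop_drop, List.drop_drop, show j + (h - j) = h by omega] at this
    exact hne this

lemma flow_below_le (hb : 2 ≤ b) {u v : List (Fin b)} {k h : ℕ} (hu : u.length + k = n)
    (hv : v.length + k = n) (hk : k ≤ h) (hne : u.drop (h - k) ≠ v.drop (h - k)) :
    flow (below n u) (below n v) ≤ ((b : ℝ) ^ k) ^ 2 * tailWeight b n (h + 1) := by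
  have : ∀ x ∈ below n u, ∀ y ∈ below n v, returnProb x y ≤ tailWeight b n (h + 1) := by
    intro x hx y hy
    refine returnProb_le_tailWeight hb ?_
    rw [show h = k + (h - k) by omega, ← List.drop_drop, ← List.drop_drop,
      (mem_below_iff hu).1 hx, (mem_below_iff hv).1 hy]
    exact hne
  refine (Finset.sum_le_sum fun x hx => Finset.sum_le_sum fun y hy => this x hx y hy).trans ?_
  simp only [Finset.sum_const, nsmul_eq_mul, card_below hu, card_below hv]
  push_cast
  exact le_of_eq (by ring)

/-- Two vertices of height `k` are joined by fewer edges than leave one of them. -/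
lemma exists_flow_below_le (hb : 2 ≤ b) (k : ℕ) :
    ∃ η : ℝ, 0 < η ∧ ∀ n, k + 2 < n → ∀ u v : List (Fin b), u.length + k = n → v.length + k = n →
      u ≠ v → flow (below n u) (below n v) ≤ cutAt b n k - η := by
  have hb2 : (2 : ℝ) ≤ b := by exact_mod_cast hb
  have h0 := pow_sub_one_pos hb one_ne_zero
  have h1 := pow_sub_one_pos hb (Nat.succ_ne_zero (k + 1))
  have h2 := pow_sub_one_pos hb (Nat.succ_ne_zero (k + 2))
  simp only [Nat.succ_eq_add_one, pow_one] at h0 h1 h2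
  have h3 : 0 < (b : ℝ) ^ (k + 2) - 2 * (b : ℝ) ^ k := by
    have : (0 : ℝ) < (b : ℝ) ^ k := by positivity
    have h4 : (2 : ℝ) < (b : ℝ) ^ 2 := by nlinarith
    rw [pow_add, mul_comm, ← sub_mul]
    exact mul_pos (by linarith) this
  -- This is the term `j = k + 2` of the sum in `h5`. The term `j = k + 1` is useless when `b = 2`,
  -- since then `b^(k+1) = 2 b^k`.
  refine ⟨(b : ℝ) ^ k * (((b : ℝ) - 1) ^ 2 / (((b : ℝ) ^ (k + 2) - 1) * ((b : ℝ) ^ (k + 3) - 1)) *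
    ((b : ℝ) ^ (k + 2) - 2 * (b : ℝ) ^ k)), by positivity, fun n hn u v hu hv huv => ?_⟩
  have h4 := flow_below_le hb hu hv le_rfl (by simpa using huv)
  have h5 : cutAt b n k - ((b : ℝ) ^ k) ^ 2 * tailWeight b n (k + 1) =
      (b : ℝ) ^ k * ∑ j ∈ Finset.Icc (k + 1) n,
        levelWeight b n j * ((b : ℝ) ^ j - 2 * (b : ℝ) ^ k) := by
    have : ∑ j ∈ Finset.Icc (k + 1) n, levelWeight b n j * ((b : ℝ) ^ j - 2 * (b : ℝ) ^ k) =
        ∑ j ∈ Finset.Icc (k + 1) n, levelWeight b n j * ((b : ℝ) ^ j - (b : ℝ) ^ k) -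
          (b : ℝ) ^ k * ∑ j ∈ Finset.Icc (k + 1) n, levelWeight b n j := by
      rw [Finset.mul_sum, ← Finset.sum_sub_distrib]
      exact Finset.sum_congr rfl fun j _ => by ring
    rw [this, cutAt, tailWeight]
    ring
  have h6 := Finset.single_le_sum (f := fun j => levelWeight b n j * ((b : ℝ) ^ j - 2 * (b : ℝ) ^ k))
    (s := Finset.Icc (k + 1) n) (fun j hj => by
      rw [Finset.mem_Icc] at hj
      refine mul_nonneg (levelWeight_nonneg hb (by omega) hj.2) ?_
      have h7 := pow_le_pow_right₀ (by linarith : (1 : ℝ) ≤ b) hj.1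
      have : (0 : ℝ) < (b : ℝ) ^ k := by positivity
      rw [pow_succ] at h7
      nlinarith) (Finset.mem_Icc.2 ⟨by omega, hn.le⟩ : k + 2 ∈ Finset.Icc (k + 1) n)
  rw [levelWeight_of_lt hb (by omega) hn] at h6
  have h7 := mul_le_mul_of_nonneg_left h6 (by positivity : 0 ≤ (b : ℝ) ^ k)
  linarith

lemma card_filter_drop_le {m d : ℕ} (hd : d ≤ m) (z : List (Fin b)) :
    open Classical in ((words b m).filter fun v => v.drop d = z).card ≤ b ^ d := by
  classical
  rw [← card_words b d]
  refine Finset.card_le_card_of_injOn (fun v => v.take d) (fun v hv => ?_) ?_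
  · have := mem_words.1 (Finset.mem_filter.1 hv).1
    exact mem_words.2 (by rw [List.length_take]; omega)
  · intro v hv v' hv' h
    rw [← List.take_append_drop d v, ← List.take_append_drop d v',
      (Finset.mem_filter.1 hv).2, (Finset.mem_filter.1 hv').2]
    simp only at h
    rw [h]

/-- A second moment estimate. -/
lemma exists_le_particleLaw_eventD (hb : 2 ≤ b) (k : ℕ) :
    ∃ η : ℝ, 0 < η ∧ ∀ n h, k + 2 < n → k ≤ h → h < n → ∀ (lam : ℝ≥0) (t : ℝ),
      2 * t * ((b : ℝ) ^ (n - k) * Real.exp (-(lam * cutAt b n k))) -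
        t ^ 2 * ((b : ℝ) ^ (n - k) * (Real.exp (-(lam * cutAt b n k)) +
          (b : ℝ) ^ (h - k) * Real.exp (-(lam * (cutAt b n k + η))) +
          (b : ℝ) ^ (n - k) * Real.exp (-(lam * (2 * cutAt b n k -
            ((b : ℝ) ^ k) ^ 2 * tailWeight b n (h + 1)))))) ≤
      (particleLaw b n lam).real (eventD b n k) := by
  classical
  obtain ⟨η, hη, hflow⟩ := exists_flow_below_le hb k
  refine ⟨η, hη, fun n h hn hk hh lam t => ?_⟩
  rw [eventD_eq (by omega)]
  refine le_trans ?_ (le_measureReal_biUnion _ _ _ (fun v _ => measurableSet_noEdge _ _) t)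
  have hlen : ∀ v ∈ words b (n - k), v.length + k = n := fun v hv => by
    rw [mem_words.1 hv]; omega
  have h1 : ∑ v ∈ words b (n - k), (particleLaw b n lam).real (noEdge (below n v) (below n v)ᶜ) =
      (b : ℝ) ^ (n - k) * Real.exp (-(lam * cutAt b n k)) := by
    rw [Finset.sum_congr rfl fun v hv => particleLaw_noEdge_below hb (by omega) lam (hlen v hv),
      Finset.sum_const, card_words, nsmul_eq_mul]
    push_cast
    rfl
  rw [h1]
  refine sub_le_sub_left (mul_le_mul_of_nonneg_left ?_ (sq_nonneg t)) _
  have h2 : ∀ u ∈ words b (n - k), ∑ v ∈ words b (n - k), (particleLaw b n lam).real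
      (noEdge (below n u) (below n u)ᶜ ∩ noEdge (below n v) (below n v)ᶜ) ≤
      Real.exp (-(lam * cutAt b n k)) +
          (b : ℝ) ^ (h - k) * Real.exp (-(lam * (cutAt b n k + η))) +
          (b : ℝ) ^ (n - k) * Real.exp (-(lam * (2 * cutAt b n k -
            ((b : ℝ) ^ k) ^ 2 * tailWeight b n (h + 1)))) := by
    intro u hu
    -- Three kinds of pairs: equal vertices; distinct ones with a common ancestor of height `h`, for
    -- which the joint boundary rate is at least `cutAt + η`; and the rest, for which the rate of
    -- edges between them is controlled by `tailWeight b n (h + 1)`.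
    have h3 : ∀ v ∈ words b (n - k), (particleLaw b n lam).real
      (noEdge (below n u) (below n u)ᶜ ∩ noEdge (below n v) (below n v)ᶜ) ≤
        (if v = u then Real.exp (-(lam * cutAt b n k)) else 0) +
        (if v.drop (h - k) = u.drop (h - k) then
          Real.exp (-(lam * (cutAt b n k + η))) else 0) +
        Real.exp (-(lam * (2 * cutAt b n k - ((b : ℝ) ^ k) ^ 2 * tailWeight b n (h + 1)))) := by
      intro v hv
      by_cases huv : v = u
      · subst huv
        rw [if_pos rfl, Set.inter_self, particleLaw_noEdge_below hb (by omega) lam (hlen v hv),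
          add_assoc]
        refine le_add_of_nonneg_right (add_nonneg ?_ (Real.exp_nonneg _))
        split_ifs
        · exact Real.exp_nonneg _
        · rfl
      · rw [if_neg huv, zero_add, particleLaw_noEdge_inter hb (by omega) lam (below_disjoint
          ((mem_words.1 hu).trans (mem_words.1 hv).symm) (Ne.symm huv)),
          cut_below (by omega) (hlen u hu), cut_below (by omega) (hlen v hv)]
        by_cases hd : v.drop (h - k) = u.drop (h - k)
        · rw [if_pos hd]
          refine le_add_of_le_of_nonneg (Real.exp_le_exp.2 (neg_le_neg
            (mul_le_mul_of_nonneg_left ?_ lam.2))) (Real.exp_nonneg _)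
          have := hflow n hn u v (hlen u hu) (hlen v hv) (Ne.symm huv)
          linarith
        · rw [if_neg hd, zero_add]
          refine Real.exp_le_exp.2 (neg_le_neg (mul_le_mul_of_nonneg_left ?_ lam.2))
          have := flow_below_le hb (hlen u hu) (hlen v hv) hk (Ne.symm hd)
          linarith
    refine (Finset.sum_le_sum h3).trans ?_
    rw [Finset.sum_add_distrib, Finset.sum_add_distrib, Finset.sum_ite_eq' , if_pos hu,
      ← Finset.sum_filter, Finset.sum_const, Finset.sum_const, card_words, nsmul_eq_mul,
      nsmul_eq_mul]
    have h4 : (((words b (n - k)).filter fun v => v.drop (h - k) = u.drop (h - k)).card : ℝ) ≤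
        (b : ℝ) ^ (h - k) := by
      exact_mod_cast card_filter_drop_le (by omega : h - k ≤ n - k) (u.drop (h - k))
    have h5 := mul_le_mul_of_nonneg_right h4
      (Real.exp_nonneg (-((lam : ℝ) * (cutAt b n k + η))))
    push_cast
    linarith
  refine (Finset.sum_le_sum h2).trans (le_of_eq ?_)
  rw [Finset.sum_const, card_words, nsmul_eq_mul]
  push_cast
  rfl

end Pairs

/-! ### Independence -/

section Independence

variable {b n : ℕ}

/-- Only particles started at first coordinates of `S` matter, so the event is determined by the
particles started in `X`. Hence such events for disjoint sets `X` and `Y` are independent. -/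
lemma measurableSet_comap_avoids {X : Finset (Leaf b n)} {S : Finset (Leaf b n × Leaf b n)}
    (hS : ∀ q ∈ S, q.1 ∈ X) :
    MeasurableSet[MeasurableSpace.comap
      (fun (ω : ParticleOutcome b n) (x : X) => ω x) MeasurableSpace.pi] (avoids S) := by
  refine ⟨Set.pi Set.univ fun x : X => {q | ∀ i < q.1, q.2 i ∉ returnsIn S x}, ?_, ?_⟩
  · exact MeasurableSet.pi Set.countable_univ fun x _ =>
      (poisson_prod_avoid (walkLaw (tree b n) x.1.1) 0 (measurableSet_returnsIn S x)).1
  · ext ω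
    rw [avoids_eq_pi]
    simp only [Set.mem_preimage, Set.mem_pi, Set.mem_univ, true_implies, Finset.coe_univ,
      Subtype.forall]
    refine ⟨fun h x => ?_, fun h x _ => h x⟩
    by_cases hx : x ∈ X
    · exact h x hx
    · have : returnsIn S x = ∅ := by
        simp only [returnsIn, Set.iUnion_eq_empty, Finset.mem_filter, Finset.mem_univ, true_and]
        exact fun y hy => absurd (hS _ hy) hx
      simp [this]

lemma indep_comap (lam : ℝ≥0) {X Y : Finset (Leaf b n)} (hXY : Disjoint X Y) :
    Indep (MeasurableSpace.comap (fun (ω : ParticleOutcome b n) (x : X) => ω x) MeasurableSpace.pi)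
      (MeasurableSpace.comap (fun (ω : ParticleOutcome b n) (x : Y) => ω x) MeasurableSpace.pi)
      (particleLaw b n lam) := by
  have h : iIndepFun (fun (x : Leaf b n) (ω : ParticleOutcome b n) => ω x) (particleLaw b n lam) :=
    iIndepFun_infinitePi (X := fun _ ω => ω) fun _ => measurable_id
  exact h.indepFun_finset X Y hXY fun x => measurable_pi_apply x

/-- An upper bound for the probability that a vertex has no edge leaving it, by independence of
the edges inside complementary sets of leaves. -/
lemma particleLaw_eventD_le_of_indep (hb : 2 ≤ b) {k : ℕ} (hk : k + 1 < n) (lam : ℝ≥0) {q : ℝ}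
    (hq : q = (b : ℝ) ^ (n - 1 - k) *
      Real.exp (-(lam * (cutAt b n k - (b : ℝ) ^ k * (cutRate b 0 / (b : ℝ) ^ (n - 1))))))
    (hq1 : q ≤ 1) (hq2 : (b - 1) * q ≤ 1) :
    (particleLaw b n lam).real (eventD b n k) ≤ 1 - (1 - q) * (1 - (b - 1) * q) := by
  classical
  set μ := particleLaw b n lam
  set E := Real.exp (-(lam * (cutAt b n k - (b : ℝ) ^ k * (cutRate b 0 / (b : ℝ) ^ (n - 1)))))
  -- The leaves are divided into those below one child of the apex and the rest. Keeping only the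
  -- edges within each part makes the two unions `U₁` and `U₂` independent, and each has a first
  -- moment of the right size.
  set a₀ : Fin b := ⟨0, by omega⟩
  set X : Finset (Leaf b n) := below n [a₀]
  have hlen : ∀ v ∈ words b (n - k), v.length + k = n := fun v hv => by
    rw [mem_words.1 hv]; omega
  have hdrop : ∀ v ∈ words b (n - k), ∃ a, v.drop (n - 1 - k) = [a] := fun v hv => by
    rw [← List.length_eq_one_iff, List.length_drop, mem_words.1 hv]; omega
  have hbelow : ∀ (v : List (Fin b)) (a : Fin b), v.drop (n - 1 - k) = [a] →
      below n v ⊆ below n [a] := fun v a h => below_mono (h ▸ List.drop_suffix _ _)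
  -- the bound for one vertex
  have hone : ∀ v ∈ words b (n - k), ∀ a, v.drop (n - 1 - k) = [a] →
      ∀ Z : Finset (Leaf b n), below n [a] ⊆ Z →
        μ.real (noEdge (below n v) (Z \ below n v)) ≤ E := by
    intro v hv a ha Z hZ
    have hvZ := (hbelow v a ha).trans hZ
    rw [particleLaw_noEdge hb (by omega) lam Finset.disjoint_sdiff]
    refine Real.exp_le_exp.2 (neg_le_neg (mul_le_mul_of_nonneg_left ?_ lam.2))
    have hc : (below n v)ᶜ = (Z \ below n v) ∪ Zᶜ := by
      ext x
      have := @hvZ x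
      simp only [Finset.mem_compl, Finset.mem_union, Finset.mem_sdiff]
      tauto
    have h1 := flow_union_right (below n v) (B := Z \ below n v) (C := Zᶜ)
      (disjoint_compl_right.mono_left Finset.sdiff_subset)
    rw [← hc, cut_below (by omega) (hlen v hv)] at h1
    -- The discarded edges leave the set below `[a]`, of height `n - 1`. By symmetry among its
    -- `b^(n-1)` leaves, only a fraction `b^k / b^(n-1)` of their rate belongs to the leaves below
    -- `v`.
    have h2 := flow_mono hb (subset_refl (below n v)) (Finset.compl_subset_compl.2 hZ)
    rw [flow_compl_below (k := n - 1) (by simp; omega) (hbelow v a ha), card_below (hlen v hv)] at h2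
    have h3 : cutAt b n (n - 1) ≤ cutRate b 0 :=
      (cutAt_le_cutRate hb (by omega)).trans
        ((strictAnti_nat_of_succ_lt (cutRate_lt hb)).antitone (Nat.zero_le _))
    have h4 : (b : ℝ) ^ k * (cutAt b n (n - 1) / (b : ℝ) ^ (n - 1)) ≤
        (b : ℝ) ^ k * (cutRate b 0 / (b : ℝ) ^ (n - 1)) := by gcongr
    push_cast at h2
    linarith
  set V₁ := (words b (n - k)).filter fun v => v.drop (n - 1 - k) = [a₀]
  set V₂ := (words b (n - k)).filter fun v => v.drop (n - 1 - k) ≠ [a₀]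
  have hcard₁ : (V₁.card : ℝ) ≤ (b : ℝ) ^ (n - 1 - k) := by
    exact_mod_cast card_filter_drop_le (by omega) _
  have hcard₂ : (V₂.card : ℝ) ≤ (b - 1) * (b : ℝ) ^ (n - 1 - k) := by
    have h1 : V₂ ⊆ (Finset.univ.erase a₀).biUnion fun a =>
        (words b (n - k)).filter fun v => v.drop (n - 1 - k) = [a] := by
      intro v hv
      obtain ⟨hv, h⟩ := Finset.mem_filter.1 hv
      obtain ⟨a, ha⟩ := hdrop v hv
      refine Finset.mem_biUnion.2 ⟨a, Finset.mem_erase.2 ⟨?_, Finset.mem_univ _⟩,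
        Finset.mem_filter.2 ⟨hv, ha⟩⟩
      rintro rfl
      exact h ha
    have h2 := (Finset.card_le_card h1).trans (Finset.card_biUnion_le_card_mul _ _
      (b ^ (n - 1 - k)) fun a _ => card_filter_drop_le (by omega) _)
    rw [Finset.card_erase_of_mem (Finset.mem_univ _), Finset.card_univ, Fintype.card_fin] at h2
    have h3 : (V₂.card : ℝ) ≤ ((b - 1 : ℕ) : ℝ) * (b : ℝ) ^ (n - 1 - k) := by exact_mod_cast h2
    rwa [Nat.cast_sub (by omega), Nat.cast_one] at h3
  set U₁ := ⋃ v ∈ V₁, noEdge (below n v) (X \ below n v)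
  set U₂ := ⋃ v ∈ V₂, noEdge (below n v) (Xᶜ \ below n v)
  have hbelow₂ : ∀ v ∈ V₂, ∃ a, v.drop (n - 1 - k) = [a] ∧ below n [a] ⊆ Xᶜ := by
    intro v hv
    obtain ⟨hv, h⟩ := Finset.mem_filter.1 hv
    obtain ⟨a, ha⟩ := hdrop v hv
    refine ⟨a, ha, fun x hx => Finset.mem_compl.2 fun hx' => ?_⟩
    refine Finset.disjoint_left.1 (below_disjoint (u := [a]) (v := [a₀]) rfl ?_) hx hx'
    rwa [← ha]
  have hU₁ : μ.real U₁ ≤ q := by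
    refine (measureReal_biUnion_finset_le _ _).trans ((Finset.sum_le_sum fun v hv => hone v
      (Finset.mem_filter.1 hv).1 a₀ (Finset.mem_filter.1 hv).2 X subset_rfl).trans ?_)
    rw [Finset.sum_const, nsmul_eq_mul, hq]
    exact mul_le_mul_of_nonneg_right hcard₁ (Real.exp_nonneg _)
  have hU₂ : μ.real U₂ ≤ (b - 1) * q := by
    refine (measureReal_biUnion_finset_le _ _).trans ((Finset.sum_le_sum fun v hv => ?_).trans
      (b := ∑ v ∈ V₂, E) ?_)
    · obtain ⟨a, ha, haX⟩ := hbelow₂ v hv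
      exact hone v (Finset.mem_filter.1 hv).1 a ha Xᶜ haX
    · rw [Finset.sum_const, nsmul_eq_mul, hq, ← mul_assoc]
      exact mul_le_mul_of_nonneg_right hcard₂ (Real.exp_nonneg _)
  have hm₁ : MeasurableSet[MeasurableSpace.comap
      (fun (ω : ParticleOutcome b n) (x : X) => ω x) MeasurableSpace.pi] U₁ := by
    refine Finset.measurableSet_biUnion _ fun v hv => measurableSet_comap_avoids fun p hp => ?_
    have hvX := hbelow v a₀ (Finset.mem_filter.1 hv).2
    simp only [Finset.mem_union, Finset.mem_product, Finset.mem_sdiff] at hp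
    exact hp.elim (fun h => hvX h.1) fun h => h.1.1
  have hm₂ : MeasurableSet[MeasurableSpace.comap
      (fun (ω : ParticleOutcome b n) (x : (Xᶜ : Finset _)) => ω x) MeasurableSpace.pi] U₂ := by
    refine Finset.measurableSet_biUnion _ fun v hv => measurableSet_comap_avoids fun p hp => ?_
    obtain ⟨a, ha, haX⟩ := hbelow₂ v hv
    have hvX := (hbelow v a ha).trans haX
    simp only [Finset.mem_union, Finset.mem_product, Finset.mem_sdiff] at hp
    exact hp.elim (fun h => hvX h.1) fun h => h.1.1
  have hind : μ.real (U₁ᶜ ∩ U₂ᶜ) = μ.real U₁ᶜ * μ.real U₂ᶜ := by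
    have := (Indep_iff _ _ _).1 (indep_comap lam (X := X) (Y := Xᶜ) disjoint_compl_right) _ _
      hm₁.compl hm₂.compl
    rw [measureReal_def, this, ENNReal.toReal_mul]
    rfl
  have hmU₁ : MeasurableSet U₁ := Finset.measurableSet_biUnion _ fun v _ => measurableSet_noEdge _ _
  have hmU₂ : MeasurableSet U₂ := Finset.measurableSet_biUnion _ fun v _ => measurableSet_noEdge _ _
  have hsub : eventD b n k ⊆ (U₁ᶜ ∩ U₂ᶜ)ᶜ := by
    rw [eventD_eq (by omega), Set.compl_inter, compl_compl, compl_compl]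
    refine Set.iUnion₂_subset fun v hv ω hω => ?_
    have hω' : ∀ Z : Finset (Leaf b n), ω ∈ noEdge (below n v) (Z \ below n v) := fun Z => by
      rw [mem_noEdge_iff] at hω ⊢
      exact fun x hx y hy => hω x hx y (Finset.mem_compl.2 (Finset.mem_sdiff.1 hy).2)
    by_cases h : v.drop (n - 1 - k) = [a₀]
    · exact Or.inl (Set.mem_biUnion (Finset.mem_filter.2 ⟨hv, h⟩ : v ∈ V₁) (hω' X))
    · exact Or.inr (Set.mem_biUnion (Finset.mem_filter.2 ⟨hv, h⟩ : v ∈ V₂) (hω' Xᶜ))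
  refine (measureReal_mono hsub).trans ?_
  rw [probReal_compl_eq_one_sub (hmU₁.compl.inter hmU₂.compl), hind,
    probReal_compl_eq_one_sub hmU₁, probReal_compl_eq_one_sub hmU₂]
  refine sub_le_sub_left (mul_le_mul (by linarith) (by linarith) (by linarith) ?_) 1
  linarith [measureReal_le_one (μ := μ) (s := U₁)]

end Independence

/-! ### Connectedness -/

section Connected

variable {b n : ℕ}

/-- Each height contributes an amount of constant order to the edges between two sets of positive
density below a vertex, since there are of order `b^(2j)` pairs of leaves. -/
lemma le_levelWeight (hb : 2 ≤ b) {j : ℕ} (hj : j ≠ 0) (hjn : j ≤ n) :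
    ((b : ℝ) - 1) ^ 2 / b ≤ levelWeight b n j * ((b : ℝ) ^ j) ^ 2 := by
  have h0 := pow_sub_one_pos hb one_ne_zero
  have h1 := pow_sub_one_pos hb hj
  have h2 := pow_sub_one_pos hb (Nat.succ_ne_zero j)
  have hb0 : (0 : ℝ) < b := by positivity
  simp only [Nat.succ_eq_add_one, pow_one] at h0 h1 h2
  rcases hjn.lt_or_eq with h | rfl
  · rw [levelWeight_of_lt hb hj h, div_mul_eq_mul_div, div_le_div_iff₀ hb0 (by positivity), mul_assoc]
    refine mul_le_mul_of_nonneg_left ?_ (by positivity)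
    have h3 : ((b : ℝ) ^ j - 1) * ((b : ℝ) ^ (j + 1) - 1) ≤ (b : ℝ) ^ j * (b : ℝ) ^ (j + 1) :=
      mul_le_mul (by linarith) (by linarith) h2.le (by positivity)
    exact h3.trans (le_of_eq (by ring))
  · rw [levelWeight_self, div_div, div_mul_eq_mul_div, div_le_div_iff₀ hb0 (by positivity)]
    have h3 : ((b : ℝ) - 1) ^ 2 * (((b : ℝ) ^ j - 1) * (b : ℝ) ^ j) ≤
        ((b : ℝ) - 1) * b * ((b : ℝ) ^ j * (b : ℝ) ^ j) := by
      rw [sq]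
      refine mul_le_mul (mul_le_mul_of_nonneg_left (by linarith) h0.le)
        (mul_le_mul_of_nonneg_right (by linarith) (by positivity)) (by positivity) (by positivity)
    exact h3.trans (le_of_eq (by ring))

/-- Edges are gained at every ancestor with leaves of both kinds below it. -/
lemma sum_levelWeight_le_flow (hb : 2 ≤ b) {h K : ℕ} (hh : h ≠ 0) (hK : h + K ≤ n)
    {v : List (Fin b)} (hv : v.length + h = n) (A B : Finset (Leaf b n)) :
    ∑ i ∈ Finset.range (K + 1), levelWeight b n (h + i) *
      (((A ∩ below n (v.drop i)).card : ℝ) * (B ∩ below n (v.drop i)).card) ≤ flow A B := by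
  have h1 : ∀ x ∈ A, ∑ i ∈ Finset.range (K + 1), levelWeight b n (h + i) *
      (if x ∈ below n (v.drop i) then ((B ∩ below n (v.drop i)).card : ℝ) else 0) ≤
        ∑ y ∈ B, returnProb x y := by
    intro x _
    rw [sum_returnProb]
    have h2 : ∑ i ∈ Finset.range (K + 1), levelWeight b n (h + i) *
        ((B ∩ below n (x.word.drop (h + i))).card : ℝ) ≤
          ∑ j ∈ Finset.Icc 1 n, levelWeight b n j * (B ∩ below n (x.word.drop j)).card := by
      rw [← Finset.sum_image (s := Finset.range (K + 1)) (g := fun i => h + i)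
        (f := fun j => levelWeight b n j * ((B ∩ below n (x.word.drop j)).card : ℝ))
        fun i _ i' _ hii => Nat.add_left_cancel hii]
      refine Finset.sum_le_sum_of_subset_of_nonneg (fun j hj => ?_) fun j hj _ => ?_
      · obtain ⟨i, hi, rfl⟩ := Finset.mem_image.1 hj
        rw [Finset.mem_range] at hi
        rw [Finset.mem_Icc]
        omega
      · rw [Finset.mem_Icc] at hj
        exact mul_nonneg (levelWeight_nonneg hb (by omega) hj.2) (Nat.cast_nonneg _)
    refine le_trans (Finset.sum_le_sum fun i hi => ?_) h2
    rw [Finset.mem_range] at hi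
    refine mul_le_mul_of_nonneg_left ?_ (levelWeight_nonneg hb (by omega) (by omega))
    split_ifs with hx
    · rw [← (mem_below_iff (k := h + i) (by rw [List.length_drop]; omega)).1 hx]
    · exact Nat.cast_nonneg _
  refine le_trans (le_of_eq ?_) (Finset.sum_le_sum h1)
  rw [Finset.sum_comm]
  refine Finset.sum_congr rfl fun i _ => ?_
  rw [← Finset.mul_sum, ← Finset.sum_filter, Finset.sum_const, nsmul_eq_mul,
    Finset.filter_mem_eq_inter]

lemma card_inter_add_card_sdiff_below {h : ℕ} {v : List (Fin b)} (hv : v.length + h = n)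
    (D : Finset (Leaf b n)) :
    ((D ∩ below n v).card : ℝ) + (below n v \ D).card = (b : ℝ) ^ h := by
  have := Finset.card_sdiff_add_card_inter (below n v) D
  rw [card_below hv, Finset.inter_comm] at this
  rw [add_comm]
  exact_mod_cast this

/-- By isoperimetry the boundary of `A` is at least `cutAt b n h`. The part leaving the leaves below
`v` is this rate times the density of `A`; the remainder must go to `B`. -/
lemma density_mul_cutAt_le_flow (hb : 2 ≤ b) {h : ℕ} (hh : h < n) {v : List (Fin b)}
    (hv : v.length + h = n) {A B : Finset (Leaf b n)} (hAB : Disjoint A B)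
    (hU : A ∪ B = below n v) (hA : A.Nonempty) :
    (B.card : ℝ) / (b : ℝ) ^ h * cutAt b n h ≤ flow A B := by
  have hAv : A ⊆ below n v := hU ▸ Finset.subset_union_left
  have h1 := cutAt_le_cut hb hh hv hAv hA
  have h2 : Aᶜ = B ∪ (below n v)ᶜ := by
    ext x
    have h3 : x ∈ A → x ∉ B := fun h => Finset.disjoint_left.1 hAB h
    simp only [← hU, Finset.mem_compl, Finset.mem_union]
    tauto
  rw [h2, flow_union_right _ (disjoint_compl_right.mono_left (hU ▸ Finset.subset_union_right)),
    flow_compl_below hv hAv] at h1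
  have h3 := card_below hv
  rw [← hU, Finset.card_union_of_disjoint hAB] at h3
  have h4 : (A.card : ℝ) + B.card = (b : ℝ) ^ h := by exact_mod_cast h3
  have h5 : (0 : ℝ) < (b : ℝ) ^ h := by positivity
  have h6 : (B.card : ℝ) / (b : ℝ) ^ h * cutAt b n h =
      cutAt b n h - A.card * (cutAt b n h / (b : ℝ) ^ h) := by
    rw [eq_sub_of_add_eq' h4]
    field_simp
  rw [h6]
  linarith

/-- A set that splits the leaves below a vertex has an edge boundary of nearly the critical size
already within the leaves below a distant ancestor of this vertex. -/
lemma cutRateInf_mul_le_flow (hb : 2 ≤ b) {h K : ℕ} (hh : h ≠ 0) (hK0 : K ≠ 0) (hK : h + 2 * K ≤ n)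
    {v : List (Fin b)} (hv : v.length + h = n) {D : Finset (Leaf b n)}
    (hD : (D ∩ below n v).Nonempty) (hD' : (below n v \ D).Nonempty) :
    cutRateInf b * (1 - 3 / (K + 1)) ≤
      flow (D ∩ below n (v.drop K)) (below n (v.drop K) \ D) := by
  have h0 := pow_sub_one_pos hb one_ne_zero
  rw [pow_one] at h0
  have hb2 : (2 : ℝ) ≤ b := by exact_mod_cast hb
  have hinf : 0 < cutRateInf b := by unfold cutRateInf; positivity
  have hlen : ∀ i ≤ K, (v.drop i).length + (h + i) = n := fun i hi => by
    rw [List.length_drop]; omega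
  set F := flow (D ∩ below n (v.drop K)) (below n (v.drop K) \ D)
  have hmono : ∀ i ≤ K, below n (v.drop i) ⊆ below n (v.drop K) := fun i hi => below_mono (by
    rw [show K = i + (K - i) by omega, ← List.drop_drop]; exact List.drop_suffix _ _)
  have hmono' : ∀ i, below n v ⊆ below n (v.drop i) := fun i => below_mono (List.drop_suffix _ _)
  -- The density of `D` among the leaves below the `i`-th ancestor of `v`.
  set ρ : ℕ → ℝ := fun i => (D ∩ below n (v.drop i)).card / (b : ℝ) ^ (h + i)
  have hpos : ∀ i, (0 : ℝ) < (b : ℝ) ^ (h + i) := fun i => by positivity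
  have hρ' : ∀ i ≤ K, 1 - ρ i = (below n (v.drop i) \ D).card / (b : ℝ) ^ (h + i) := by
    intro i hi
    rw [eq_div_iff (hpos i).ne', sub_mul, one_mul, div_mul_cancel₀ _ (hpos i).ne',
      ← card_inter_add_card_sdiff_below (hlen i hi) D]
    ring
  have hρ0 : ∀ i, 0 ≤ ρ i := fun i => by positivity
  have hρ1 : ∀ i ≤ K, 0 ≤ 1 - ρ i := fun i hi => by rw [hρ' i hi]; positivity
  have hlow : ∀ i ≤ K, (1 - ρ i) * cutAt b n (h + i) ≤ F ∧ ρ i * cutAt b n (h + i) ≤ F := by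
    intro i hi
    have hU : D ∩ below n (v.drop i) ∪ below n (v.drop i) \ D = below n (v.drop i) := by
      ext x; simp only [Finset.mem_union, Finset.mem_inter, Finset.mem_sdiff]; tauto
    have hdis : Disjoint (D ∩ below n (v.drop i)) (below n (v.drop i) \ D) :=
      Finset.disjoint_sdiff.mono_left Finset.inter_subset_left
    have hle : flow (D ∩ below n (v.drop i)) (below n (v.drop i) \ D) ≤ F :=
      flow_mono hb (Finset.inter_subset_inter_left (hmono i hi))
        (Finset.sdiff_subset_sdiff (hmono i hi) subset_rfl)
    constructor
    · rw [hρ' i hi]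
      exact (density_mul_cutAt_le_flow hb (by omega) (hlen i hi) hdis hU
        (hD.mono (Finset.inter_subset_inter_left (hmono' i)))).trans hle
    · refine (density_mul_cutAt_le_flow hb (by omega) (hlen i hi) hdis.symm
        (by rw [Finset.union_comm]; exact hU)
        (hD'.mono (Finset.sdiff_subset_sdiff (hmono' i) subset_rfl))).trans ?_
      rwa [flow_comm]
  have hK1 : (0 : ℝ) < K + 1 := by positivity
  -- Either some ancestor has density close to `0` or `1`, and isoperimetry at that height gives
  -- almost the whole of `cutAt`; or each of the `K + 1` heights contributes at least a `1/(K+1)`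
  -- share of `(b-1)^2/b`.
  by_cases hex : ∃ i ≤ K, ρ i * (1 - ρ i) ≤ 1 / (K + 1)
  · obtain ⟨i, hi, hρi⟩ := hex
    -- The ancestor is at least `K` levels below the apex, and `b^(2K) ≥ K + 1`.
    have hcut : cutRateInf b * (1 - 1 / (K + 1)) ≤ cutAt b n (h + i) := by
      refine le_trans (mul_le_mul_of_nonneg_left (sub_le_sub_left ?_ 1) hinf.le)
        (cutRateInf_mul_le_cutAt hb (by omega))
      rw [one_div]
      refine inv_anti₀ hK1 ?_
      have h1 : K + 1 ≤ b ^ (2 * (n - (h + i))) :=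
        (Nat.lt_pow_self (by omega : 1 < b)).trans_le (Nat.pow_le_pow_right (by omega) (by omega))
      exact_mod_cast h1
    have hc0 := (cutAt_pos hb (by omega : h + i < n)).le
    have hmain : (1 - 2 / (K + 1)) * cutAt b n (h + i) ≤ F := by
      rcases le_total (ρ i) (1 / 2) with hle | hle
      · refine le_trans (mul_le_mul_of_nonneg_right ?_ hc0) (hlow i hi).1
        -- The smaller of `ρ` and `1 - ρ` is at most `2ρ(1 - ρ)`.
        have h1 : ρ i ≤ 2 * (ρ i * (1 - ρ i)) := by nlinarith [hρ0 i]
        have h2 : 2 / ((K : ℝ) + 1) = 2 * (1 / (K + 1)) := by ring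
        linarith
      · refine le_trans (mul_le_mul_of_nonneg_right ?_ hc0) (hlow i hi).2
        have h1 : 1 - ρ i ≤ 2 * (ρ i * (1 - ρ i)) := by nlinarith [hρ1 i hi]
        have h2 : 2 / ((K : ℝ) + 1) = 2 * (1 / (K + 1)) := by ring
        linarith
    refine le_trans ?_ hmain
    have hx : 1 / ((K : ℝ) + 1) ≤ 1 / 2 := by
      refine one_div_le_one_div_of_le (by norm_num) ?_
      have : (1 : ℝ) ≤ K := by exact_mod_cast Nat.one_le_iff_ne_zero.2 hK0
      linarith
    have hx0 : 0 ≤ 1 / ((K : ℝ) + 1) := by positivity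
    rw [show 3 / ((K : ℝ) + 1) = 3 * (1 / (K + 1)) by ring,
      show 2 / ((K : ℝ) + 1) = 2 * (1 / (K + 1)) by ring]
    -- With `x = 1/(K+1)` the two losses combine as `(1 - 2x)(1 - x) ≥ 1 - 3x`.
    refine le_trans ?_ (mul_le_mul_of_nonneg_left hcut (by linarith))
    nlinarith [mul_nonneg hinf.le (mul_nonneg hx0 hx0)]
  · push Not at hex
    have h1 := sum_levelWeight_le_flow hb hh (by omega : h + K ≤ n) hv
      (D ∩ below n (v.drop K)) (below n (v.drop K) \ D)
    have h2 : ∀ i ∈ Finset.range (K + 1), ((b : ℝ) - 1) ^ 2 / b * (1 / (K + 1)) ≤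
        levelWeight b n (h + i) *
      (((D ∩ below n (v.drop K) ∩ below n (v.drop i)).card : ℝ) *
        ((below n (v.drop K) \ D) ∩ below n (v.drop i)).card) := by
      intro i hi
      rw [Finset.mem_range] at hi
      have hi : i ≤ K := by omega
      rw [Finset.inter_assoc, Finset.inter_eq_right.2 (hmono i hi),
        show (below n (v.drop K) \ D) ∩ below n (v.drop i) = below n (v.drop i) \ D by
          ext x
          have := @hmono i hi x
          simp only [Finset.mem_inter, Finset.mem_sdiff]
          tauto]
      have h3 : ((D ∩ below n (v.drop i)).card : ℝ) * (below n (v.drop i) \ D).card =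
          ((b : ℝ) ^ (h + i)) ^ 2 * (ρ i * (1 - ρ i)) := by
        rw [hρ' i hi]
        have := (hpos i).ne'
        simp only [ρ]
        field_simp
      rw [h3, ← mul_assoc]
      exact mul_le_mul (le_levelWeight hb (by omega) (by omega)) (hex i hi).le (by positivity)
        (mul_nonneg (levelWeight_nonneg hb (by omega) (by omega)) (by positivity))
    have h4 := (Finset.sum_le_sum h2).trans h1
    rw [Finset.sum_const, Finset.card_range, nsmul_eq_mul] at h4
    push_cast at h4
    have h5 : ((K : ℝ) + 1) * (((b : ℝ) - 1) ^ 2 / b * (1 / (K + 1))) = ((b : ℝ) - 1) ^ 2 / b := by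
      field_simp
    rw [h5] at h4
    refine le_trans ?_ h4
    have h6 : cutRateInf b ≤ ((b : ℝ) - 1) ^ 2 / b := by
      rw [cutRateInf, div_le_div_iff₀ (by linarith) (by linarith)]
      nlinarith
    have h7 : 0 ≤ 3 / ((K : ℝ) + 1) := by positivity
    nlinarith

end Connected

/-! ### Disconnection: the lowest split vertex and a union bound -/

section UnionBound

variable {b n : ℕ}

/-- A set of leaves below `u` that is a union of sets of leaves below vertices of height `j`. -/
noncomputable def saturated (n : ℕ) (u : List (Fin b)) (j K : ℕ) (S : Finset (List (Fin b))) :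
    Finset (Leaf b n) :=
  (below n u).filter fun x => (x.word.drop j).take (K + 1) ∈ S

lemma saturated_subset (u : List (Fin b)) (j K : ℕ) (S : Finset (List (Fin b))) :
    saturated n u j K S ⊆ below n u := Finset.filter_subset _ _

/-- The leaves below `v` are in one component. -/
def Good (ω : ParticleOutcome b n) (v : List (Fin b)) : Prop :=
  ∀ x ∈ below n v, below n v ⊆ componentOf ω x

lemma good_leaf (ω : ParticleOutcome b n) {v : List (Fin b)} (hv : v.length + 0 = n) :
    Good ω v := by
  intro x hx y hy
  rw [below_leaf v hv, Finset.mem_singleton] at hx hy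
  rw [hx, hy]
  exact mem_componentOf_self ω _

/-- Leaves are trivially good and, if the multigraph is disconnected, the apex is not; take the
lowest height with a vertex that is not good. -/
lemma exists_minimal_not_good (hb : b ≠ 0) {ω : ParticleOutcome b n}
    (hω : ω ∉ eventConnected b n) :
    ∃ j < n, (∃ v : List (Fin b), v.length + (j + 1) = n ∧ ¬ Good ω v) ∧
      ∀ v : List (Fin b), v.length + j = n → Good ω v := by
  have hroot : ¬ Good ω ([] : List (Fin b)) := by
    intro h
    refine hω ⟨?_, fun x _ y _ => ?_⟩
    · obtain ⟨x, -⟩ := below_nonempty (n := n) (v := []) (k := n) hb (by simp)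
      exact ⟨x, Set.mem_univ _⟩
    · have hmem : ∀ z : Leaf b n, z ∈ below n ([] : List (Fin b)) := fun z =>
        mem_below.2 List.nil_suffix
      exact mem_componentOf.1 (h x (hmem x) (hmem y))
  classical
  have hex : ∃ h, ∃ v : List (Fin b), v.length + h = n ∧ ¬ Good ω v := ⟨n, [], by simp, hroot⟩
  obtain ⟨v, hv, hgood⟩ := Nat.find_spec hex
  obtain ⟨j, hj⟩ : ∃ j, Nat.find hex = j + 1 := by
    refine Nat.exists_eq_succ_of_ne_zero fun h0 => ?_
    rw [h0] at hv
    exact hgood (good_leaf ω hv)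
  rw [hj] at hv
  refine ⟨j, by omega, ⟨v, hv, hgood⟩, fun v' hv' => ?_⟩
  by_contra hng
  exact Nat.find_min hex (by omega : j < Nat.find hex) ⟨v', hv', hng⟩

/-- The event that some vertex of height `j + 1` is split by a set of leaves, saturated at height
`j`, that no edge leaves below the `K`-th ancestor of this vertex. -/
def splitEvent (b n j K : ℕ) : Set (ParticleOutcome b n) :=
  {ω | ∃ v ∈ words b (n - (j + 1)), ∃ S ∈ (words b (K + 1)).powerset,
    (saturated n (v.drop K) j K S ∩ below n v).Nonempty ∧
    (below n v \ saturated n (v.drop K) j K S).Nonempty ∧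
    ω ∈ noEdge (saturated n (v.drop K) j K S)
      (below n (v.drop K) \ saturated n (v.drop K) j K S)}

/-- As every vertex of height `j` is good, a component meeting the leaves below such a vertex
contains all of them. Below the `K`-th ancestor a component is therefore described by a set of words
of length `K + 1`, so the number of shapes does not depend on `n`. -/
lemma mem_splitEvent {ω : ParticleOutcome b n} {j : ℕ} (hj : j < n)
    {v : List (Fin b)} (hv : v.length + (j + 1) = n) (hng : ¬ Good ω v)
    (hgood : ∀ v : List (Fin b), v.length + j = n → Good ω v) {K : ℕ} (hK : j + 1 + K ≤ n) :
    ω ∈ splitEvent b n j K := by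
  unfold Good at hng
  push Not at hng
  obtain ⟨x₀, hx₀, hnsub⟩ := hng
  obtain ⟨z, hz, hzC⟩ := Finset.not_subset.1 hnsub
  set C := componentOf ω x₀
  set u := v.drop K
  have hu : u.length + (j + 1 + K) = n := by rw [List.length_drop]; omega
  classical
  set S : Finset (List (Fin b)) :=
    (C ∩ below n u).image fun x => (x.word.drop j).take (K + 1)
  have hkey : ∀ x ∈ below n u, x.word.drop j = (x.word.drop j).take (K + 1) ++ u := by
    intro x hx
    conv_lhs => rw [← List.take_append_drop (K + 1) (x.word.drop j)]
    rw [List.drop_drop, show j + (K + 1) = j + 1 + K by omega, (mem_below_iff hu).1 hx]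
  have hsat : saturated n u j K S = C ∩ below n u := by
    ext y
    simp only [saturated, Finset.mem_filter, S, Finset.mem_image]
    constructor
    · rintro ⟨hy, x, hx, hxy⟩
      obtain ⟨hxC, hxu⟩ := Finset.mem_inter.1 hx
      have hd : x.word.drop j = y.word.drop j := by rw [hkey x hxu, hkey y hy, hxy]
      refine Finset.mem_inter.2 ⟨?_, hy⟩
      have hg := hgood (x.word.drop j) (by rw [List.length_drop, x.length_eq]; omega) x
        (mem_below_drop x j) ((mem_below_drop_iff hj.le).2 hd)
      exact mem_componentOf.2 ((mem_componentOf.1 hxC).trans (mem_componentOf.1 hg))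
    · intro hy
      exact ⟨(Finset.mem_inter.1 hy).2, y, hy, rfl⟩
  have hvu : below n v ⊆ below n u := below_mono (List.drop_suffix _ _)
  refine ⟨v, mem_words.2 (by omega), S, Finset.mem_powerset.2 fun s hs => ?_, ?_⟩
  · obtain ⟨x, hx, rfl⟩ := Finset.mem_image.1 hs
    rw [mem_words, List.length_take, List.length_drop, x.length_eq]
    omega
  · change (saturated n u j K S ∩ below n v).Nonempty ∧ (below n v \ saturated n u j K S).Nonempty ∧
      ω ∈ noEdge (saturated n u j K S) (below n u \ saturated n u j K S)
    rw [hsat]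
    refine ⟨⟨x₀, ?_⟩, ⟨z, ?_⟩, ?_⟩
    · exact Finset.mem_inter.2 ⟨Finset.mem_inter.2 ⟨mem_componentOf_self ω x₀, hvu hx₀⟩, hx₀⟩
    · exact Finset.mem_sdiff.2 ⟨hz, fun h => hzC (Finset.mem_inter.1 h).1⟩
    · have h := mem_noEdge_iff.1 (mem_noEdge_componentOf ω x₀)
      rw [mem_noEdge_iff]
      intro x hx y hy
      obtain ⟨hyu, hyn⟩ := Finset.mem_sdiff.1 hy
      exact h x (Finset.mem_inter.1 hx).1 y
        (Finset.mem_compl.2 fun hyC => hyn (Finset.mem_inter.2 ⟨hyC, hyu⟩))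

lemma particleLaw_splitEvent_le (hb : 2 ≤ b) (hn : n ≠ 0) (lam : ℝ≥0) {j K : ℕ} {R : ℝ}
    (hR : ∀ v ∈ words b (n - (j + 1)), ∀ S : Finset (List (Fin b)),
      (saturated n (v.drop K) j K S ∩ below n v).Nonempty →
      (below n v \ saturated n (v.drop K) j K S).Nonempty →
      R ≤ flow (saturated n (v.drop K) j K S)
        (below n (v.drop K) \ saturated n (v.drop K) j K S)) :
    (particleLaw b n lam).real (splitEvent b n j K) ≤
      (b : ℝ) ^ (n - (j + 1)) * (2 ^ b ^ (K + 1) * Real.exp (-(lam * R))) := by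
  classical
  set 𝒮 : List (Fin b) → Finset (Finset (List (Fin b))) := fun v =>
    (words b (K + 1)).powerset.filter fun S =>
      (saturated n (v.drop K) j K S ∩ below n v).Nonempty ∧
      (below n v \ saturated n (v.drop K) j K S).Nonempty
  have hsub : splitEvent b n j K ⊆ ⋃ v ∈ words b (n - (j + 1)), ⋃ S ∈ 𝒮 v,
      noEdge (saturated n (v.drop K) j K S)
        (below n (v.drop K) \ saturated n (v.drop K) j K S) := by
    rintro ω ⟨v, hv, S, hS, h1, h2, h3⟩
    simp only [Set.mem_iUnion]
    exact ⟨v, hv, S, Finset.mem_filter.2 ⟨hS, h1, h2⟩, h3⟩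
  refine (measureReal_mono hsub (measure_ne_top _ _)).trans ((measureReal_biUnion_finset_le _ _).trans ?_)
  have hv : ∀ v ∈ words b (n - (j + 1)), (particleLaw b n lam).real (⋃ S ∈ 𝒮 v,
      noEdge (saturated n (v.drop K) j K S)
        (below n (v.drop K) \ saturated n (v.drop K) j K S)) ≤
      2 ^ b ^ (K + 1) * Real.exp (-(lam * R)) := by
    intro v hv
    refine (measureReal_biUnion_finset_le _ _).trans ?_
    have hS : ∀ S ∈ 𝒮 v, (particleLaw b n lam).real (noEdge (saturated n (v.drop K) j K S)
        (below n (v.drop K) \ saturated n (v.drop K) j K S)) ≤ Real.exp (-(lam * R)) := by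
      intro S hS
      obtain ⟨-, h1, h2⟩ := Finset.mem_filter.1 hS
      rw [particleLaw_noEdge hb hn lam Finset.disjoint_sdiff]
      exact Real.exp_le_exp.2 (neg_le_neg (mul_le_mul_of_nonneg_left (hR v hv S h1 h2) lam.2))
    refine (Finset.sum_le_sum hS).trans ?_
    rw [Finset.sum_const, nsmul_eq_mul]
    refine mul_le_mul_of_nonneg_right ?_ (Real.exp_nonneg _)
    have := Finset.card_filter_le (words b (K + 1)).powerset fun S =>
      (saturated n (v.drop K) j K S ∩ below n v).Nonempty ∧
      (below n v \ saturated n (v.drop K) j K S).Nonempty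
    rw [Finset.card_powerset, card_words] at this
    exact_mod_cast this
  refine (Finset.sum_le_sum hv).trans (le_of_eq ?_)
  rw [Finset.sum_const, card_words, nsmul_eq_mul]
  push_cast
  rfl

lemma splitEvent_far_le (hb : 2 ≤ b) (lam : ℝ≥0) {j K : ℕ} (hK0 : K ≠ 0) (hK : j + 1 + 2 * K ≤ n) :
    (particleLaw b n lam).real (splitEvent b n j K) ≤ (b : ℝ) ^ n *
      (2 ^ b ^ (K + 1) * Real.exp (-(lam * (cutRateInf b * (1 - 3 / (K + 1)))))) := by
  have hb1 : (1 : ℝ) ≤ b := by exact_mod_cast (by omega : 1 ≤ b)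
  refine (particleLaw_splitEvent_le hb (by omega) lam fun v hv S h1 h2 => ?_).trans
    (mul_le_mul_of_nonneg_right (pow_le_pow_right₀ hb1 (Nat.sub_le _ _)) (by positivity))
  have h := cutRateInf_mul_le_flow hb (Nat.succ_ne_zero j) hK0 hK
    (by rw [mem_words.1 hv]; omega : v.length + (j + 1) = n) h1 h2
  rwa [Finset.inter_eq_left.2 (saturated_subset _ _ _ _)] at h

/-- Near the apex there is no room for a distant ancestor, but there are at most `b^(2K)` vertices,
so any positive rate will do. Both sides of the split contain all leaves below some vertex of height
`j`, and the pairs between them already have rate at least `(b-1)^2/b^3`. -/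
lemma splitEvent_near_le (hb : 2 ≤ b) (lam : ℝ≥0) {j K : ℕ} (hj : j < n) (hK : n < j + 1 + 2 * K) :
    (particleLaw b n lam).real (splitEvent b n j 0) ≤ (b : ℝ) ^ (2 * K) *
      (2 ^ b * Real.exp (-(lam * (((b : ℝ) - 1) ^ 2 / b ^ 3)))) := by
  have hb1 : (1 : ℝ) ≤ b := by exact_mod_cast (by omega : 1 ≤ b)
  have hb0 : (0 : ℝ) < b := by linarith
  have hmain := particleLaw_splitEvent_le (n := n) hb (by omega) lam (j := j) (K := 0)
    (R := ((b : ℝ) - 1) ^ 2 / b ^ 3) fun v hv S h1 h2 => ?_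
  · refine hmain.trans ?_
    rw [zero_add, pow_one]
    exact mul_le_mul_of_nonneg_right (pow_le_pow_right₀ hb1 (by omega)) (by positivity)
  · rw [List.drop_zero] at h1 h2 ⊢
    have hv : v.length + (j + 1) = n := by rw [mem_words.1 hv]; omega
    set D := saturated n v j 0 S
    have hDv : D ⊆ below n v := saturated_subset _ _ _ _
    have hsat : ∀ x ∈ below n v, ∀ y, x.word.drop j = y.word.drop j → y ∈ below n v := by
      intro x hx y hxy
      rw [mem_below_iff hv] at hx ⊢
      rw [← List.drop_drop, ← hxy, List.drop_drop, hx]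
    have hcard : ∀ (x : Leaf b n) (A : Finset (Leaf b n)),
        (∀ y, x.word.drop j = y.word.drop j → y ∈ A) → (b : ℝ) ^ j ≤ A.card := by
      intro x A hA
      have h3 : below n (x.word.drop j) ⊆ A := fun y hy =>
        hA y ((mem_below_drop_iff hj.le).1 hy)
      have h4 := Finset.card_le_card h3
      rw [card_below (k := j) (by rw [List.length_drop, x.length_eq]; omega)] at h4
      exact_mod_cast h4
    obtain ⟨x, hx⟩ := h1
    obtain ⟨z, hz⟩ := h2
    have hc1 : (b : ℝ) ^ j ≤ D.card := by
      obtain ⟨hx1, hx2⟩ := Finset.mem_filter.1 (Finset.mem_inter.1 hx).1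
      refine hcard x D fun y hxy => Finset.mem_filter.2 ⟨hsat x hx1 y hxy, ?_⟩
      rwa [← hxy]
    have hc2 : (b : ℝ) ^ j ≤ (below n v \ D).card := by
      obtain ⟨hz1, hz2⟩ := Finset.mem_sdiff.1 hz
      refine hcard z _ fun y hzy => Finset.mem_sdiff.2 ⟨hsat z hz1 y hzy, fun hyD => hz2 ?_⟩
      refine Finset.mem_filter.2 ⟨hz1, ?_⟩
      rw [hzy]
      exact (Finset.mem_filter.1 hyD).2
    have h3 := sum_levelWeight_le_flow hb (Nat.succ_ne_zero j) (by omega : j + 1 + 0 ≤ n) hv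
      D (below n v \ D)
    rw [zero_add, Finset.sum_range_one, add_zero, List.drop_zero, Finset.inter_eq_left.2 hDv,
      Finset.inter_eq_left.2 Finset.sdiff_subset] at h3
    refine le_trans ?_ h3
    have h4 := le_levelWeight (n := n) hb (Nat.succ_ne_zero j) (by omega)
    have h5 := levelWeight_nonneg (n := n) hb (Nat.succ_ne_zero j) (by omega)
    refine le_trans ?_ (mul_le_mul_of_nonneg_left
      (mul_le_mul hc1 hc2 (by positivity) (by positivity)) h5)
    have h6 : levelWeight b n (j + 1) * ((b : ℝ) ^ j * (b : ℝ) ^ j) =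
        levelWeight b n (j + 1) * ((b : ℝ) ^ (j + 1)) ^ 2 / (b : ℝ) ^ 2 := by
      rw [eq_div_iff (by positivity)]
      ring
    simp only [Nat.succ_eq_add_one] at h4
    rw [h6]
    refine le_trans (le_of_eq ?_) (div_le_div_of_nonneg_right h4 (by positivity))
    field_simp

/-- A union bound for the probability that the multigraph is not connected. -/
lemma particleLaw_eventConnected_compl_le (hb : 2 ≤ b) (lam : ℝ≥0) {K : ℕ} (hK0 : K ≠ 0) :
    (particleLaw b n lam).real (eventConnected b n)ᶜ ≤
      n * ((b : ℝ) ^ n *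
        (2 ^ b ^ (K + 1) * Real.exp (-(lam * (cutRateInf b * (1 - 3 / (K + 1))))))) +
      n * ((b : ℝ) ^ (2 * K) * (2 ^ b * Real.exp (-(lam * (((b : ℝ) - 1) ^ 2 / b ^ 3))))) := by
  -- The boundary is measured below the `K`-th ancestor when there are `2K` levels above, and below
  -- the split vertex itself otherwise.
  set f : ℕ → ℕ := fun j => if j + 1 + 2 * K ≤ n then K else 0
  have hsub : (eventConnected b n)ᶜ ⊆ ⋃ j ∈ Finset.range n, splitEvent b n j (f j) := by
    intro ω hω
    obtain ⟨j, hj, ⟨v, hv, hng⟩, hgood⟩ := exists_minimal_not_good (by omega) hω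
    refine Set.mem_biUnion (Finset.mem_range.2 hj) (mem_splitEvent hj hv hng hgood ?_)
    simp only [f]
    split_ifs <;> omega
  refine (measureReal_mono hsub (measure_ne_top _ _)).trans ((measureReal_biUnion_finset_le _ _).trans ?_)
  have hj : ∀ j ∈ Finset.range n, (particleLaw b n lam).real (splitEvent b n j (f j)) ≤
      (b : ℝ) ^ n * (2 ^ b ^ (K + 1) * Real.exp (-(lam * (cutRateInf b * (1 - 3 / (K + 1)))))) +
        (b : ℝ) ^ (2 * K) * (2 ^ b * Real.exp (-(lam * (((b : ℝ) - 1) ^ 2 / b ^ 3)))) := by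
    intro j hj
    by_cases h : j + 1 + 2 * K ≤ n
    · rw [show f j = K from if_pos h]
      exact le_add_of_le_of_nonneg (splitEvent_far_le hb lam hK0 h) (by positivity)
    · rw [show f j = 0 from if_neg h]
      exact le_add_of_nonneg_of_le (by positivity)
        (splitEvent_near_le hb lam (Finset.mem_range.1 hj) (by omega))
  refine (Finset.sum_le_sum hj).trans (le_of_eq ?_)
  rw [Finset.sum_const, Finset.card_range, nsmul_eq_mul]
  ring

end UnionBound

/-! ### Asymptotics -/

section Asymptotics

variable {b : ℕ}

lemma log_base_pos (hb : 2 ≤ b) : 0 < Real.log b := Real.log_pos (by exact_mod_cast hb)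

lemma pow_eq_exp (hb : 2 ≤ b) (n : ℕ) : (b : ℝ) ^ n = Real.exp (n * Real.log b) := by
  have hb0 : (0 : ℝ) < b := by positivity
  rw [Real.exp_nat_mul, Real.exp_log hb0]

lemma cutRateInf_pos (hb : 2 ≤ b) : 0 < cutRateInf b := by
  have h0 := pow_sub_one_pos hb one_ne_zero
  rw [pow_one] at h0
  unfold cutRateInf
  positivity

/-- The threshold constants. -/
noncomputable def sigma (b k : ℕ) : ℝ≥0 := (Real.log b / cutRate b k).toNNReal

lemma coe_sigma (hb : 2 ≤ b) (k : ℕ) : (sigma b k : ℝ) = Real.log b / cutRate b k :=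
  Real.coe_toNNReal _ (div_nonneg (log_base_pos hb).le (cutRate_pos hb k).le)

lemma sigma_mul_cutRate (hb : 2 ≤ b) (k : ℕ) : (sigma b k : ℝ) * cutRate b k = Real.log b := by
  rw [coe_sigma hb, div_mul_cancel₀ _ (cutRate_pos hb k).ne']

lemma sigma_pos (hb : 2 ≤ b) (k : ℕ) : 0 < sigma b k :=
  Real.toNNReal_pos.2 (div_pos (log_base_pos hb) (cutRate_pos hb k))

lemma strictMono_sigma (hb : 2 ≤ b) : StrictMono (sigma b) := by
  refine strictMono_nat_of_lt_succ fun k => NNReal.coe_lt_coe.1 ?_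
  rw [coe_sigma hb, coe_sigma hb]
  exact div_lt_div_of_pos_left (log_base_pos hb) (cutRate_pos hb _) (cutRate_lt hb k)

lemma sigmaCrit_eq (b : ℕ) : sigmaCrit b = Real.log b / cutRateInf b := by
  rw [sigmaCrit, cutRateInf, div_div_eq_mul_div, div_mul_eq_mul_div, mul_comm]

lemma sigmaCrit_mul_cutRateInf (hb : 2 ≤ b) : sigmaCrit b * cutRateInf b = Real.log b := by
  rw [sigmaCrit_eq, div_mul_cancel₀ _ (cutRateInf_pos hb).ne']

lemma sigmaCrit_pos (hb : 2 ≤ b) : 0 < sigmaCrit b := by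
  rw [sigmaCrit_eq]
  exact div_pos (log_base_pos hb) (cutRateInf_pos hb)

lemma tendsto_sigma (hb : 2 ≤ b) :
    Tendsto (fun k => (sigma b k : ℝ)) atTop (𝓝 (sigmaCrit b)) := by
  rw [sigmaCrit_eq]
  simp_rw [coe_sigma hb]
  exact tendsto_const_nhds.div (tendsto_cutRate hb) (cutRateInf_pos hb).ne'

lemma sigma_lt_sigmaCrit (hb : 2 ≤ b) (k : ℕ) : (sigma b k : ℝ) < sigmaCrit b := by
  have h1 : (sigma b k : ℝ) < sigma b (k + 1) := by
    exact_mod_cast strictMono_sigma hb (Nat.lt_succ_self k)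
  refine h1.trans_le (Monotone.ge_of_tendsto (fun i j hij => ?_) (tendsto_sigma hb) (k + 1))
  exact_mod_cast (strictMono_sigma hb).monotone hij

lemma tendsto_natCast_mul_exp {c : ℝ} (hc : 0 < c) :
    Tendsto (fun n : ℕ => (n : ℝ) * Real.exp (-(c * n))) atTop (𝓝 0) := by
  have := tendsto_self_mul_const_pow_of_lt_one (Real.exp_nonneg (-c))
    (Real.exp_lt_one_iff.2 (by linarith))
  refine this.congr fun n => ?_
  rw [← Real.exp_nat_mul]
  congr 2
  ring

lemma tendsto_natCast_mul_pow_mul_exp (hb : 2 ≤ b) {ε : ℝ} (hε : 0 < ε) {μ : ℕ → ℝ}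
    (hμ : ∀ᶠ n : ℕ in atTop, (1 + ε) * (n * Real.log b) ≤ μ n) :
    Tendsto (fun n : ℕ => (n : ℝ) * ((b : ℝ) ^ n * Real.exp (-μ n))) atTop (𝓝 0) := by
  refine tendsto_of_tendsto_of_tendsto_of_le_of_le' tendsto_const_nhds
    (tendsto_natCast_mul_exp (mul_pos hε (log_base_pos hb)))
    (Eventually.of_forall fun n => by positivity) ?_
  filter_upwards [hμ] with n hn
  refine mul_le_mul_of_nonneg_left ?_ (Nat.cast_nonneg n)
  rw [pow_eq_exp hb, ← Real.exp_add, Real.exp_le_exp]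
  linarith

lemma tendsto_pow_mul_exp (hb : 2 ≤ b) {ε : ℝ} (hε : 0 < ε) {μ : ℕ → ℝ}
    (hμ : ∀ᶠ n : ℕ in atTop, (1 + ε) * (n * Real.log b) ≤ μ n) :
    Tendsto (fun n : ℕ => (b : ℝ) ^ n * Real.exp (-μ n)) atTop (𝓝 0) := by
  refine tendsto_of_tendsto_of_tendsto_of_le_of_le' tendsto_const_nhds
    (tendsto_natCast_mul_pow_mul_exp hb hε hμ)
    (Eventually.of_forall fun n => by positivity) ?_
  filter_upwards [eventually_ge_atTop 1] with n hn
  exact le_mul_of_one_le_left (by positivity) (by exact_mod_cast hn)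

lemma tendsto_natCast_mul_inv_pow (hb : 2 ≤ b) (k : ℕ) :
    Tendsto (fun n : ℕ => (n : ℝ) * ((b : ℝ) ^ (n - k))⁻¹) atTop (𝓝 0) := by
  have hb0 : (0 : ℝ) < b := by positivity
  have h := (tendsto_natCast_mul_exp (log_base_pos hb)).const_mul ((b : ℝ) ^ k)
  rw [mul_zero] at h
  refine h.congr' ?_
  filter_upwards [eventually_ge_atTop k] with n hn
  rw [Real.exp_neg, mul_comm (Real.log b), ← pow_eq_exp hb, mul_left_comm]
  congr 1
  rw [← div_eq_mul_inv, div_eq_iff (by positivity), ← Nat.sub_add_cancel hn, pow_add,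
    Nat.add_sub_cancel]
  field_simp

/-- The extra factor `n` is needed exactly at the threshold: there `λ` is of order `n`, and the
exponent `λ * cutAt` must be known up to `o(1)`. -/
lemma tendsto_natCast_mul_cutRate_sub (hb : 2 ≤ b) (k : ℕ) :
    Tendsto (fun n : ℕ => (n : ℝ) * (cutRate b k - cutAt b n k)) atTop (𝓝 0) := by
  have h := (tendsto_natCast_mul_inv_pow hb k).const_mul (2 * cutRateInf b)
  rw [mul_zero] at h
  have hb1 : (1 : ℝ) ≤ b := by exact_mod_cast (by omega : 1 ≤ b)
  refine tendsto_of_tendsto_of_tendsto_of_le_of_le' tendsto_const_nhds h ?_ ?_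
  · filter_upwards [eventually_ge_atTop k] with n hn
    exact mul_nonneg (Nat.cast_nonneg n) (sub_nonneg.2 (cutAt_le_cutRate hb hn))
  · filter_upwards [eventually_ge_atTop k] with n hn
    rw [mul_left_comm]
    refine mul_le_mul_of_nonneg_left ((cutRate_sub_cutAt_le hb hn).trans ?_) (Nat.cast_nonneg n)
    refine mul_le_mul_of_nonneg_left (inv_anti₀ (by positivity) (pow_le_pow_right₀ hb1 (by omega)))
      (mul_nonneg (by norm_num) (cutRateInf_pos hb).le)

lemma tendsto_cutAt (hb : 2 ≤ b) (k : ℕ) :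
    Tendsto (fun n => cutAt b n k) atTop (𝓝 (cutRate b k)) := by
  have h : Tendsto (fun n => cutRate b k - cutAt b n k) atTop (𝓝 0) := by
    refine tendsto_of_tendsto_of_tendsto_of_le_of_le' tendsto_const_nhds
      (tendsto_natCast_mul_cutRate_sub hb k) ?_ ?_
    · filter_upwards [eventually_ge_atTop k] with n hn
      exact sub_nonneg.2 (cutAt_le_cutRate hb hn)
    · filter_upwards [eventually_ge_atTop k, eventually_ge_atTop 1] with n hn hn1
      exact le_mul_of_one_le_left (sub_nonneg.2 (cutAt_le_cutRate hb hn)) (by exact_mod_cast hn1)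
  simpa using h.const_sub (cutRate b k)

lemma tendsto_eventC_zero (hb : 2 ≤ b) (k : ℕ) {ε : ℝ} (hε : 0 < ε) {lam : ℕ → ℝ≥0}
    (hlam : ∀ᶠ n in atTop, (1 + ε) * (sigma b k * n) ≤ lam n) :
    Tendsto (fun n => (particleLaw b n (lam n)).real (eventC b n k)) atTop (𝓝 0) := by
  have hb1 : (1 : ℝ) ≤ b := by exact_mod_cast (by omega : 1 ≤ b)
  obtain ⟨δ, hδ, hC⟩ := exists_particleLaw_eventC_le hb k
  -- Half of `ε` is given up to replace `cutRate` by `cutAt`.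
  have hmu : ∀ᶠ n : ℕ in atTop, (1 + ε / 2) * (n * Real.log b) ≤ lam n * cutAt b n k := by
    have h1 : (1 + ε / 2) / (1 + ε) * cutRate b k < cutRate b k := by
      refine mul_lt_of_lt_one_left (cutRate_pos hb k) ?_
      rw [div_lt_one (by linarith)]
      linarith
    filter_upwards [hlam, (tendsto_cutAt hb k).eventually_const_le h1] with n h2 h3
    have h4 := mul_le_mul h2 h3
      (mul_nonneg (by positivity) (cutRate_pos hb k).le) (lam n).2
    refine le_trans (le_of_eq ?_) h4
    rw [← sigma_mul_cutRate hb k]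
    field_simp
  have h := (tendsto_pow_mul_exp hb (half_pos hε) hmu).const_mul (1 + 2 ^ b ^ k)
  rw [mul_zero] at h
  refine tendsto_of_tendsto_of_tendsto_of_le_of_le' tendsto_const_nhds h
    (Eventually.of_forall fun n => measureReal_nonneg) ?_
  filter_upwards [eventually_gt_atTop k] with n hn
  refine (hC n hn (lam n)).trans ?_
  have h1 := particleLaw_eventD_le hb hn (lam n)
  have h2 : (b : ℝ) ^ (n - k) ≤ (b : ℝ) ^ n := pow_le_pow_right₀ hb1 (Nat.sub_le _ _)
  have h3 : Real.exp (-(lam n * (cutAt b n k + δ))) ≤ Real.exp (-(lam n * cutAt b n k)) :=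
    Real.exp_le_exp.2 (neg_le_neg (mul_le_mul_of_nonneg_left (by linarith) (lam n).2))
  have h4 : (b : ℝ) ^ (n - k) * Real.exp (-(lam n * cutAt b n k)) ≤
      (b : ℝ) ^ n * Real.exp (-(lam n * cutAt b n k)) :=
    mul_le_mul_of_nonneg_right h2 (Real.exp_nonneg _)
  have h5 : (b : ℝ) ^ (n - k) * (2 ^ b ^ k * Real.exp (-(lam n * (cutAt b n k + δ)))) ≤
      (b : ℝ) ^ n * (2 ^ b ^ k * Real.exp (-(lam n * cutAt b n k))) := by
    gcongr
  linarith

/-- The second moment estimate below and at the threshold. -/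
lemma exists_second_moment_error (hb : 2 ≤ b) (k : ℕ) {lam : ℕ → ℝ≥0}
    (hlam : ∀ᶠ n in atTop, (lam n : ℝ) ≤ sigma b k * n) :
    ∃ e : ℕ → ℝ, Tendsto e atTop (𝓝 1) ∧ ∀ᶠ n in atTop, ∀ s : ℝ,
      2 * s - s ^ 2 * ((b : ℝ) ^ k * Real.exp (lam n * cutRate b k - n * Real.log b) + e n) ≤
        (particleLaw b n (lam n)).real (eventD b n k) := by
  have hb0 : (0 : ℝ) < b := by positivity
  have hb1 : (1 : ℝ) ≤ b := by exact_mod_cast (by omega : 1 ≤ b)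
  obtain ⟨η, hη, hD⟩ := exists_le_particleLaw_eventD hb k
  -- The minimum keeps `cutRate b k - η'` nonnegative, so that the upper bound for `λ` can be
  -- multiplied by it.
  set η' := min η (cutRate b k)
  have hη' : 0 < η' := lt_min hη (cutRate_pos hb k)
  have hσ : (0 : ℝ) < sigma b k := sigma_pos hb k
  set C : ℝ := sigma b k * (((b : ℝ) ^ k) ^ 2 * (2 * b))
  -- The first summand bounds the contribution of nearby distinct pairs, the second that of distant
  -- pairs; the diagonal is the exponential term in the statement.
  refine ⟨fun n => n * Real.exp (-(sigma b k * η' * n)) + Real.exp (C / n), ?_, ?_⟩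
  · have h1 := tendsto_natCast_mul_exp (mul_pos hσ hη')
    have h2 := (Real.continuous_exp.tendsto 0).comp (tendsto_const_div_atTop_nhds_zero_nat C)
    rw [Real.exp_zero] at h2
    simpa using h1.add h2
  · filter_upwards [hlam, eventually_gt_atTop (k + 2), eventually_ge_atTop (b ^ k)] with n hl hn hnk s
    -- With `b^h` between `n / b` and `n` there are at most `n` nearby partners per vertex, while `λ
    -- * tailWeight b n (h + 1)` is of order `1/n`.
    set h := Nat.log b n
    have hkh : k ≤ h := Nat.le_log_of_pow_le (by omega) hnk
    have hhn : h < n := Nat.log_lt_self b (by omega)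
    have hpow : (b : ℝ) ^ h ≤ n := by exact_mod_cast Nat.pow_log_le_self b (by omega)
    have hpow' : (n : ℝ) ≤ (b : ℝ) ^ (h + 1) := by
      exact_mod_cast (Nat.lt_pow_succ_log_self (by omega) n).le
    have hn0 : (0 : ℝ) < n := by exact_mod_cast (by omega : 0 < n)
    set M : ℝ := (b : ℝ) ^ (n - k)
    set l : ℝ := (lam n : ℝ)
    have hl0 : 0 ≤ l := (lam n).2
    set c := cutAt b n k
    have hc : c ≤ cutRate b k := cutAt_le_cutRate hb (by omega)
    set a := Real.exp (-(l * c))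
    have ha : 0 < a := Real.exp_pos _
    have hM : 0 < M := by positivity
    have hMn : (b : ℝ) ^ n = M * (b : ℝ) ^ k := by
      rw [← pow_add, Nat.sub_add_cancel (by omega)]
    have hMk : M⁻¹ = (b : ℝ) ^ k * Real.exp (-(n * Real.log b)) := by
      rw [Real.exp_neg, ← pow_eq_exp hb, ← div_eq_mul_inv, eq_div_iff (by positivity), hMn]
      exact inv_mul_cancel_left₀ hM.ne' _
    -- Here `M * a` is the expected number of vertices of height `k` that no edge leaves, so `s` is
    -- `t` in units of its inverse.
    refine le_trans ?_ (hD n h hn hkh hhn (lam n) (s / (M * a)))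
    have e1 : Real.exp (-(l * (c + η))) = a ^ 2 * Real.exp (l * (c - η)) := by
      rw [← Real.exp_nat_mul, ← Real.exp_add]; congr 1; push_cast; ring
    have e2 : Real.exp (-(l * (2 * c - ((b : ℝ) ^ k) ^ 2 * tailWeight b n (h + 1)))) =
        a ^ 2 * Real.exp (l * (((b : ℝ) ^ k) ^ 2 * tailWeight b n (h + 1))) := by
      rw [← Real.exp_nat_mul, ← Real.exp_add]; congr 1; push_cast; ring
    have e3 : a⁻¹ = Real.exp (l * c) := by rw [← Real.exp_neg, neg_neg]
    change _ ≤ 2 * (s / (M * a)) * (M * a) - (s / (M * a)) ^ 2 * (M * (a +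
      (b : ℝ) ^ (h - k) * Real.exp (-(l * (c + η))) +
      M * Real.exp (-(l * (2 * c - ((b : ℝ) ^ k) ^ 2 * tailWeight b n (h + 1))))))
    rw [e1, e2]
    have e4 : 2 * (s / (M * a)) * (M * a) - (s / (M * a)) ^ 2 * (M * (a +
        (b : ℝ) ^ (h - k) * (a ^ 2 * Real.exp (l * (c - η))) +
        M * (a ^ 2 * Real.exp (l * (((b : ℝ) ^ k) ^ 2 * tailWeight b n (h + 1)))))) =
        2 * s - s ^ 2 * (M⁻¹ * a⁻¹ + (b : ℝ) ^ (h - k) * M⁻¹ * Real.exp (l * (c - η)) +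
          Real.exp (l * (((b : ℝ) ^ k) ^ 2 * tailWeight b n (h + 1)))) := by
      field_simp
    rw [e4]
    refine sub_le_sub_left (mul_le_mul_of_nonneg_left ?_ (sq_nonneg s)) _
    rw [← add_assoc]
    refine add_le_add (add_le_add ?_ ?_) ?_
    · rw [hMk, e3, mul_assoc, ← Real.exp_add]
      refine mul_le_mul_of_nonneg_left (Real.exp_le_exp.2 ?_) (by positivity)
      have := mul_le_mul_of_nonneg_left hc hl0
      linarith
    · have h1 : l * (c - η) ≤ n * Real.log b - sigma b k * η' * n := by
        have h2 : l * (c - η) ≤ l * (cutRate b k - η') :=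
          mul_le_mul_of_nonneg_left (sub_le_sub hc (min_le_left _ _)) hl0
        have h3 := mul_le_mul_of_nonneg_right hl (sub_nonneg.2 (min_le_right η (cutRate b k)))
        refine h2.trans (h3.trans (le_of_eq ?_))
        rw [← sigma_mul_cutRate hb k]
        ring
      calc (b : ℝ) ^ (h - k) * M⁻¹ * Real.exp (l * (c - η))
          = (b : ℝ) ^ h * (Real.exp (-(n * Real.log b)) * Real.exp (l * (c - η))) := by
            rw [hMk, ← Nat.sub_add_cancel hkh, pow_add, Nat.add_sub_cancel]
            ring
        _ ≤ n * Real.exp (-(sigma b k * η' * n)) := by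
            rw [← Real.exp_add]
            refine mul_le_mul hpow (Real.exp_le_exp.2 (by linarith)) (Real.exp_nonneg _) hn0.le
    · refine Real.exp_le_exp.2 ?_
      have h1 : tailWeight b n (h + 1) ≤ 2 * b / (n : ℝ) ^ 2 := by
        refine (tailWeight_le hb (Nat.succ_ne_zero h) hhn).trans ?_
        refine div_le_div_of_nonneg_left (by positivity) (by positivity) ?_
        rw [mul_comm 2, pow_mul]
        exact pow_le_pow_left₀ hn0.le hpow' 2
      calc l * (((b : ℝ) ^ k) ^ 2 * tailWeight b n (h + 1))
          ≤ (sigma b k * n) * (((b : ℝ) ^ k) ^ 2 * (2 * b / (n : ℝ) ^ 2)) := by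
            refine mul_le_mul hl (mul_le_mul_of_nonneg_left h1 (by positivity)) ?_ (by positivity)
            exact mul_nonneg (by positivity) (tailWeight_nonneg hb (Nat.succ_ne_zero h))
        _ = C / n := by
            simp only [C]
            field_simp

lemma tendsto_eventD_one (hb : 2 ≤ b) (k : ℕ) {ε : ℝ} (hε : 0 < ε) {lam : ℕ → ℝ≥0}
    (hlam : ∀ᶠ n in atTop, (lam n : ℝ) ≤ (1 - ε) * (sigma b k * n)) :
    Tendsto (fun n => (particleLaw b n (lam n)).real (eventD b n k)) atTop (𝓝 1) := by
  have hσ : (0 : ℝ) < sigma b k := sigma_pos hb k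
  obtain ⟨e, he, hD⟩ := exists_second_moment_error hb k (lam := lam) (by
    filter_upwards [hlam] with n hn
    refine hn.trans (mul_le_of_le_one_left (by positivity) (by linarith)))
  have h1 : Tendsto (fun n : ℕ => (b : ℝ) ^ k * Real.exp (lam n * cutRate b k - n * Real.log b))
      atTop (𝓝 0) := by
    have h2 : Tendsto (fun n : ℕ => (b : ℝ) ^ k * Real.exp (-(ε * Real.log b) * n)) atTop (𝓝 0) := by
      rw [← mul_zero ((b : ℝ) ^ k)]
      refine Tendsto.const_mul _ (Real.tendsto_exp_atBot.comp ?_)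
      exact (tendsto_natCast_atTop_atTop).const_mul_atTop_of_neg
        (neg_lt_zero.2 (mul_pos hε (log_base_pos hb)))
    refine tendsto_of_tendsto_of_tendsto_of_le_of_le' tendsto_const_nhds h2
      (Eventually.of_forall fun n => by positivity) ?_
    filter_upwards [hlam] with n hn
    refine mul_le_mul_of_nonneg_left (Real.exp_le_exp.2 ?_) (by positivity)
    have := mul_le_mul_of_nonneg_right hn (cutRate_pos hb k).le
    have h3 : (1 - ε) * (sigma b k * n) * cutRate b k = (1 - ε) * (n * Real.log b) := by
      rw [← sigma_mul_cutRate hb k]; ring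
    linarith
  have h4 := (h1.add he).const_sub 2
  norm_num at h4
  refine tendsto_of_tendsto_of_tendsto_of_le_of_le' h4 tendsto_const_nhds ?_
    (Eventually.of_forall fun n => measureReal_le_one)
  filter_upwards [hD] with n hn
  -- At `s = 1` the lower bound tends to `2 - 1`, since the diagonal term vanishes in the limit.
  have := hn 1
  linarith

lemma tendsto_eventC_one (hb : 2 ≤ b) (k : ℕ) {ε : ℝ} (hε : 0 < ε) {lam : ℕ → ℝ≥0}
    (hlam : ∀ᶠ n in atTop, (lam n : ℝ) ≤ (1 - ε) * (sigma b k * n)) :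
    Tendsto (fun n => (particleLaw b n (lam n)).real (eventC b n k)) atTop (𝓝 1) :=
  tendsto_of_tendsto_of_tendsto_of_le_of_le (tendsto_eventD_one hb k hε hlam) tendsto_const_nhds
    (fun _ => measureReal_mono (eventD_subset_eventC (by omega))) fun _ => measureReal_le_one

lemma tendsto_eventD_zero (hb : 2 ≤ b) (k : ℕ) {ε : ℝ} (hε : 0 < ε) {lam : ℕ → ℝ≥0}
    (hlam : ∀ᶠ n in atTop, (1 + ε) * (sigma b k * n) ≤ lam n) :
    Tendsto (fun n => (particleLaw b n (lam n)).real (eventD b n k)) atTop (𝓝 0) :=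
  tendsto_of_tendsto_of_tendsto_of_le_of_le tendsto_const_nhds (tendsto_eventC_zero hb k hε hlam)
    (fun _ => measureReal_nonneg) fun _ => measureReal_mono (eventD_subset_eventC (by omega))

/-- As `σ_k → σ_crit`, some fixed `k` has its threshold above the given parameters with room to
spare, and `D_k` excludes connectedness. -/
lemma tendsto_eventConnected_zero (hb : 2 ≤ b) {ε : ℝ} (hε : 0 < ε) {lam : ℕ → ℝ≥0}
    (hlam : ∀ᶠ n in atTop, (lam n : ℝ) ≤ (1 - ε) * (sigmaCrit b * n)) :
    Tendsto (fun n => (particleLaw b n (lam n)).real (eventConnected b n)) atTop (𝓝 0) := by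
  set ε' := min ε 1 / 2
  have hε' : 0 < ε' := half_pos (lt_min hε one_pos)
  have hε'ε : ε' < ε := (half_lt_self (lt_min hε one_pos)).trans_le (min_le_left _ _)
  have h1 : (1 - ε) * sigmaCrit b < (1 - ε') * sigmaCrit b :=
    mul_lt_mul_of_pos_right (by linarith) (sigmaCrit_pos hb)
  obtain ⟨k, hk⟩ := (((tendsto_sigma hb).const_mul (1 - ε')).eventually_const_le h1).exists
  have h2 := tendsto_eventD_one hb k hε' (lam := lam) (by
    filter_upwards [hlam] with n hn
    have := mul_le_mul_of_nonneg_right hk (Nat.cast_nonneg n : (0 : ℝ) ≤ n)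
    linarith)
  have h3 := h2.const_sub 1
  rw [sub_self] at h3
  refine tendsto_of_tendsto_of_tendsto_of_le_of_le' tendsto_const_nhds h3
    (Eventually.of_forall fun n => measureReal_nonneg) ?_
  filter_upwards [eventually_gt_atTop k] with n hn
  rw [← probReal_compl_eq_one_sub (measurableSet_eventD hn.le)]
  exact measureReal_mono (Set.subset_compl_iff_disjoint_right.2 (eventConnected_disjoint_eventD hb hn))

lemma tendsto_eventConnected_one (hb : 2 ≤ b) {ε : ℝ} (hε : 0 < ε) {lam : ℕ → ℝ≥0}
    (hlam : ∀ᶠ n in atTop, (1 + ε) * (sigmaCrit b * n) ≤ lam n) :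
    Tendsto (fun n => (particleLaw b n (lam n)).real (eventConnected b n)) atTop (𝓝 1) := by
  have h0 := pow_sub_one_pos hb one_ne_zero
  rw [pow_one] at h0
  have hb0 : (0 : ℝ) < b := by positivity
  -- the distance to the ancestor
  have hK : Tendsto (fun K : ℕ => (1 + ε) * (1 - 3 / ((K : ℝ) + 1))) atTop (𝓝 (1 + ε)) := by
    have h1 : Tendsto (fun K : ℕ => 3 / ((K : ℝ) + 1)) atTop (𝓝 0) :=
      tendsto_const_nhds.div_atTop (tendsto_natCast_atTop_atTop.atTop_add tendsto_const_nhds)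
    simpa using (h1.const_sub 1).const_mul (1 + ε)
  obtain ⟨K, hK, hK0⟩ := ((hK.eventually_const_le (by linarith : 1 + ε / 2 < 1 + ε)).and
    (eventually_ne_atTop 0)).exists
  have hK3 : 0 ≤ 1 - 3 / ((K : ℝ) + 1) := by
    by_contra hneg
    have : (1 + ε) * (1 - 3 / ((K : ℝ) + 1)) ≤ 0 :=
      mul_nonpos_of_nonneg_of_nonpos (by linarith) (not_le.1 hneg).le
    linarith
  have h1 := (tendsto_natCast_mul_pow_mul_exp hb (half_pos hε)
    (μ := fun n => lam n * (cutRateInf b * (1 - 3 / ((K : ℝ) + 1)))) (by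
      filter_upwards [hlam] with n hn
      have h2 := mul_le_mul_of_nonneg_right hn (mul_nonneg (cutRateInf_pos hb).le hK3)
      refine le_trans ?_ h2
      have h3 : (1 + ε) * (sigmaCrit b * n) * (cutRateInf b * (1 - 3 / ((K : ℝ) + 1))) =
          ((1 + ε) * (1 - 3 / ((K : ℝ) + 1))) * (n * Real.log b) := by
        rw [← sigmaCrit_mul_cutRateInf hb]; ring
      rw [h3]
      exact mul_le_mul_of_nonneg_right hK
        (mul_nonneg (Nat.cast_nonneg n) (log_base_pos hb).le))).const_mul ((2 : ℝ) ^ b ^ (K + 1))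
  set κ : ℝ := ((b : ℝ) - 1) ^ 2 / (b : ℝ) ^ 3
  have hκ : 0 < κ := by positivity
  have h2 := (tendsto_natCast_mul_exp (mul_pos (mul_pos (by linarith : 0 < 1 + ε) (sigmaCrit_pos hb))
    hκ)).const_mul ((b : ℝ) ^ (2 * K) * 2 ^ b)
  have h3 := (h1.add h2).const_sub 1
  simp only [mul_zero, add_zero, sub_zero] at h3
  refine tendsto_of_tendsto_of_tendsto_of_le_of_le' h3 tendsto_const_nhds ?_
    (Eventually.of_forall fun n => measureReal_le_one)
  filter_upwards [hlam] with n hn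
  have h4 := particleLaw_eventConnected_compl_le (n := n) hb (lam n) hK0
  -- Subadditivity is enough here and does not require the event to be measurable.
  have h5 : (1 : ℝ) ≤ (particleLaw b n (lam n)).real (eventConnected b n) +
      (particleLaw b n (lam n)).real (eventConnected b n)ᶜ := by
    rw [← probReal_univ (μ := particleLaw b n (lam n)), ← Set.union_compl_self (eventConnected b n)]
    exact measureReal_union_le _ _
  have h6 : Real.exp (-(lam n * κ)) ≤ Real.exp (-((1 + ε) * sigmaCrit b * κ * n)) := by
    refine Real.exp_le_exp.2 (neg_le_neg ?_)
    have := mul_le_mul_of_nonneg_right hn hκ.le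
    linarith
  have h7 : (n : ℝ) * ((b : ℝ) ^ (2 * K) * (2 ^ b * Real.exp (-(lam n * κ)))) ≤
      (b : ℝ) ^ (2 * K) * 2 ^ b * (n * Real.exp (-((1 + ε) * sigmaCrit b * κ * n))) := by
    have := mul_le_mul_of_nonneg_left h6
      (by positivity : (0 : ℝ) ≤ (b : ℝ) ^ (2 * K) * 2 ^ b * n)
    linarith
  linarith

/-- At the threshold the probability is bounded away from `0` and `1`. -/
lemma exists_bounds_at_threshold (hb : 2 ≤ b) (k : ℕ) :
    ∃ c : ℝ, 0 < c ∧ ∀ᶠ n : ℕ in atTop,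
      (particleLaw b n (sigma b k * n)).real (eventC b n k) ∈ Set.Icc c (1 - c) ∧
      (particleLaw b n (sigma b k * n)).real (eventD b n k) ∈ Set.Icc c (1 - c) := by
  have hb0 : (0 : ℝ) < b := by positivity
  have hb2 : (2 : ℝ) ≤ b := by exact_mod_cast hb
  have hσ : (0 : ℝ) < sigma b k := sigma_pos hb k
  have hcoe : ∀ n : ℕ, ((sigma b k * n : ℝ≥0) : ℝ) = sigma b k * n := fun n => by push_cast; rfl
  -- lower bound
  set s : ℝ := ((b : ℝ) ^ k + 2)⁻¹
  have hs : 0 < s := by positivity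
  have hlow : ∀ᶠ n : ℕ in atTop, s ≤ (particleLaw b n (sigma b k * n)).real (eventD b n k) := by
    obtain ⟨e, he, hD⟩ := exists_second_moment_error hb k (lam := fun n => sigma b k * n)
      (Eventually.of_forall fun n => (hcoe n).le)
    filter_upwards [hD, he.eventually_le_const (by norm_num : (1 : ℝ) < 2)] with n h1 h2
    refine le_trans ?_ (h1 s)
    have h3 : (sigma b k : ℝ) * n * cutRate b k - n * Real.log b = 0 := by
      rw [← sigma_mul_cutRate hb k]; ring
    rw [hcoe, h3, Real.exp_zero, mul_one]
    -- Eventually `e n ≤ 2`, and `s = 1/(b^k + 2)` maximises `2s - s^2 (b^k + 2)`, with maximum `s`.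
    have h4 : s ^ 2 * ((b : ℝ) ^ k + e n) ≤ s ^ 2 * ((b : ℝ) ^ k + 2) :=
      mul_le_mul_of_nonneg_left (by linarith) (sq_nonneg s)
    have h5 : s ^ 2 * ((b : ℝ) ^ k + 2) = s := by
      simp only [s]
      field_simp
    linarith
  -- upper bound for `D`
  set q₀ : ℝ := ((b : ℝ) + 1) / b ^ 2
  have hq₀ : 0 < q₀ := by positivity
  have hq₀1 : q₀ < 1 := by
    rw [div_lt_one (by positivity)]
    nlinarith
  have hq₀2 : (b - 1) * q₀ < 1 := by
    rw [mul_div_assoc', div_lt_one (by positivity)]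
    nlinarith
  set c₁ : ℝ := (1 - q₀) * (1 - (b - 1) * q₀)
  have hc₁ : 0 < c₁ := mul_pos (by linarith) (by linarith)
  have hup : ∀ᶠ n : ℕ in atTop,
      (particleLaw b n (sigma b k * n)).real (eventD b n k) ≤ 1 - c₁ := by
    have h1 : Tendsto (fun n : ℕ => Real.exp (sigma b k * (n * (cutRate b k - cutAt b n k)) +
        sigma b k * ((b : ℝ) ^ k * cutRate b 0) * (n * ((b : ℝ) ^ (n - 1))⁻¹))) atTop (𝓝 1) := by
      have h2 := ((tendsto_natCast_mul_cutRate_sub hb k).const_mul (sigma b k : ℝ)).add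
        ((tendsto_natCast_mul_inv_pow hb 1).const_mul (sigma b k * ((b : ℝ) ^ k * cutRate b 0)))
      rw [mul_zero, mul_zero, add_zero] at h2
      have h3 := (Real.continuous_exp.tendsto 0).comp h2
      rwa [Real.exp_zero] at h3
    filter_upwards [h1.eventually_le_const (by
      have : (0 : ℝ) < 1 / b := by positivity
      linarith : (1 : ℝ) < 1 + 1 / b), eventually_gt_atTop (k + 1)] with n h2 h3
    set q : ℝ := (b : ℝ) ^ (n - 1 - k) * Real.exp (-((sigma b k * n : ℝ≥0) *
      (cutAt b n k - (b : ℝ) ^ k * (cutRate b 0 / (b : ℝ) ^ (n - 1)))))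
    -- At the threshold `q` is `exp(o(1)) / b^(k+1)`. Allowing a factor `1 + 1/b` gives `q₀ = (1 +
    -- 1/b)/b`, which still has `(b - 1) q₀ = 1 - 1/b^2 < 1`.
    have hqq : q ≤ q₀ := by
      have e1 : (b : ℝ) ^ (n - 1 - k) = Real.exp (n * Real.log b) / (b : ℝ) ^ (k + 1) := by
        rw [← pow_eq_exp hb, eq_div_iff (by positivity), ← pow_add]
        congr 1
        omega
      have e2 : q = Real.exp (sigma b k * (n * (cutRate b k - cutAt b n k)) +
          sigma b k * ((b : ℝ) ^ k * cutRate b 0) * (n * ((b : ℝ) ^ (n - 1))⁻¹)) /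
            (b : ℝ) ^ (k + 1) := by
        simp only [q]
        rw [e1, hcoe, div_mul_eq_mul_div, ← Real.exp_add]
        congr 2
        rw [← sigma_mul_cutRate hb k]
        field_simp
        ring
      rw [e2]
      calc _ ≤ (1 + 1 / (b : ℝ)) / (b : ℝ) ^ (k + 1) :=
            div_le_div_of_nonneg_right h2 (by positivity)
        _ ≤ (1 + 1 / (b : ℝ)) / b :=
            div_le_div_of_nonneg_left (by positivity) hb0
              (le_self_pow₀ (by linarith) (Nat.succ_ne_zero k))
        _ = q₀ := by simp only [q₀]; field_simp
    have hq2 : (b - 1) * q ≤ (b - 1) * q₀ := mul_le_mul_of_nonneg_left hqq (by linarith)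
    refine (particleLaw_eventD_le_of_indep hb h3 _ (q := q) rfl (by linarith) (by linarith)).trans ?_
    exact sub_le_sub_left (mul_le_mul (by linarith) (by linarith) (by linarith) (by linarith)) 1
  -- upper bound for `C`
  have hC : ∀ᶠ n : ℕ in atTop,
      (particleLaw b n (sigma b k * n)).real (eventC b n k) ≤ 1 - c₁ / 2 := by
    obtain ⟨δ, hδ, hC⟩ := exists_particleLaw_eventC_le hb k
    -- The isoperimetric `δ` makes partial components exponentially unlikely even at the threshold,
    -- where `C_k` and `D_k` thus have nearly the same probability.
    have hmu : ∀ᶠ n : ℕ in atTop, (1 + δ / (2 * cutRate b k)) * (n * Real.log b) ≤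
        (sigma b k * n : ℝ≥0) * (cutAt b n k + δ) := by
      have hck := cutRate_pos hb k
      filter_upwards [(tendsto_cutAt hb k).eventually_const_le
        (by linarith : cutRate b k - δ / 2 < cutRate b k)] with n h1
      rw [hcoe, ← sigma_mul_cutRate hb k]
      have h2 : (1 + δ / (2 * cutRate b k)) * (n * (sigma b k * cutRate b k)) =
          sigma b k * n * (cutRate b k + δ / 2) := by
        field_simp
      rw [h2]
      exact mul_le_mul_of_nonneg_left (by linarith) (by positivity)
    have h1 := (tendsto_pow_mul_exp hb (div_pos hδ (mul_pos two_pos (cutRate_pos hb k))) hmu).const_mul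
      ((2 : ℝ) ^ b ^ k)
    rw [mul_zero] at h1
    filter_upwards [hup, h1.eventually_le_const (half_pos hc₁), eventually_gt_atTop k] with n h2 h3 h4
    refine (hC n h4 _).trans ?_
    have h5 : (b : ℝ) ^ (n - k) * (2 ^ b ^ k *
        Real.exp (-((sigma b k * n : ℝ≥0) * (cutAt b n k + δ)))) ≤ (b : ℝ) ^ n * (2 ^ b ^ k *
        Real.exp (-((sigma b k * n : ℝ≥0) * (cutAt b n k + δ)))) :=
      mul_le_mul_of_nonneg_right (pow_le_pow_right₀ (by linarith) (Nat.sub_le _ _)) (by positivity)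
    linarith
  refine ⟨min s (c₁ / 2), lt_min hs (half_pos hc₁), ?_⟩
  filter_upwards [hlow, hup, hC] with n h1 h2 h3
  have h4 : (particleLaw b n (sigma b k * n)).real (eventD b n k) ≤
      (particleLaw b n (sigma b k * n)).real (eventC b n k) :=
    measureReal_mono (eventD_subset_eventC (by omega))
  have h5 := min_le_left s (c₁ / 2)
  have h6 := min_le_right s (c₁ / 2)
  exact ⟨⟨by linarith, by linarith⟩, ⟨by linarith, by linarith⟩⟩

end Asymptotics

/-! ### The main theorem -/

theorem mainTheorem4 (b : ℕ) (hb : 2 ≤ b) :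
    ∃ σ : ℕ → ℝ≥0, 0 < σ 0 ∧ StrictMono σ ∧
      Tendsto (fun k => (σ k : ℝ)) atTop (𝓝 (sigmaCrit b)) ∧
      (∀ k : ℕ,
        IsSharpThreshold (fun n lam => (particleLaw b n lam).real (eventC b n k))
          (fun n => (σ k : ℝ) * n) 1 0 ∧
        IsSharpThreshold (fun n lam => (particleLaw b n lam).real (eventD b n k))
          (fun n => (σ k : ℝ) * n) 1 0) ∧
      IsSharpThreshold (fun n lam => (particleLaw b n lam).real (eventConnected b n))
        (fun n => sigmaCrit b * n) 0 1 ∧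
      (∀ k : ℕ, ∃ c : ℝ, 0 < c ∧ ∀ᶠ n : ℕ in atTop,
        (particleLaw b n (σ k * n)).real (eventC b n k) ∈ Set.Icc c (1 - c) ∧
        (particleLaw b n (σ k * n)).real (eventD b n k) ∈ Set.Icc c (1 - c)) ∧
      IsSharpThreshold (fun n lam => (particleLaw b n lam).real (eventIsolated b n))
        (fun n => (σ 0 : ℝ) * n) 1 0 ∧
      (σ 0 : ℝ) < sigmaCrit b := by
  have hD : ∀ k, IsSharpThreshold (fun n lam => (particleLaw b n lam).real (eventD b n k))
      (fun n => (sigma b k : ℝ) * n) 1 0 := fun k ε hε lam =>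
    ⟨tendsto_eventD_one hb k hε, tendsto_eventD_zero hb k hε⟩
  refine ⟨sigma b, sigma_pos hb 0, strictMono_sigma hb, tendsto_sigma hb, fun k => ⟨fun ε hε lam =>
    ⟨tendsto_eventC_one hb k hε, tendsto_eventC_zero hb k hε⟩, hD k⟩, fun ε hε lam =>
    ⟨tendsto_eventConnected_zero hb hε, tendsto_eventConnected_one hb hε⟩,
    exists_bounds_at_threshold hb, ?_, sigma_lt_sigmaCrit hb 0⟩
  simp_rw [eventIsolated_eq]
  exact hD 0
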